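/- Let $a_i,b_j\in[0,1]$ ($i,j\ge 1$) satisfy $0<a_ib_j<1$, and let $\omega(i,j)$ be independent geometric random variables, $\Pr(\omega(i,j)=k)=(1-a_ib_j)(a_ib_j)^k$ for $k=0,1,2,\dots$. Let $\mathbf G(m,n)=\max\{\mathbf G(m-1,n),\mathbf G(m,n-1)\}+\omega(m,n)$ for $m,n\ge 1$, with zero boundary and initial condition $\mathbf G(m,0)=\mathbf G(0,n)=0$. Fix integers $1\le n<N$, $1\le m<M$ and $h,H\in\mathbb Z$. Write $[k]=\{1,\dots,k\}$ and, for $z\in\mathbb C$, $h\in\mathbb Z$, $S\subset[N]$, $T\subset[M]$, $$G(z\,|\,S,T,h)=z^h\prod_{k\in S}(z-1/b_k)\prod_{k\in T}(1-a_k/z)^{-1}.$$ All contours are circles oriented counter-clockwise. Let $\gamma_b$ enclose all the points $1/b_k$, $k\in[N]$, and let $\Gamma,\Gamma_{\rm out},\Gamma_{\rm in}$ each enclose $0$ and all the points $a_k$, $k\in[M]$, where $\Gamma_{\rm in}$ lies strictly inside $\Gamma_{\rm out}$ and the closed disc bounded by $\gamma_b$ is disjoint from the closed discs bounded by $\Gamma$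 and $\Gamma_{\rm out}$. For $i,j\in[N]$ let $$J_1(i,j)=\mathbf 1_{\{j\le n\}}\frac1{(2\pi \mathrm i)^2}\oint_{\gamma_b}d\zeta\oint_{\Gamma}dz\,\frac{G(z|[j-1],[m],h-1)}{G(\zeta|[i],[m],h-1)(z-\zeta)},$$ $$J_2(i,j)=\mathbf 1_{\{i>n\}}\frac1{(2\pi \mathrm i)^2}\oint_{\gamma_b}d\omega\oint_{\Gamma}dw\,\frac{G(w|[N]\setminus[i],[M]\setminus[m],H-h)}{G(\omega|[N]\setminus[j-1],[M]\setminus[m],H-h)(w-\omega)},$$ $$J_3(i,j)=\frac1{(2\pi \mathrm i)^4}\oint_{\gamma_b}d\zeta\oint_{\gamma_b}d\omega\oint_{\Gamma_{\rm out}}dz\oint_{\Gamma_{\rm in}}dw\,\frac{G(z|[n],[m],h-1)\,G(w|[N]\setminus[n],[M]\setminus[m],H-h)}{G(\zeta|[i],[m],h-1)\,G(\omega|[N]\setminus[j-1],[M]\setminus[m],H-h)(z-\zeta)(w-\omega)(z-w)},$$ and let $J_4$ be the same as $J_3$ but with $z\in\Gamma_{\rm in}$ and $w\in\Gamma_{\rm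 out}$. Put $F_1=J_1-J_2+J_3$ and $F_2=J_2-J_1-J_4$. Then: (1) For every $s>1$, $$\Pr\big(\mathbf G(m,n)<h,\ \mathbf G(M,N)<H\big)=\frac1{2\pi \mathrm i}\oint_{|\theta|=s}\frac{\det\big(I+\theta^{\mathbf 1\{i>n\}}F_1+\theta^{-\mathbf 1\{i\le n\}}F_2\big)_{i,j=1}^N}{\theta-1}\,d\theta .$$ (2) $F_2$ is related to $F_1$ by complementation: when $F_1(i,j)$ is regarded as a function of $[i],[j-1],[n],[m],h-1$ (for given $[N],[M],H$; $\mathbf 1_{\{j\le n\}}$ and $\mathbf 1_{\{i>n\}}$ are read as $\mathbf 1_{\{\#[j-1]+1\le\#[n]\}}$ and $\mathbf 1_{\{\#[i]>\#[n]\}}$, and $H-h$ as $H-1-(h-1)$), replacing these by $[N]\setminus[j-1],\ [N]\setminus[i],\ [N]\setminus[n],\ [M]\setminus[m],\ H-h$ respectively gives $F_2(i,j)$. (3) The $N\times N$ matrices $$A(i,j)=\frac1{2\pi \mathrm i}\oint_{\gamma_b}d\zeta\,\frac{\prod_{k\in[j-1]}(\zeta-1/b_k)}{\prod_{k\in[i]}(\zeta-1/b_k)}(b_j\zeta)^{1-h}\prod_{k\in[m]}\frac{1-a_k/\zeta}{1-a_kb_j},$$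 $$B(i,j)=\frac1{2\pi \mathrm i}\oint_{\gamma_b}d\omega\,\frac{\prod_{k\in[j-1]}(\omega-1/b_k)}{\prod_{k\in[i]}(\omega-1/b_k)}(b_i\omega)^{h-H}\prod_{k\in[M]\setminus[m]}\frac{1-a_k/\omega}{1-a_kb_i}$$ are lower triangular with ones on the diagonal. If $$L_1(i,j)=\frac1{(2\pi \mathrm i)^2}\oint_{|z|=R_1}dz\oint_{|w|=R_2}dw\,\frac{(b_iz)^{h-1}(b_jw)^{H-h}}{z-w}\,\frac{\prod_{k\in[n]}(z-1/b_k)}{\prod_{k\in[i]}(z-1/b_k)}\,\frac{\prod_{k\in[j-1]}(w-1/b_k)}{\prod_{k\in[n]}(w-1/b_k)}\prod_{k\in[m]}\frac{1-a_kb_i}{1-a_k/z}\prod_{k\in[M]\setminus[m]}\frac{1-a_kb_j}{1-a_k/w}$$ with $R_1>R_2>\max_{k\in[N]}1/b_k$, and $L_2$ is given by the same formula with $R_2>R_1>\max_{k\in[N]}1/b_k$, then $(AL_1B)(i,j)=\mathbf 1_{\{i=j\le n\}}+F_1(i,j)$ and $-(AL_2B)(i,j)=\mathbf 1_{\{i=j>n\}}+F_2(i,j)$.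 -/

import Mathlib

open scoped BigOperators

noncomputable section

namespace TwoTime

/-- The growth function: `G(m, 0) = 0`, `G(0, n) = x n` for `n ≥ 1`, and
`G(m, n) = max (G(m - 1, n)) (G(m, n - 1)) + w m n` for `m, n ≥ 1`. -/
def growth (x : ℕ → ℤ) (w : ℕ → ℕ → ℕ) : ℕ → ℕ → ℤ
  | _, 0 => 0
  | 0, n + 1 => x (n + 1)
  | m + 1, n + 1 =>
      max (growth x w m (n + 1)) (growth x w (m + 1) n) + (w (m + 1) (n + 1) : ℤ)

/-- A circular contour, oriented counter-clockwise. -/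
structure Contour where
  /-- the centre of the circle -/
  center : ℂ
  /-- the radius of the circle -/
  radius : ℝ

namespace Contour

/-- The open disc bounded by the contour. -/
def inside (C : Contour) : Set ℂ := Metric.ball C.center C.radius

/-- The closed disc bounded by the contour. -/
def disc (C : Contour) : Set ℂ := Metric.closedBall C.center C.radius

/-- The contour integral `(1 / 2πi) ∮ f(z) dz`. -/
def integral (C : Contour) (f : ℂ → ℂ) : ℂ :=
  (2 * (Real.pi : ℂ) * Complex.I)⁻¹ * ∮ z in C(C.center, C.radius), f z

/-- The origin-centred circle of radius `R`. -/
def centered (R : ℝ) : Contour := ⟨0, R⟩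

end Contour

/-- The set `[k] = {1, …, k}`. -/
def seg (k : ℕ) : Finset ℕ := Finset.Icc 1 k

/-- The matrix `(f(i, j))` with rows and columns indexed by `1, …, N`. -/
def toMatrix (N : ℕ) (f : ℕ → ℕ → ℂ) : Matrix (Fin N) (Fin N) ℂ :=
  Matrix.of fun i j => f (i.val + 1) (j.val + 1)

/-- `G(z | S, T, h) = z ^ h ∏_{k ∈ S} (z - 1 / b_k) ∏_{k ∈ T} (1 - a_k / z)⁻¹`. -/
def G (a b : ℕ → ℝ) (z : ℂ) (S T : Finset ℕ) (h : ℤ) : ℂ :=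
  z ^ h * (∏ k ∈ S, (z - 1 / (b k : ℂ))) * ∏ k ∈ T, (1 - (a k : ℂ) / z)⁻¹

/-- The double integral
`∮_γ dζ ∮_Γ dz G(z | S, T, g) / (G(ζ | S', T, g) (z - ζ))` (with a factor `1 / 2πi` for each). -/
def double (a b : ℕ → ℝ) (γ Γ : Contour) (S S' T : Finset ℕ) (g : ℤ) : ℂ :=
  γ.integral fun ζ => Γ.integral fun z =>
    G a b z S T g / (G a b ζ S' T g * (z - ζ))

/-- The quadruple integral over `ζ, ω ∈ γ`, `z ∈ Γz`, `w ∈ Γw` of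
`G(z | S, T, g) G(w | R, U, g') /
  (G(ζ | S', T, g) G(ω | R', U, g') (z - ζ) (w - ω) (z - w))`
(with a factor `1 / 2πi` for each). -/
def quadruple (a b : ℕ → ℝ) (γ Γz Γw : Contour)
    (S S' T : Finset ℕ) (g : ℤ) (R R' U : Finset ℕ) (g' : ℤ) : ℂ :=
  γ.integral fun ζ => γ.integral fun ω => Γz.integral fun z => Γw.integral fun w =>
    G a b z S T g * G a b w R U g' /
      (G a b ζ S' T g * G a b ω R' U g' * (z - ζ) * (w - ω) * (z - w))

/-- The entry `J₁(i, j)`. -/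
def J₁ (a b : ℕ → ℝ) (n m : ℕ) (h : ℤ) (γ Γ : Contour) (i j : ℕ) : ℂ :=
  if j ≤ n then double a b γ Γ (seg (j - 1)) (seg i) (seg m) (h - 1) else 0

/-- The entry `J₂(i, j)`. -/
def J₂ (a b : ℕ → ℝ) (n N m M : ℕ) (h H : ℤ) (γ Γ : Contour) (i j : ℕ) : ℂ :=
  if n < i then
    double a b γ Γ (seg N \ seg i) (seg N \ seg (j - 1)) (seg M \ seg m) (H - h)
  else 0

/-- The common form of `J₃(i, j)` and `J₄(i, j)`, in which `z` runs over `Γz` and `w` over `Γw`: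
it is `J₃` when `Γw` is inside `Γz`, and `J₄` when `Γz` is inside `Γw`. -/
def J₃₄ (a b : ℕ → ℝ) (n N m M : ℕ) (h H : ℤ) (γ Γz Γw : Contour) (i j : ℕ) : ℂ :=
  quadruple a b γ Γz Γw (seg n) (seg i) (seg m) (h - 1)
    (seg N \ seg n) (seg N \ seg (j - 1)) (seg M \ seg m) (H - h)

/-- `F₁ = J₁ - J₂ + J₃`; the contour `Γin` is meant to lie inside `Γout`. -/
def F₁ (a b : ℕ → ℝ) (n N m M : ℕ) (h H : ℤ) (γ Γ Γout Γin : Contour) (i j : ℕ) : ℂ :=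
  J₁ a b n m h γ Γ i j - J₂ a b n N m M h H γ Γ i j
    + J₃₄ a b n N m M h H γ Γout Γin i j

/-- `F₂ = J₂ - J₁ - J₄`; the contour `Γin` is meant to lie inside `Γout`. -/
def F₂ (a b : ℕ → ℝ) (n N m M : ℕ) (h H : ℤ) (γ Γ Γout Γin : Contour) (i j : ℕ) : ℂ :=
  J₂ a b n N m M h H γ Γ i j - J₁ a b n m h γ Γ i j
    - J₃₄ a b n N m M h H γ Γin Γout i j

/-- The entry `F₁(i, j)` as a function of the sets `I = [i]`, `J = [j - 1]`, `S = [n]`, `T = [m]`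
and of the integer `g = h - 1`; the conditions `j ≤ n` and `i > n` are read as
`#[j - 1] + 1 ≤ #[n]` and `#[i] > #[n]`, and `H - h = H - 1 - g`. -/
def F₁Set (a b : ℕ → ℝ) (N M : ℕ) (H : ℤ) (γ Γ Γout Γin : Contour)
    (I J S T : Finset ℕ) (g : ℤ) : ℂ :=
  (if J.card + 1 ≤ S.card then double a b γ Γ J I T g else 0)
    - (if S.card < I.card then
        double a b γ Γ (seg N \ I) (seg N \ J) (seg M \ T) (H - 1 - g) else 0)
    + quadruple a b γ Γout Γin S I T g (seg N \ S) (seg N \ J) (seg M \ T) (H - 1 - g)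

/-- The double contour integral over `|z| = Rz`, `|w| = Rw` defining, for the zero initial
condition, the entry `L₁(i, j)` when `Rz > Rw > max 1 / b_k` and the entry `L₂(i, j)` when
`Rw > Rz > max 1 / b_k`. -/
def L (a b : ℕ → ℝ) (n m M : ℕ) (h H : ℤ) (Rz Rw : ℝ) (i j : ℕ) : ℂ :=
  (Contour.centered Rz).integral fun z => (Contour.centered Rw).integral fun w =>
    ((b i : ℂ) * z) ^ (h - 1) * ((b j : ℂ) * w) ^ (H - h) / (z - w)
      * ((∏ k ∈ seg n, (z - 1 / (b k : ℂ))) / ∏ k ∈ seg i, (z - 1 / (b k : ℂ)))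
      * ((∏ k ∈ seg (j - 1), (w - 1 / (b k : ℂ))) / ∏ k ∈ seg n, (w - 1 / (b k : ℂ)))
      * (∏ k ∈ seg m, (1 - (a k : ℂ) * b i) / (1 - (a k : ℂ) / z))
      * ∏ k ∈ seg M \ seg m, (1 - (a k : ℂ) * b j) / (1 - (a k : ℂ) / w)

/-- The left orthogonalizing matrix `A`. -/
def A (a b : ℕ → ℝ) (m : ℕ) (h : ℤ) (γ : Contour) (i j : ℕ) : ℂ :=
  γ.integral fun ζ =>
    (∏ k ∈ seg (j - 1), (ζ - 1 / (b k : ℂ))) / (∏ k ∈ seg i, (ζ - 1 / (b k : ℂ)))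
      * ((b j : ℂ) * ζ) ^ (1 - h)
      * ∏ k ∈ seg m, (1 - (a k : ℂ) / ζ) / (1 - (a k : ℂ) * b j)

/-- The right orthogonalizing matrix `B`. -/
def B (a b : ℕ → ℝ) (m M : ℕ) (h H : ℤ) (γ : Contour) (i j : ℕ) : ℂ :=
  γ.integral fun ω =>
    (∏ k ∈ seg (j - 1), (ω - 1 / (b k : ℂ))) / (∏ k ∈ seg i, (ω - 1 / (b k : ℂ)))
      * ((b i : ℂ) * ω) ^ (h - H)
      * ∏ k ∈ seg M \ seg m, (1 - (a k : ℂ) / ω) / (1 - (a k : ℂ) * b i)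

/-- Lower triangular with ones on the diagonal. -/
def IsLowerUnitriangular {N : ℕ} (X : Matrix (Fin N) (Fin N) ℂ) : Prop :=
  (∀ i j, i < j → X i j = 0) ∧ ∀ i, X i i = 1

end TwoTime

end

/-! The weights are integrated out one at a time, backwards from the last column. The event that
`G(M, N) < H` is itself a determinant of contour integrals, whose `i`-th row depends only on the
`i`-th entry of column `M` (`det_rowInt_empty`). If `U` and `V` are functions of a column with `U(x)
- q U(x + e_k) = (1 - q) V(x)`, then the geometric average of `V` over the weight at height `k`
telescopes to `U` (`StepFamily.hasSum_push`). The weight also pushes up the entries above it, so `U`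
must not notice when an entry that is one less than the entry below it is raised to that value.
Determinants have both properties (`RowFamily.stepFamily`): the first is linearity in a row, the
second is adding a multiple of one row to the next. For the rows at hand the two relations are the
elementary identities `(b z - a b) / (1 - a / z) = b z` (`rowInt_step`) and `b z - 1 = b (z - 1 /
b)`, whose right side cancels a node (`rowInt_reflect`).

When column `m` is reached, the indicator of `G(m, n) < h` has to be absorbed into the determinant.
This is done by the integral over `θ` of `θ ^ (-n) det(θ X - Y) / (θ - 1)`, where `X` and `Y` are
double contour integrals that differ only in which of the two circles is the larger
(`integral_det_pairing_empty`). If the inequality holds, the first `n` rows of `Y` vanish, `θ ^ n`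
comes out of the determinant, and the pole at `1` leaves `det(X - Y)`, which the residue at `z = w`
identifies with the one-time determinant. If it fails, all rows of `X` from the `n`-th on vanish and
the integrand is `O(θ ^ (-2))`. The rows of `θ X - Y` obey the same two relations, so the first `m`
columns can be integrated out as well. What is left is evaluated at the zero column and is `det(θ L₁
- L₂)` (`measureReal_growth`).

The rest is complex analysis. `A` and `B` are unitriangular and do not change the determinant. By
Newton interpolation the sums in `A L B` collapse, and an entry becomes a double integral over large
circles of `G` times Cauchy transforms of `1 / G` (`A_mul_L_mul_B`). Contracting these circles until
they exclude the `1 / b_k` crosses the poles `w = ω` and `z = ζ`. Crossing neither gives `J₃`, the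
residues give `J₁`, `J₂` and the diagonal ones (`pairing_eq_F₁Set`). This computation is made for
general node sets, so that it also applies to their complements with `z` and `w` interchanged, and
this yields `F₂`. -/

noncomputable section

namespace TwoTime

open Metric Set

/-! ### Calculus of integrals over circles -/

namespace Contour

/-- The circle underlying a contour. -/
def bd (C : Contour) : Set ℂ := sphere C.center C.radius

lemma bd_subset_disc (C : Contour) : C.bd ⊆ C.disc := sphere_subset_closedBall

lemma inside_subset_disc (C : Contour) : C.inside ⊆ C.disc := ball_subset_closedBall

lemma disjoint_bd_inside (C : Contour) : Disjoint C.bd C.inside :=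
  sphere_disjoint_ball

lemma ne_of_bd_inside {C : Contour} {z w : ℂ} (hz : z ∈ C.bd) (hw : w ∈ C.inside) : z ≠ w :=
  fun h => C.disjoint_bd_inside.ne_of_mem hz hw h

lemma radius_pos {C : Contour} {z : ℂ} (hz : z ∈ C.inside) : 0 < C.radius :=
  dist_nonneg.trans_lt (mem_ball.mp hz)

lemma isCompact_bd (C : Contour) : IsCompact C.bd := isCompact_sphere _ _

lemma integral_congr {C : Contour} (hC : 0 ≤ C.radius) {f g : ℂ → ℂ} (h : EqOn f g C.bd) :
    C.integral f = C.integral g := by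
  unfold integral
  rw [circleIntegral.integral_congr hC h]

lemma integral_const_mul (C : Contour) (c : ℂ) (f : ℂ → ℂ) :
    (C.integral fun z => c * f z) = c * C.integral f := by
  unfold integral
  rw [circleIntegral.integral_const_mul]; ring

lemma integral_mul_const (C : Contour) (c : ℂ) (f : ℂ → ℂ) :
    (C.integral fun z => f z * c) = C.integral f * c := by
  simp_rw [mul_comm _ c]; exact C.integral_const_mul c f

lemma integral_neg (C : Contour) (f : ℂ → ℂ) :
    (C.integral fun z => -f z) = -C.integral f := by
  simpa using C.integral_const_mul (-1) f

lemma integral_zero (C : Contour) : (C.integral fun _ => 0) = 0 := by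
  simpa using C.integral_const_mul 0 fun _ => 0

lemma integral_add {C : Contour} (hC : 0 ≤ C.radius) {f g : ℂ → ℂ} (hf : ContinuousOn f C.bd)
    (hg : ContinuousOn g C.bd) :
    (C.integral fun z => f z + g z) = C.integral f + C.integral g := by
  unfold integral
  rw [circleIntegral.integral_add (hf.circleIntegrable hC) (hg.circleIntegrable hC), mul_add]

lemma integral_sub {C : Contour} (hC : 0 ≤ C.radius) {f g : ℂ → ℂ} (hf : ContinuousOn f C.bd)
    (hg : ContinuousOn g C.bd) :
    (C.integral fun z => f z - g z) = C.integral f - C.integral g := by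
  unfold integral
  rw [circleIntegral.integral_sub (hf.circleIntegrable hC) (hg.circleIntegrable hC), mul_sub]

lemma integral_sum {C : Contour} (hC : 0 ≤ C.radius) {ι : Type*} (s : Finset ι) {f : ι → ℂ → ℂ}
    (hf : ∀ i ∈ s, ContinuousOn (f i) C.bd) :
    (C.integral fun z => ∑ i ∈ s, f i z) = ∑ i ∈ s, C.integral (f i) := by
  unfold integral
  rw [circleIntegral.integral_fun_sum fun i hi => (hf i hi).circleIntegrable hC, Finset.mul_sum]

lemma norm_integral_le {C : Contour} (hC : 0 ≤ C.radius) {f : ℂ → ℂ} {K : ℝ}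
    (hf : ∀ z ∈ C.bd, ‖f z‖ ≤ K) : ‖C.integral f‖ ≤ C.radius * K := by
  have := circleIntegral.norm_two_pi_i_inv_smul_integral_le_of_norm_le_const hC hf
  simpa [integral] using this

/-- A contour integral depends continuously on parameters. -/
lemma continuousOn_integral {X : Type*} [TopologicalSpace X] [FirstCountableTopology X]
    {C : Contour} (hC : 0 ≤ C.radius) {s : Set X}
    {F : X → ℂ → ℂ} (hF : ContinuousOn (Function.uncurry F) (s ×ˢ C.bd)) :
    ContinuousOn (fun x => C.integral (F x)) s := by
  rw [continuousOn_iff_continuous_domRestrict]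
  unfold integral circleIntegral
  refine Continuous.mul continuous_const ?_
  refine intervalIntegral.continuous_parametric_intervalIntegral_of_continuous' ?_ 0 (2 * Real.pi)
  have h1 : Continuous fun p : s × ℝ => F p.1 (circleMap C.center C.radius p.2) := by
    refine hF.comp_continuous (f := fun p : s × ℝ =>
      ((p.1 : X), circleMap C.center C.radius p.2)) (by fun_prop) fun p => ?_
    exact ⟨p.1.2, circleMap_mem_sphere _ hC _⟩
  simp only [deriv_circleMap, Function.uncurry_def, smul_eq_mul]
  exact Continuous.mul (by fun_prop) h1

/-- Fubini's theorem for contour integrals. -/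
lemma integral_swap {C D : Contour} (hC : 0 ≤ C.radius) (hD : 0 ≤ D.radius)
    {F : ℂ → ℂ → ℂ} (hF : ContinuousOn (Function.uncurry F) (C.bd ×ˢ D.bd)) :
    (C.integral fun z => D.integral fun w => F z w)
      = D.integral fun w => C.integral fun z => F z w := by
  unfold integral circleIntegral
  simp only [deriv_circleMap, smul_eq_mul]
  have h1 : Continuous fun p : ℝ × ℝ =>
      F (circleMap C.center C.radius p.1) (circleMap D.center D.radius p.2) :=
    hF.comp_continuous (f := fun p : ℝ × ℝ =>
      (circleMap C.center C.radius p.1, circleMap D.center D.radius p.2)) (by fun_prop) fun p =>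
      ⟨circleMap_mem_sphere _ hC _, circleMap_mem_sphere _ hD _⟩
  simp_rw [← intervalIntegral.integral_const_mul]
  rw [MeasureTheory.intervalIntegral_intervalIntegral_swap]
  · congr 1; ext t; congr 1; ext u; ring
  · refine MeasureTheory.IntegrableOn.mono_set (ContinuousOn.integrableOn_compact
      (isCompact_uIcc.prod isCompact_uIcc) (Continuous.continuousOn ?_))
      (Set.prod_mono uIoc_subset_uIcc uIoc_subset_uIcc)
    simp only [Function.uncurry_def]
    exact continuous_const.mul (Continuous.mul (by fun_prop) (continuous_const.mul
      (Continuous.mul (by fun_prop) h1)))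

/-- Cauchy's theorem. -/
lemma integral_eq_zero {C : Contour} (hC : 0 ≤ C.radius) {f : ℂ → ℂ}
    (hf : DifferentiableOn ℂ f C.disc) : C.integral f = 0 := by
  have h : DiffContOnCl ℂ f (ball C.center C.radius) :=
    (hf.mono closure_ball_subset_closedBall).diffContOnCl
  simp [integral, h.circleIntegral_eq_zero hC]

/-- Cauchy's integral formula. -/
lemma integral_div_sub {C : Contour} {f : ℂ → ℂ} {w : ℂ}
    (hf : DifferentiableOn ℂ f C.disc) (hw : w ∈ C.inside) :
    (C.integral fun z => f z / (z - w)) = f w := by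
  have h : DiffContOnCl ℂ f (ball C.center C.radius) :=
    (hf.mono closure_ball_subset_closedBall).diffContOnCl
  have := h.two_pi_i_inv_smul_circleIntegral_sub_inv_smul hw
  simpa [integral, div_eq_inv_mul] using this

end Contour

/-- The monic polynomial `∏_{e ∈ E} (z - e)` as a function of `z`. -/
def rootProd (E : Multiset ℂ) (z : ℂ) : ℂ := (E.map fun e => z - e).prod

@[simp] lemma rootProd_zero (z : ℂ) : rootProd 0 z = 1 := by simp [rootProd]

@[simp] lemma rootProd_cons (e : ℂ) (E : Multiset ℂ) (z : ℂ) :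
    rootProd (e ::ₘ E) z = (z - e) * rootProd E z := by simp [rootProd]

lemma rootProd_add (E F : Multiset ℂ) (z : ℂ) :
    rootProd (E + F) z = rootProd E z * rootProd F z := by simp [rootProd]

lemma rootProd_map {ι : Type*} (s : Finset ι) (f : ι → ℂ) (z : ℂ) :
    rootProd (s.val.map f) z = ∏ k ∈ s, (z - f k) := by
  rw [rootProd, Multiset.map_map]; rfl

lemma rootProd_replicate_zero (n : ℕ) (z : ℂ) : rootProd (Multiset.replicate n 0) z = z ^ n := by
  simp [rootProd]

lemma rootProd_ne_zero {E : Multiset ℂ} {z : ℂ} (h : z ∉ E) : rootProd E z ≠ 0 := by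
  unfold rootProd
  rw [Ne, Multiset.prod_eq_zero_iff, Multiset.mem_map]
  rintro ⟨e, he, h0⟩
  exact h (sub_eq_zero.mp h0 ▸ he)

lemma differentiable_rootProd (E : Multiset ℂ) : Differentiable ℂ (rootProd E) := by
  induction E using Multiset.induction with
  | empty => simp only [funext rootProd_zero]; fun_prop
  | cons e E ih => simp only [funext (rootProd_cons e E)]; fun_prop

namespace Contour

lemma rootProd_ne_zero_of_bd {C : Contour} {E : Multiset ℂ} (hE : ∀ e ∈ E, e ∈ C.inside) {z : ℂ}
    (hz : z ∈ C.bd) : rootProd E z ≠ 0 :=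
  rootProd_ne_zero fun h => ne_of_bd_inside hz (hE z h) rfl

lemma integral_inv_sub {C : Contour} {e : ℂ} (he : e ∈ C.inside) :
    (C.integral fun z => (z - e)⁻¹) = 1 := by
  simpa using C.integral_div_sub (f := fun _ => 1) (differentiableOn_const _) he

/-- The integral of `∏_{e ∈ E} (z - e)⁻¹` around all the points of `E` vanishes if there are at
least two of them. -/
lemma integral_inv_rootProd {C : Contour} (E : Multiset ℂ) (hE : ∀ e ∈ E, e ∈ C.inside)
    (h2 : 2 ≤ E.card) : (C.integral fun z => (rootProd E z)⁻¹) = 0 := by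
  induction hk : E.card using Nat.strong_induction_on generalizing E with
  | _ k ih =>
  obtain ⟨e, he⟩ := Multiset.card_pos_iff_exists_mem.mp (by omega : 0 < E.card)
  have hC := radius_pos (hE e he)
  -- If all roots coincide, the integrand is a power other than `-1` and has a primitive. Otherwise
  -- partial fractions in two distinct roots lower the number of roots by one. With two roots in
  -- all, both parts have integral `1` and cancel.
  by_cases hall : ∀ e' ∈ E, e' = e
  · rw [Multiset.eq_replicate_card.mpr hall]
    have h := circleIntegral.integral_sub_zpow_of_ne (n := -(E.card : ℤ)) (by omega) C.center e
      C.radius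
    simp only [integral, rootProd, Multiset.map_replicate, Multiset.prod_replicate]
    simp only [zpow_neg, zpow_natCast] at h
    rw [h, mul_zero]
  · push Not at hall
    obtain ⟨e', he', hne⟩ := hall
    obtain ⟨E₁, rfl⟩ := Multiset.exists_cons_of_mem he
    obtain ⟨E₂, rfl⟩ := Multiset.exists_cons_of_mem
      ((Multiset.mem_cons.mp he').resolve_left hne)
    have hsub : e - e' ≠ 0 := sub_ne_zero.mpr hne.symm
    have heq : EqOn (fun z => (rootProd (e ::ₘ e' ::ₘ E₂) z)⁻¹)
        (fun z => (e - e')⁻¹ * ((rootProd (e ::ₘ E₂) z)⁻¹ - (rootProd (e' ::ₘ E₂) z)⁻¹)) C.bd := by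
      intro z hz
      have h1 := rootProd_ne_zero_of_bd hE hz
      simp only [rootProd_cons] at h1 ⊢
      have h3 := (mul_ne_zero_iff.mp h1).1
      have h4 := (mul_ne_zero_iff.mp (mul_ne_zero_iff.mp h1).2)
      have h5 := h4.1
      have h6 := h4.2
      field_simp
      ring
    rw [integral_congr hC.le heq, integral_const_mul]
    have hE1 : ∀ x ∈ e ::ₘ E₂, x ∈ C.inside := by
      intro x hx; apply hE
      simp only [Multiset.mem_cons] at hx ⊢; tauto
    have hE2 : ∀ x ∈ e' ::ₘ E₂, x ∈ C.inside := by
      intro x hx; apply hE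
      simp only [Multiset.mem_cons] at hx ⊢; tauto
    have hc : ∀ E : Multiset ℂ, (∀ x ∈ E, x ∈ C.inside) →
        ContinuousOn (fun z => (rootProd E z)⁻¹) C.bd := fun E hE =>
      (differentiable_rootProd E).continuous.continuousOn.inv₀
        fun z hz => rootProd_ne_zero_of_bd hE hz
    rw [integral_sub hC.le (hc _ hE1) (hc _ hE2)]
    simp only [Multiset.card_cons] at hk
    rcases Nat.eq_zero_or_pos E₂.card with h0 | h0
    · rw [Multiset.card_eq_zero.mp h0]
      simp only [rootProd_cons, rootProd_zero, mul_one]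
      rw [integral_inv_sub (hE e he), integral_inv_sub (hE e' he')]; ring
    · rw [ih (E₂.card + 1) (by omega) _ hE1 (by simpa [Nat.one_le_iff_ne_zero, Nat.pos_iff_ne_zero] using h0) (by simp),
        ih (E₂.card + 1) (by omega) _ hE2 (by simpa [Nat.one_le_iff_ne_zero, Nat.pos_iff_ne_zero] using h0) (by simp)]
      ring

/-- Deformation of contours: the integral of a function with poles in `E` is the same over any two
circles around `E`, as long as there are no other singularities in their discs. -/
lemma integral_deform {C D : Contour} {U : Set ℂ} (hU : IsOpen U) (hC : C.disc ⊆ U)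
    (hD : D.disc ⊆ U) (hC0 : 0 ≤ C.radius) (hD0 : 0 ≤ D.radius) (E : Multiset ℂ)
    (hEC : ∀ e ∈ E, e ∈ C.inside) (hED : ∀ e ∈ E, e ∈ D.inside) {g : ℂ → ℂ}
    (hg : DifferentiableOn ℂ g U) :
    (C.integral fun z => g z / rootProd E z) = D.integral fun z => g z / rootProd E z := by
  induction E using Multiset.induction generalizing g with
  | empty =>
    simp only [rootProd_zero, div_one]
    rw [integral_eq_zero hC0 (hg.mono hC), integral_eq_zero hD0 (hg.mono hD)]
  | cons e E ih =>
    have hg1 : DifferentiableOn ℂ (dslope g e) U :=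
      (Complex.differentiableOn_dslope (hU.mem_nhds (hC (inside_subset_disc _
        (hEC e (Multiset.mem_cons_self e E)))))).mpr hg
    -- Splitting `g = g(e) + (z - e) dslope g e` removes the root `e` from the second part. The
    -- first part is an integral of `1 / rootProd`, which is `1` or `0` according to the number of
    -- roots, whichever circle is used.
    have key : ∀ K : Contour, 0 ≤ K.radius → K.disc ⊆ U → (∀ x ∈ e ::ₘ E, x ∈ K.inside) →
        (K.integral fun z => g z / rootProd (e ::ₘ E) z) =
          (g e) * (K.integral fun z => (rootProd (e ::ₘ E) z)⁻¹)
            + K.integral fun z => dslope g e z / rootProd E z := by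
      intro K hK0 hK hE
      have hE' : ∀ x ∈ E, x ∈ K.inside := fun x hx => hE x (Multiset.mem_cons_of_mem hx)
      rw [← integral_const_mul, ← integral_add hK0]
      · refine integral_congr hK0 fun z hz => ?_
        have h1 := rootProd_ne_zero_of_bd hE hz
        have h2 := sub_smul_dslope g e z
        simp only [rootProd_cons, smul_eq_mul] at h1 h2 ⊢
        have h3 := (mul_ne_zero_iff.mp h1).1
        have h4 := (mul_ne_zero_iff.mp h1).2
        field_simp
        linear_combination -h2
      · exact continuousOn_const.mul
          ((differentiable_rootProd _).continuous.continuousOn.inv₀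
            fun z hz => rootProd_ne_zero_of_bd hE hz)
      · exact (hg1.continuousOn.mono (K.bd_subset_disc.trans hK)).div
          (differentiable_rootProd _).continuous.continuousOn
            fun z hz => rootProd_ne_zero_of_bd hE' hz
    rw [key C hC0 hC hEC, key D hD0 hD hED,
      ih (fun x hx => hEC x (Multiset.mem_cons_of_mem hx))
        (fun x hx => hED x (Multiset.mem_cons_of_mem hx)) hg1]
    congr 2
    rcases Nat.eq_zero_or_pos E.card with h0 | h0
    · rw [Multiset.card_eq_zero.mp h0]
      simp only [rootProd_cons, rootProd_zero, mul_one]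
      rw [integral_inv_sub (hEC e (Multiset.mem_cons_self e E)),
        integral_inv_sub (hED e (Multiset.mem_cons_self e E))]
    · rw [integral_inv_rootProd _ hEC (by simpa [Nat.one_le_iff_ne_zero, Nat.pos_iff_ne_zero] using h0),
        integral_inv_rootProd _ hED (by simpa [Nat.one_le_iff_ne_zero, Nat.pos_iff_ne_zero] using h0)]

/-- Contracting a contour across a simple pole. -/
lemma integral_contract {C D : Contour} {U : Set ℂ} (hU : IsOpen U) (hC : C.disc ⊆ U)
    (hD : D.disc ⊆ U) (hD0 : 0 ≤ D.radius) (E : Multiset ℂ)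
    (hEC : ∀ e ∈ E, e ∈ C.inside) (hED : ∀ e ∈ E, e ∈ D.inside) {g : ℂ → ℂ}
    (hg : DifferentiableOn ℂ g U) {ζ : ℂ} (hζC : ζ ∈ C.inside) (hζD : ζ ∉ D.disc) :
    (C.integral fun z => g z / (rootProd E z * (z - ζ)))
      = (D.integral fun z => g z / (rootProd E z * (z - ζ))) + g ζ / rootProd E ζ := by
  have hC0 := (radius_pos hζC).le
  have hP : rootProd E ζ ≠ 0 :=
    rootProd_ne_zero fun h => hζD (inside_subset_disc _ (hED ζ h))
  -- `k` vanishes at `ζ`, so `k / (z - ζ)` is regular there. Dividing by `rootProd E ζ * rootProd E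
  -- z` gives the integrand minus `(g ζ / rootProd E ζ) / (z - ζ)`, and only this last term
  -- distinguishes the two circles.
  set k : ℂ → ℂ := fun z => g z * rootProd E ζ - g ζ * rootProd E z with hk
  have hkd : DifferentiableOn ℂ k U :=
    (hg.mul_const _).sub ((differentiable_rootProd E).differentiableOn.const_mul _)
  have hk1 : DifferentiableOn ℂ (fun z => dslope k ζ z / rootProd E ζ) U :=
    ((Complex.differentiableOn_dslope
      (hU.mem_nhds (hC (inside_subset_disc _ hζC)))).mpr hkd).div_const _
  have key : ∀ K : Contour, 0 ≤ K.radius → K.disc ⊆ U → (∀ x ∈ E, x ∈ K.inside) →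
      (∀ z ∈ K.bd, z ≠ ζ) →
      (K.integral fun z => g z / (rootProd E z * (z - ζ))) =
        (K.integral fun z => dslope k ζ z / rootProd E ζ / rootProd E z)
          + g ζ / rootProd E ζ * K.integral fun z => (z - ζ)⁻¹ := by
    intro K hK0 hK hE hne
    rw [← integral_const_mul, ← integral_add hK0]
    · refine integral_congr hK0 fun z hz => ?_
      have h1 := rootProd_ne_zero_of_bd hE hz
      have h2 := sub_smul_dslope k ζ z
      have h3 := sub_ne_zero.mpr (hne z hz)
      have h4 : k ζ = 0 := by simp [hk]
      rw [h4] at h2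
      simp only [smul_eq_mul, hk] at h2 ⊢
      field_simp
      linear_combination -h2
    · exact (hk1.continuousOn.mono (K.bd_subset_disc.trans hK)).div
          (differentiable_rootProd _).continuous.continuousOn
            fun z hz => rootProd_ne_zero_of_bd hE hz
    · exact continuousOn_const.mul ((continuousOn_id.sub continuousOn_const).inv₀
        fun z hz => sub_ne_zero.mpr (hne z hz))
  rw [key C hC0 hC hEC fun z hz => ne_of_bd_inside hz hζC,
    key D hD0 hD hED fun z hz h => hζD (h ▸ D.bd_subset_disc hz),
    integral_deform hU hC hD hC0 hD0 E hEC hED hk1, integral_inv_sub hζC,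
    integral_eq_zero hD0 (f := fun z => (z - ζ)⁻¹)]
  · ring
  · exact (differentiableOn_id.sub (differentiableOn_const _)).inv
      fun z hz => sub_ne_zero.mpr fun h => hζD (h ▸ hz)

end Contour
end TwoTime

namespace TwoTime

open Metric Set

/-! ### Double and quadruple integrals as iterated Cauchy transforms -/

/-- The Cauchy transform `(1 / 2πi) ∮_γ p(ζ) / (z - ζ) dζ`. -/
def cauchyTransform (γ : Contour) (p : ℂ → ℂ) (z : ℂ) : ℂ :=
  γ.integral fun ζ => p ζ / (z - ζ)

/-- The double integral of `f(z) k(w) / (z - w)` over `z ∈ C`, `w ∈ D`. -/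
def pairing (C D : Contour) (f k : ℂ → ℂ) : ℂ :=
  C.integral fun z => D.integral fun w => f z * k w / (z - w)

lemma continuousOn_div_sub_prod {s t : Set ℂ} {f k : ℂ → ℂ} (hf : ContinuousOn f s)
    (hk : ContinuousOn k t) (hst : Disjoint s t) :
    ContinuousOn (Function.uncurry fun z w => f z * k w / (z - w)) (s ×ˢ t) := by
  refine ContinuousOn.div ((hf.comp continuousOn_fst fun p hp => hp.1).mul
    (hk.comp continuousOn_snd fun p hp => hp.2)) (by fun_prop) fun p hp => ?_
  exact sub_ne_zero.mpr (hst.ne_of_mem hp.1 hp.2)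

lemma continuousOn_cauchyTransform {γ : Contour} (hγ : 0 ≤ γ.radius) {p : ℂ → ℂ}
    (hp : ContinuousOn p γ.bd) {s : Set ℂ} (hs : Disjoint s γ.bd) :
    ContinuousOn (cauchyTransform γ p) s := by
  refine Contour.continuousOn_integral hγ ?_
  simpa using continuousOn_div_sub_prod (f := fun _ => 1) continuousOn_const hp hs

lemma pairing_eq {C D : Contour} (f k : ℂ → ℂ) :
    pairing C D f k = C.integral fun z => f z * cauchyTransform D k z := by
  unfold pairing cauchyTransform
  congr 1; ext z
  rw [← Contour.integral_const_mul]
  congr 1; ext w; ring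

lemma pairing_swap {C D : Contour} (hC : 0 ≤ C.radius) (hD : 0 ≤ D.radius) {f k : ℂ → ℂ}
    (hf : ContinuousOn f C.bd) (hk : ContinuousOn k D.bd) (h : Disjoint C.bd D.bd) :
    pairing C D f k = -pairing D C k f := by
  unfold pairing
  rw [Contour.integral_swap hC hD (continuousOn_div_sub_prod hf hk h), ← Contour.integral_neg]
  congr 1; ext w
  rw [← Contour.integral_neg]
  congr 1; ext z
  rw [← neg_sub w z, div_neg]; ring

lemma pairing_congr {C D : Contour} (hC : 0 ≤ C.radius) (hD : 0 ≤ D.radius) {f f' k k' : ℂ → ℂ}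
    (hf : EqOn f f' C.bd) (hk : EqOn k k' D.bd) : pairing C D f k = pairing C D f' k' :=
  Contour.integral_congr hC fun z hz => Contour.integral_congr hD fun w hw => by
    simp only [hf hz, hk hw]

lemma pairing_sum {C D : Contour} (hC : 0 ≤ C.radius) (hD : 0 ≤ D.radius) (h : Disjoint C.bd D.bd)
    {ι κ : Type*} (s : Finset ι) (t : Finset κ) (f : ι → ℂ → ℂ) (k : κ → ℂ → ℂ) (c : ι → ℂ)
    (d : κ → ℂ) (hf : ∀ i ∈ s, ContinuousOn (f i) C.bd) (hk : ∀ j ∈ t, ContinuousOn (k j) D.bd) :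
    (∑ i ∈ s, ∑ j ∈ t, c i * pairing C D (f i) (k j) * d j)
      = pairing C D (fun z => ∑ i ∈ s, c i * f i z) (fun w => ∑ j ∈ t, k j w * d j) := by
  have hin : ∀ z ∈ C.bd, (D.integral fun w =>
      (∑ i ∈ s, c i * f i z) * (∑ j ∈ t, k j w * d j) / (z - w))
      = ∑ i ∈ s, ∑ j ∈ t, (c i * d j) * D.integral fun w => f i z * k j w / (z - w) := by
    intro z hz
    have hz' : ∀ i, ∀ j ∈ t, ContinuousOn (fun w => f i z * k j w / (z - w)) D.bd := fun i j hj =>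
      (continuousOn_const.mul (hk j hj)).div (by fun_prop)
        fun w hw => sub_ne_zero.mpr (h.ne_of_mem hz hw)
    simp_rw [← Contour.integral_const_mul]
    rw [← Finset.sum_product', ← Contour.integral_sum hD]
    · refine Contour.integral_congr hD fun w _ => ?_
      rw [Finset.sum_mul_sum, Finset.sum_product, Finset.sum_div]
      refine Finset.sum_congr rfl fun i _ => ?_
      rw [Finset.sum_div]
      exact Finset.sum_congr rfl fun j _ => by ring
    · intro p hp
      exact continuousOn_const.mul (hz' _ _ (Finset.mem_product.mp hp).2)
  unfold pairing
  rw [Contour.integral_congr hC hin]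
  have hc : ∀ i ∈ s, ∀ j ∈ t, ContinuousOn
      (fun z => D.integral fun w => f i z * k j w / (z - w)) C.bd := fun i hi j hj =>
    Contour.continuousOn_integral hD (continuousOn_div_sub_prod (hf i hi) (hk j hj) h)
  rw [Contour.integral_sum hC]
  · refine Finset.sum_congr rfl fun i hi => ?_
    rw [Contour.integral_sum hC]
    · refine Finset.sum_congr rfl fun j hj => ?_
      rw [Contour.integral_const_mul]; ring
    · exact fun j hj => continuousOn_const.mul (hc i hi j hj)
  · exact fun i hi => continuousOn_finsetSum _ fun j hj => continuousOn_const.mul (hc i hi j hj)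

/-- By Fubini the integration over `γ` can be done first. The result is a single integral over `Γ`,
the only contour that is moved later. -/
lemma double_integral_eq {γ Γ : Contour} (hγ : 0 ≤ γ.radius) (hΓ : 0 ≤ Γ.radius)
    (h : Disjoint γ.bd Γ.bd) {p X : ℂ → ℂ} (hp : ContinuousOn p γ.bd) (hX : ContinuousOn X Γ.bd) :
    (γ.integral fun ζ => Γ.integral fun z => X z * p ζ / (z - ζ))
      = Γ.integral fun z => X z * cauchyTransform γ p z := by
  rw [← pairing_eq, pairing_swap hΓ hγ hX hp h.symm]
  unfold pairing
  rw [← Contour.integral_neg]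
  congr 1; ext ζ
  rw [← Contour.integral_neg]
  congr 1; ext z
  rw [← neg_sub z ζ, div_neg]; ring

/-- `double_integral_eq` is used twice: for fixed `z` in the pair `(ω, w)`, and then in the pair
`(ζ, z)`, after Fubini has pulled `z` out of the integral over `ω`. -/
lemma quadruple_integral_eq {γ C D : Contour} (hγ : 0 ≤ γ.radius) (hC : 0 ≤ C.radius)
    (hD : 0 ≤ D.radius) (hγC : Disjoint γ.bd C.bd) (hγD : Disjoint γ.bd D.bd)
    (hCD : Disjoint C.bd D.bd) {p q X Y : ℂ → ℂ} (hp : ContinuousOn p γ.bd)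
    (hq : ContinuousOn q γ.bd) (hX : ContinuousOn X C.bd) (hY : ContinuousOn Y D.bd) :
    (γ.integral fun ζ => γ.integral fun ω => C.integral fun z => D.integral fun w =>
      X z * p ζ / (z - ζ) * (Y w * q ω / (w - ω)) / (z - w))
      = pairing C D (fun z => X z * cauchyTransform γ p z)
          (fun w => Y w * cauchyTransform γ q w) := by
  have hβ := continuousOn_cauchyTransform hγ hq hγD.symm
  have hR : ContinuousOn (cauchyTransform D fun w => Y w * cauchyTransform γ q w) C.bd :=
    continuousOn_cauchyTransform hD (hY.mul hβ) hCD
  have h1 : ∀ z ∈ C.bd, (γ.integral fun ω => D.integral fun w => Y w * q ω / (w - ω) / (z - w))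
      = cauchyTransform D (fun w => Y w * cauchyTransform γ q w) z := by
    intro z hz
    have := double_integral_eq hγ hD hγD hq (X := fun w => Y w / (z - w))
      (hY.div (by fun_prop) fun w hw => sub_ne_zero.mpr (hCD.ne_of_mem hz hw))
    rw [cauchyTransform]
    refine Eq.trans ?_ (this.trans ?_)
    · congr 1; ext ω; congr 1; ext w; ring
    · congr 1; ext w; ring
  have h2 : ∀ ζ ∈ γ.bd, (γ.integral fun ω => C.integral fun z => D.integral fun w =>
      X z * p ζ / (z - ζ) * (Y w * q ω / (w - ω)) / (z - w))
      = C.integral fun z => (X z * cauchyTransform D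
          (fun w => Y w * cauchyTransform γ q w) z) * p ζ / (z - ζ) := by
    intro ζ hζ
    have hXz : ContinuousOn (fun z => X z * p ζ / (z - ζ)) C.bd :=
      (hX.mul continuousOn_const).div (by fun_prop)
        fun z hz => sub_ne_zero.mpr (hγC.ne_of_mem hζ hz).symm
    have hQ : ContinuousOn (Function.uncurry fun ω z => D.integral fun w =>
        X z * p ζ / (z - ζ) * (Y w * q ω / (w - ω)) / (z - w)) (γ.bd ×ˢ C.bd) := by
      refine Contour.continuousOn_integral (X := ℂ × ℂ) (F := fun y w =>
        X y.2 * p ζ / (y.2 - ζ) * (Y w * q y.1 / (w - y.1)) / (y.2 - w)) hD ?_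
      refine ContinuousOn.div (ContinuousOn.mul
        (hXz.comp (g := fun z => X z * p ζ / (z - ζ)) (f := fun y : (ℂ × ℂ) × ℂ => y.1.2)
          (by fun_prop) fun y hy => hy.1.2)
        (ContinuousOn.div (ContinuousOn.mul
          (hY.comp (f := fun y : (ℂ × ℂ) × ℂ => y.2) (by fun_prop) fun y hy => hy.2)
          (hq.comp (f := fun y : (ℂ × ℂ) × ℂ => y.1.1) (by fun_prop) fun y hy => hy.1.1))
          (by fun_prop) fun y hy => sub_ne_zero.mpr (hγD.ne_of_mem hy.1.1 hy.2).symm))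
        (by fun_prop) fun y hy => sub_ne_zero.mpr (hCD.ne_of_mem hy.1.2 hy.2)
    rw [Contour.integral_swap hγ hC hQ]
    refine Contour.integral_congr hC fun z hz => ?_
    have : (fun ω => D.integral fun w =>
        X z * p ζ / (z - ζ) * (Y w * q ω / (w - ω)) / (z - w))
        = fun ω => X z * p ζ / (z - ζ) * D.integral fun w =>
          Y w * q ω / (w - ω) / (z - w) := by
      ext ω; rw [← Contour.integral_const_mul]; congr 1; ext w; ring
    simp only [this]
    rw [Contour.integral_const_mul, h1 z hz]; ring
  rw [Contour.integral_congr hγ h2, pairing_eq]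
  refine (double_integral_eq hγ hC hγC hp (hX.mul hR)).trans ?_
  congr 1; ext z; simp only [Pi.mul_apply]; ring

/-! ### The function `G` on the contours -/

variable {a b : ℕ → ℝ} {N M : ℕ}

/-- The product `∏_{k ∈ S} (z - 1 / b_k)`. -/
def nodes (b : ℕ → ℝ) (S : Finset ℕ) (z : ℂ) : ℂ := ∏ k ∈ S, (z - 1 / (b k : ℂ))

/-- The contour encloses `0` and all the points `a_k`, `k ∈ [M]`. -/
def EnclosesZeros (a : ℕ → ℝ) (M : ℕ) (Γ : Contour) : Prop :=
  0 ∈ Γ.inside ∧ ∀ k ∈ seg M, (a k : ℂ) ∈ Γ.inside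

/-- The contour encloses all the points `1 / b_k`, `k ∈ [N]`. -/
def EnclosesPoles (b : ℕ → ℝ) (N : ℕ) (γ : Contour) : Prop :=
  ∀ k ∈ seg N, 1 / (b k : ℂ) ∈ γ.inside

lemma differentiable_nodes (b : ℕ → ℝ) (S : Finset ℕ) : Differentiable ℂ (nodes b S) := by
  unfold nodes; fun_prop

lemma nodes_eq_rootProd (S : Finset ℕ) (z : ℂ) :
    nodes b S z = rootProd (S.val.map fun k => 1 / (b k : ℂ)) z := (rootProd_map _ _ _).symm

lemma nodes_ne_zero {S : Finset ℕ} {z : ℂ} (h : ∀ k ∈ S, z ≠ 1 / (b k : ℂ)) : nodes b S z ≠ 0 :=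
  Finset.prod_ne_zero_iff.mpr fun k hk => sub_ne_zero.mpr (h k hk)

lemma nodes_sdiff_mul {S I : Finset ℕ} (h : S ⊆ I) (z : ℂ) :
    nodes b (I \ S) z * nodes b S z = nodes b I z := Finset.prod_sdiff h

lemma nodes_ne_zero_of_notMem {γ : Contour} (hγ : EnclosesPoles b N γ) {S : Finset ℕ}
    (hS : S ⊆ seg N) {z : ℂ} (hz : z ∉ γ.inside) : nodes b S z ≠ 0 :=
  nodes_ne_zero fun k hk h => hz (h ▸ hγ k (hS hk))

lemma G_eq (z : ℂ) (S T : Finset ℕ) (h : ℤ) :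
    G a b z S T h = z ^ h * nodes b S z * ∏ k ∈ T, (1 - (a k : ℂ) / z)⁻¹ := rfl

/-- Each factor `(1 - a / z)⁻¹` is `z / (z - a)`, and a negative power of `z` counts as a root at
`0`. This brings `G` to the shape that the deformation lemmas require. -/
lemma G_eq_div (S T : Finset ℕ) (h : ℤ) : ∃ (E : Multiset ℂ) (g : ℂ → ℂ), Differentiable ℂ g ∧
    (∀ e ∈ E, e = 0 ∨ ∃ k ∈ T, e = a k) ∧
    ∀ z, z ≠ 0 → G a b z S T h = g z / rootProd E z := by
  refine ⟨Multiset.replicate (-h).toNat 0 + T.val.map fun k => (a k : ℂ),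
    fun z => z ^ (h.toNat + T.card) * nodes b S z,
    ((differentiable_id.pow _).mul (differentiable_nodes b S)), ?_, ?_⟩
  · intro e he
    rcases Multiset.mem_add.mp he with he | he
    · exact Or.inl (Multiset.eq_of_mem_replicate he)
    · obtain ⟨k, hk, rfl⟩ := Multiset.mem_map.mp he
      exact Or.inr ⟨k, hk, rfl⟩
  · intro z hz
    have h1 : z ^ h = z ^ h.toNat / z ^ (-h).toNat := by
      rw [← zpow_natCast, ← zpow_natCast, ← zpow_sub₀ hz]
      congr 1; omega
    have h2 : ∏ k ∈ T, (1 - (a k : ℂ) / z)⁻¹ = z ^ T.card / ∏ k ∈ T, (z - a k) := by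
      rw [← Finset.prod_const, ← Finset.prod_div_distrib]
      refine Finset.prod_congr rfl fun k _ => ?_
      rw [← div_self hz, ← sub_div, inv_div]
    rw [G_eq, rootProd_add, rootProd_replicate_zero, rootProd_map, h1, h2]
    simp only [pow_add]
    ring

lemma differentiableAt_G {z : ℂ} {S T : Finset ℕ} (h : ℤ) (hz : z ≠ 0)
    (hT : ∀ k ∈ T, z ≠ a k) : DifferentiableAt ℂ (fun z => G a b z S T h) z := by
  unfold G
  refine DifferentiableAt.mul (DifferentiableAt.mul
    (differentiableAt_id.zpow (Or.inl hz)) (by fun_prop)) ?_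
  refine DifferentiableAt.fun_finsetProd fun k hk => ?_
  refine DifferentiableAt.inv ?_ ?_
  · exact (differentiableAt_const _).sub ((differentiableAt_const _).div differentiableAt_id hz)
  · rw [one_sub_div hz]; exact div_ne_zero (sub_ne_zero.mpr (hT k hk)) hz

lemma G_ne_zero {z : ℂ} {S T : Finset ℕ} (h : ℤ) (hz : z ≠ 0)
    (hT : ∀ k ∈ T, z ≠ a k) (hS : ∀ k ∈ S, z ≠ 1 / (b k : ℂ)) : G a b z S T h ≠ 0 := by
  rw [G_eq]
  refine mul_ne_zero (mul_ne_zero (zpow_ne_zero _ hz) (nodes_ne_zero hS)) ?_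
  refine Finset.prod_ne_zero_iff.mpr fun k hk => inv_ne_zero ?_
  rw [one_sub_div hz]; exact div_ne_zero (sub_ne_zero.mpr (hT k hk)) hz

/-- The power of `z` and the factors from `T` cancel. Therefore the residue at `z = ζ` of `G(z) /
(G(ζ) (z - ζ))` contains node polynomials only. -/
lemma G_div_G {z : ℂ} {S I T : Finset ℕ} (h : ℤ) (hz : z ≠ 0) (hT : ∀ k ∈ T, z ≠ a k) :
    G a b z S T h / G a b z I T h = nodes b S z / nodes b I z := by
  have h2 : ∏ k ∈ T, (1 - (a k : ℂ) / z)⁻¹ ≠ 0 := by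
    refine Finset.prod_ne_zero_iff.mpr fun k hk => inv_ne_zero ?_
    rw [one_sub_div hz]; exact div_ne_zero (sub_ne_zero.mpr (hT k hk)) hz
  rw [G_eq, G_eq, mul_div_mul_right _ _ h2, mul_div_mul_left _ _ (zpow_ne_zero _ hz)]

/-- A residue correction `1 / nodes` changes the node set of `G`; this is how the integrands of `J₁`
and `J₂` arise from that of `J₃`. -/
lemma G_div_nodes {γ : Contour} (hγ : EnclosesPoles b N γ) {S I T : Finset ℕ} (h : ℤ)
    (hS : S ⊆ I) (hI : I ⊆ seg N) {z : ℂ} (hz : z ∉ γ.inside) :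
    G a b z I T h / nodes b (I \ S) z = G a b z S T h := by
  rw [G_eq, G_eq, ← nodes_sdiff_mul hS]
  have := nodes_ne_zero_of_notMem hγ (Finset.sdiff_subset.trans hI : I \ S ⊆ seg N) hz
  field_simp

namespace EnclosesZeros

variable {Γ Γ' : Contour}

lemma ne_zero (hΓ : EnclosesZeros a M Γ) {z : ℂ} (hz : z ∉ Γ.inside) : z ≠ 0 :=
  fun h => hz (h ▸ hΓ.1)

lemma ne_a (hΓ : EnclosesZeros a M Γ) {T : Finset ℕ} (hT : T ⊆ seg M) {z : ℂ}
    (hz : z ∉ Γ.inside) : ∀ k ∈ T, z ≠ a k :=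
  fun k hk h => hz (h ▸ hΓ.2 k (hT hk))

lemma radius_pos (hΓ : EnclosesZeros a M Γ) : 0 < Γ.radius := Contour.radius_pos hΓ.1

lemma continuousOn_G (hΓ : EnclosesZeros a M Γ) {T : Finset ℕ} (hT : T ⊆ seg M)
    (S : Finset ℕ) (h : ℤ) {s : Set ℂ} (hs : Disjoint s Γ.inside) :
    ContinuousOn (fun z => G a b z S T h) s := fun _ hz =>
  have hz' := disjoint_left.mp hs hz
  (differentiableAt_G h (hΓ.ne_zero hz') (hΓ.ne_a hT hz')).continuousAt.continuousWithinAt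

lemma continuousOn_G_inv (hΓ : EnclosesZeros a M Γ) {γ : Contour} (hγ : EnclosesPoles b N γ)
    {S T : Finset ℕ} (hT : T ⊆ seg M) (hS : S ⊆ seg N) (h : ℤ) {s : Set ℂ}
    (hs : Disjoint s Γ.inside) (hs' : Disjoint s γ.inside) :
    ContinuousOn (fun z => (G a b z S T h)⁻¹) s :=
  (hΓ.continuousOn_G hT S h hs).inv₀ fun _ hz =>
    have hz' := disjoint_left.mp hs hz
    G_ne_zero h (hΓ.ne_zero hz') (hΓ.ne_a hT hz')
      fun k hk e => disjoint_left.mp hs' hz (e ▸ hγ k (hS hk))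

lemma roots_mem (hΓ : EnclosesZeros a M Γ) {T : Finset ℕ} (hT : T ⊆ seg M) {e : ℂ}
    (he : e = 0 ∨ ∃ k ∈ T, e = a k) : e ∈ Γ.inside := by
  rcases he with rfl | ⟨k, hk, rfl⟩
  exacts [hΓ.1, hΓ.2 k (hT hk)]

/-- Deforming a contour around the singularities `0`, `a_k` of `G`. -/
lemma integral_G_deform (hΓ : EnclosesZeros a M Γ) (hΓ' : EnclosesZeros a M Γ')
    {T : Finset ℕ} (hT : T ⊆ seg M) (S : Finset ℕ) (h : ℤ) {U : Set ℂ} (hU : IsOpen U)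
    (hC : Γ.disc ⊆ U) (hD : Γ'.disc ⊆ U) {φ : ℂ → ℂ} (hφ : DifferentiableOn ℂ φ U) :
    (Γ.integral fun z => G a b z S T h * φ z) = Γ'.integral fun z => G a b z S T h * φ z := by
  obtain ⟨E, g, hg, hE, hG⟩ := G_eq_div (a := a) (b := b) S T h
  have key : ∀ K : Contour, EnclosesZeros a M K → (K.integral fun z => G a b z S T h * φ z)
      = K.integral fun z => (g z * φ z) / rootProd E z := fun K hK =>
    Contour.integral_congr hK.radius_pos.le fun z hz => by
      simp only [hG z (Contour.ne_of_bd_inside hz hK.1)]; ring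
  rw [key _ hΓ, key _ hΓ']
  exact Contour.integral_deform hU hC hD hΓ.radius_pos.le hΓ'.radius_pos.le E
    (fun e he => hΓ.roots_mem hT (hE e he)) (fun e he => hΓ'.roots_mem hT (hE e he))
    (hg.differentiableOn.mul hφ)

/-- Contracting a contour of integration of `G` across a simple pole. -/
lemma integral_G_contract (hΓ : EnclosesZeros a M Γ) (hΓ' : EnclosesZeros a M Γ')
    {T : Finset ℕ} (hT : T ⊆ seg M) (S : Finset ℕ) (h : ℤ) {U : Set ℂ} (hU : IsOpen U)
    (hC : Γ.disc ⊆ U) (hD : Γ'.disc ⊆ U) {φ : ℂ → ℂ} (hφ : DifferentiableOn ℂ φ U)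
    (F : Multiset ℂ) (hF : ∀ e ∈ F, e ∈ Γ.inside) (hF' : ∀ e ∈ F, e ∈ Γ'.inside) {ζ : ℂ}
    (hζ : ζ ∈ Γ.inside) (hζ' : ζ ∉ Γ'.disc) :
    (Γ.integral fun z => G a b z S T h * φ z / (rootProd F z * (z - ζ))) =
      (Γ'.integral fun z => G a b z S T h * φ z / (rootProd F z * (z - ζ)))
        + G a b ζ S T h * φ ζ / rootProd F ζ := by
  obtain ⟨E, g, hg, hE, hG⟩ := G_eq_div (a := a) (b := b) S T h
  have key : ∀ K : Contour, EnclosesZeros a M K →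
      (K.integral fun z => G a b z S T h * φ z / (rootProd F z * (z - ζ)))
      = K.integral fun z => (g z * φ z) / (rootProd (E + F) z * (z - ζ)) := fun K hK =>
    Contour.integral_congr hK.radius_pos.le fun z hz => by
      simp only [hG z (Contour.ne_of_bd_inside hz hK.1), rootProd_add, div_eq_mul_inv, mul_inv]
      ring
  rw [key _ hΓ, key _ hΓ']
  refine (Contour.integral_contract hU hC hD hΓ'.radius_pos.le (E + F) ?_ ?_
    (hg.differentiableOn.mul hφ) hζ hζ').trans ?_
  rotate_left 2
  · rw [hG ζ (hΓ'.ne_zero fun hh => hζ' (Contour.inside_subset_disc _ hh)), rootProd_add]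
    simp only [Pi.mul_apply, div_eq_mul_inv, mul_inv]; ring
  · exact fun e he => (Multiset.mem_add.mp he).elim (fun h => hΓ.roots_mem hT (hE e h)) (hF e)
  · exact fun e he => (Multiset.mem_add.mp he).elim (fun h => hΓ'.roots_mem hT (hE e h)) (hF' e)

end EnclosesZeros
end TwoTime

namespace TwoTime

open Metric Set

variable {a b : ℕ → ℝ} {N M : ℕ}

/-! ### Integrals of ratios of node polynomials -/

lemma exists_centered_inside (s : Set ℂ) (hs : Bornology.IsBounded s) (r : ℝ) :
    ∃ R : ℝ, r < R ∧ s ⊆ (Contour.centered R).inside := by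
  obtain ⟨R, hR⟩ := hs.subset_ball 0
  refine ⟨max R (r + 1), by simp, hR.trans (ball_subset_ball (le_max_left _ _))⟩

lemma differentiableOn_inv_sub {s : Set ℂ} {w : ℂ} (hw : w ∉ s) :
    DifferentiableOn ℂ (fun z => (z - w)⁻¹) s :=
  (differentiableOn_id.sub (differentiableOn_const _)).inv
    fun _ hz => sub_ne_zero.mpr fun e => hw (e ▸ hz)

lemma nodes_div_eq {S I : Finset ℕ} (h : I ⊆ S) {z : ℂ} (hz : nodes b I z ≠ 0) :
    nodes b S z / nodes b I z = nodes b (S \ I) z := by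
  rw [← nodes_sdiff_mul h, mul_div_cancel_right₀ _ hz]

lemma nodes_div_eq_inv {S I : Finset ℕ} (h : S ⊆ I) {z : ℂ} (hz : nodes b I z ≠ 0) :
    nodes b S z / nodes b I z = (nodes b (I \ S) z)⁻¹ := by
  rw [← nodes_div_eq h, inv_div]
  rw [← nodes_sdiff_mul h] at hz
  exact right_ne_zero_of_mul hz

namespace EnclosesPoles

variable {γ : Contour}

lemma nodes_ne_zero_of_bd (hγ : EnclosesPoles b N γ) {S : Finset ℕ} (hS : S ⊆ seg N) {z : ℂ}
    (hz : z ∈ γ.bd) : nodes b S z ≠ 0 :=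
  nodes_ne_zero_of_notMem hγ hS (disjoint_left.mp γ.disjoint_bd_inside hz)

lemma mem_inside (hγ : EnclosesPoles b N γ) {S : Finset ℕ} (hS : S ⊆ seg N) :
    ∀ e ∈ S.val.map fun k => 1 / (b k : ℂ), e ∈ γ.inside := by
  intro e he
  obtain ⟨k, hk, rfl⟩ := Multiset.mem_map.mp he
  exact hγ k (hS hk)

lemma integral_nodes_div_of_subset (hγ : EnclosesPoles b N γ) (h0 : 0 ≤ γ.radius)
    {S I : Finset ℕ} (h : I ⊆ S) (hI : I ⊆ seg N) {φ : ℂ → ℂ} (hφ : DifferentiableOn ℂ φ γ.disc) :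
    (γ.integral fun z => nodes b S z / nodes b I z * φ z) = 0 := by
  rw [Contour.integral_congr h0 (g := fun z => nodes b (S \ I) z * φ z)]
  · exact Contour.integral_eq_zero h0 ((differentiable_nodes _ _).differentiableOn.mul hφ)
  · intro z hz
    simp only [nodes_div_eq h (hγ.nodes_ne_zero_of_bd hI hz)]

lemma integral_nodes_div_of_card_eq_one (hγ : EnclosesPoles b N γ) (h0 : 0 ≤ γ.radius)
    {S I : Finset ℕ} (h : S ⊆ I) (hI : I ⊆ seg N) (hc : (I \ S).card = 1) :
    (γ.integral fun z => nodes b S z / nodes b I z) = 1 := by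
  obtain ⟨k, hk⟩ := Finset.card_eq_one.mp hc
  have hkI : k ∈ I := (Finset.mem_sdiff.mp (hk ▸ Finset.mem_singleton_self k)).1
  rw [Contour.integral_congr h0 (g := fun z => (z - 1 / (b k : ℂ))⁻¹)]
  · exact Contour.integral_inv_sub (hγ k (hI hkI))
  · intro z hz
    simp only [nodes_div_eq_inv h (hγ.nodes_ne_zero_of_bd hI hz), hk]
    simp [nodes]

lemma integral_nodes_div_of_two_le_card (hγ : EnclosesPoles b N γ) (h0 : 0 ≤ γ.radius)
    {S I : Finset ℕ} (h : S ⊆ I) (hI : I ⊆ seg N) (hc : 2 ≤ (I \ S).card) :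
    (γ.integral fun z => nodes b S z / nodes b I z) = 0 := by
  rw [Contour.integral_congr h0
    (g := fun z => (rootProd ((I \ S).val.map fun k => 1 / (b k : ℂ)) z)⁻¹)]
  · exact Contour.integral_inv_rootProd _ (hγ.mem_inside (Finset.sdiff_subset.trans hI))
      (by rwa [Multiset.card_map])
  · intro z hz
    simp only [nodes_div_eq_inv h (hγ.nodes_ne_zero_of_bd hI hz)]
    rw [nodes_eq_rootProd]

/-- Around a circle that contains `γ` and `w` the integral vanishes, since the denominator has at
least two roots: `w`, and a node because the inclusion is strict. So the residues inside `γ` add up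
to minus the residue at `w`. -/
lemma integral_nodes_div_sub_of_ssubset (hγ : EnclosesPoles b N γ) (h0 : 0 ≤ γ.radius)
    {S I : Finset ℕ} (h : S ⊂ I) (hI : I ⊆ seg N) {w : ℂ} (hw : w ∉ γ.disc) :
    (γ.integral fun z => nodes b S z / nodes b I z * (z - w)⁻¹) = -(nodes b (I \ S) w)⁻¹ := by
  obtain ⟨R, -, hR⟩ := exists_centered_inside (γ.disc ∪ {w})
    (isBounded_closedBall.union Bornology.isBounded_singleton) 0
  have hwR : w ∈ (Contour.centered R).inside := hR (Or.inr rfl)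
  set E : Multiset ℂ := (I \ S).val.map fun k => 1 / (b k : ℂ) with hEdef
  have hE := hγ.mem_inside (Finset.sdiff_subset.trans hI : I \ S ⊆ seg N)
  have hE' : ∀ e ∈ E, e ∈ (Contour.centered R).inside := fun e he =>
    hR (Or.inl (Contour.inside_subset_disc _ (hE e he)))
  have h1 := Contour.integral_contract (C := Contour.centered R) (D := γ) isOpen_univ
    (subset_univ _) (subset_univ _) h0 E hE' hE (g := fun _ => 1) (differentiableOn_const _) hwR hw
  have h2 : (Contour.centered R).integral (fun z => 1 / (rootProd E z * (z - w))) = 0 := by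
    have := Contour.integral_inv_rootProd (C := Contour.centered R) (w ::ₘ E) (by
      intro x hx
      rcases Multiset.mem_cons.mp hx with rfl | hx
      exacts [hwR, hE' x hx]) (by
      have : 0 < (I \ S).card := Finset.card_pos.mpr (Finset.sdiff_nonempty.mpr h.2)
      rw [Multiset.card_cons, hEdef, Multiset.card_map]
      exact Nat.succ_le_succ this)
    rw [← this]
    congr 1; ext z; rw [rootProd_cons, one_div, mul_comm]
  rw [h2] at h1
  rw [nodes_eq_rootProd, ← hEdef]
  rw [Contour.integral_congr h0 (g := fun z => 1 / (rootProd E z * (z - w)))]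
  · rw [one_div] at h1; linear_combination -h1
  · intro z hz
    simp only [nodes_div_eq_inv h.1 (hγ.nodes_ne_zero_of_bd hI hz)]
    rw [nodes_eq_rootProd, one_div, mul_inv]

end EnclosesPoles

/-! ### Contraction of the large circles -/

section

variable {γ C D : Contour}

lemma double_eq (hγ : EnclosesPoles b N γ) (hγ0 : 0 ≤ γ.radius) (hD : EnclosesZeros a M D)
    (hγD : Disjoint γ.disc D.disc) {S I T : Finset ℕ} (hI : I ⊆ seg N) (hT : T ⊆ seg M) (g : ℤ) :
    double a b γ D S I T g
      = D.integral fun z => G a b z S T g * cauchyTransform γ (fun ζ => (G a b ζ I T g)⁻¹) z := by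
  have hbd : Disjoint γ.bd D.bd := hγD.mono γ.bd_subset_disc D.bd_subset_disc
  rw [← double_integral_eq hγ0 hD.radius_pos.le hbd
    (hD.continuousOn_G_inv hγ hT hI g (hγD.mono γ.bd_subset_disc D.inside_subset_disc)
      γ.disjoint_bd_inside) (hD.continuousOn_G hT S g D.disjoint_bd_inside)]
  unfold double
  congr 1; ext ζ; congr 1; ext z
  simp only [div_eq_mul_inv, mul_inv]; ring

lemma quadruple_eq (hγ : EnclosesPoles b N γ) (hγ0 : 0 ≤ γ.radius) (hC : EnclosesZeros a M C)
    (hD : EnclosesZeros a M D) (hγC : Disjoint γ.disc C.disc) (hγD : Disjoint γ.disc D.disc)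
    (hCD : Disjoint C.bd D.bd) {S I T S' I' T' : Finset ℕ} (hI : I ⊆ seg N) (hI' : I' ⊆ seg N)
    (hT : T ⊆ seg M) (hT' : T' ⊆ seg M) (g g' : ℤ) :
    quadruple a b γ C D S I T g S' I' T' g'
      = pairing C D (fun z => G a b z S T g * cauchyTransform γ (fun ζ => (G a b ζ I T g)⁻¹) z)
        (fun w => G a b w S' T' g' * cauchyTransform γ (fun ω => (G a b ω I' T' g')⁻¹) w) := by
  have hd := hγC.mono γ.bd_subset_disc C.inside_subset_disc
  rw [← quadruple_integral_eq hγ0 hC.radius_pos.le hD.radius_pos.le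
    (hγC.mono γ.bd_subset_disc C.bd_subset_disc) (hγD.mono γ.bd_subset_disc D.bd_subset_disc) hCD
    (hC.continuousOn_G_inv hγ hT hI g hd γ.disjoint_bd_inside)
    (hC.continuousOn_G_inv hγ hT' hI' g' hd γ.disjoint_bd_inside)
    (hC.continuousOn_G hT S g C.disjoint_bd_inside)
    (hD.continuousOn_G hT' _ g' D.disjoint_bd_inside)]
  unfold quadruple
  congr 1; ext ζ; congr 1; ext ω; congr 1; ext z; congr 1; ext w
  simp only [div_eq_mul_inv, mul_inv]; ring

/-- Contracting a contour around everything to one which excludes the points `1 / b_k`. -/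
lemma integral_G_mul_cauchyTransform (hγ : EnclosesPoles b N γ) (hγ0 : 0 ≤ γ.radius)
    (hC : EnclosesZeros a M C) (hD : EnclosesZeros a M D) (hγC : γ.disc ⊆ C.inside)
    (hγD : Disjoint γ.disc D.disc) {S I T : Finset ℕ} (hI : I ⊆ seg N) (hT : T ⊆ seg M) (g : ℤ)
    {U : Set ℂ} (hU : IsOpen U) (hCU : C.disc ⊆ U) (hDU : D.disc ⊆ U) {φ : ℂ → ℂ}
    (hφ : DifferentiableOn ℂ φ U) (F : Multiset ℂ) (hF : ∀ e ∈ F, e ∈ C.inside)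
    (hF' : ∀ e ∈ F, e ∈ D.inside) :
    (C.integral fun z => G a b z S T g * (φ z / rootProd F z)
        * cauchyTransform γ (fun ζ => (G a b ζ I T g)⁻¹) z)
      = (D.integral fun z => G a b z S T g * (φ z / rootProd F z)
          * cauchyTransform γ (fun ζ => (G a b ζ I T g)⁻¹) z)
        + γ.integral fun ζ => nodes b S ζ / nodes b I ζ * (φ ζ / rootProd F ζ) := by
  have hp : ContinuousOn (fun ζ => (G a b ζ I T g)⁻¹) γ.bd :=
    hD.continuousOn_G_inv hγ hT hI g (hγD.mono γ.bd_subset_disc D.inside_subset_disc)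
      γ.disjoint_bd_inside
  have hX : ∀ K : Contour, EnclosesZeros a M K → K.disc ⊆ U → (∀ e ∈ F, e ∈ K.inside) →
      ContinuousOn (fun z => G a b z S T g * (φ z / rootProd F z)) K.bd := fun K hK hKU hFK =>
    (hK.continuousOn_G hT S g K.disjoint_bd_inside).mul
      ((hφ.continuousOn.mono (K.bd_subset_disc.trans hKU)).div
        (differentiable_rootProd F).continuous.continuousOn
        fun z hz => Contour.rootProd_ne_zero_of_bd hFK hz)
  have hdC : Disjoint γ.bd C.bd :=
    (C.disjoint_bd_inside.mono_right (γ.bd_subset_disc.trans hγC)).symm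
  have hdD : Disjoint γ.bd D.bd := hγD.mono γ.bd_subset_disc D.bd_subset_disc
  rw [← double_integral_eq hγ0 hC.radius_pos.le hdC hp (hX C hC hCU hF),
    ← double_integral_eq hγ0 hD.radius_pos.le hdD hp (hX D hD hDU hF')]
  -- For fixed `ζ` on `γ`, the contour crosses the simple pole `z = ζ` and nothing else. By
  -- `G_div_G` the residue keeps only the nodes.
  have hin : EqOn (fun ζ => C.integral fun z => G a b z S T g * (φ z / rootProd F z)
        * (G a b ζ I T g)⁻¹ / (z - ζ))
      (fun ζ => (D.integral fun z => G a b z S T g * (φ z / rootProd F z)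
        * (G a b ζ I T g)⁻¹ / (z - ζ)) + nodes b S ζ / nodes b I ζ * (φ ζ / rootProd F ζ))
      γ.bd := by
    intro ζ hζ
    have hζ1 := γ.bd_subset_disc hζ
    have hζ2 : ζ ∉ D.disc := disjoint_left.mp hγD hζ1
    have hζ3 : ζ ∉ D.inside := fun h => hζ2 (D.inside_subset_disc h)
    have h1 := hC.integral_G_contract hD hT (b := b) S g hU hCU hDU hφ F hF hF' (hγC hζ1) hζ2
    have h2 := G_div_G (a := a) (b := b) (S := S) (I := I) g (hD.ne_zero hζ3) (hD.ne_a hT hζ3)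
    have h3 : ∀ K : Contour, (K.integral fun z => G a b z S T g * (φ z / rootProd F z)
        * (G a b ζ I T g)⁻¹ / (z - ζ)) = (G a b ζ I T g)⁻¹ * K.integral fun z =>
          G a b z S T g * φ z / (rootProd F z * (z - ζ)) := fun K => by
      rw [← Contour.integral_const_mul]
      congr 1; ext z; simp only [div_eq_mul_inv, mul_inv]; ring
    simp only [h3, ← h2]
    rw [h1, div_eq_mul_inv _ (G a b ζ I T g)]
    ring
  rw [Contour.integral_congr hγ0 hin, Contour.integral_add hγ0]
  · refine Contour.continuousOn_integral hD.radius_pos.le ?_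
    refine ContinuousOn.div (ContinuousOn.mul ((hX D hD hDU hF').comp continuousOn_snd
      fun p hp => hp.2) (hp.comp continuousOn_fst fun p hp => hp.1)) (by fun_prop) fun p hp => ?_
    exact sub_ne_zero.mpr (hdD.ne_of_mem hp.1 hp.2).symm
  · refine ((differentiable_nodes _ _).continuous.continuousOn.div
      (differentiable_nodes _ _).continuous.continuousOn
      fun z hz => hγ.nodes_ne_zero_of_bd hI hz).mul ?_
    refine (hφ.continuousOn.mono (γ.bd_subset_disc.trans (hγC.trans
      (C.inside_subset_disc.trans hCU)))).div
        (differentiable_rootProd F).continuous.continuousOn fun z hz => rootProd_ne_zero fun h => ?_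
    exact disjoint_left.mp hγD (γ.bd_subset_disc hz) (D.inside_subset_disc (hF' z h))

/-- The pole at `w` must not be crossed. If it is inside both contours it is treated as one more
enclosed root; if it is outside both, `1 / (z - w)` belongs to the analytic factor. -/
lemma cauchyTransform_G_contract (hγ : EnclosesPoles b N γ) (hγ0 : 0 ≤ γ.radius)
    (hC : EnclosesZeros a M C) (hD : EnclosesZeros a M D) (hγC : γ.disc ⊆ C.inside)
    (hγD : Disjoint γ.disc D.disc) {S I T : Finset ℕ} (hI : I ⊆ seg N) (hT : T ⊆ seg M) (g : ℤ)
    {w : ℂ} (hw : (w ∈ C.inside ∧ w ∈ D.inside) ∨ (w ∉ C.disc ∧ w ∉ D.disc)) :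
    cauchyTransform C (fun z => G a b z S T g
        * cauchyTransform γ (fun ζ => (G a b ζ I T g)⁻¹) z) w
      = cauchyTransform D (fun z => G a b z S T g
          * cauchyTransform γ (fun ζ => (G a b ζ I T g)⁻¹) z) w
        - γ.integral fun ζ => nodes b S ζ / nodes b I ζ * (ζ - w)⁻¹ := by
  have key : ∀ K : Contour, cauchyTransform K (fun z => G a b z S T g
        * cauchyTransform γ (fun ζ => (G a b ζ I T g)⁻¹) z) w
      = -K.integral fun z => G a b z S T g * (z - w)⁻¹
        * cauchyTransform γ (fun ζ => (G a b ζ I T g)⁻¹) z := fun K => by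
    rw [← Contour.integral_neg, cauchyTransform]
    congr 1; ext z
    rw [← neg_sub z w, div_neg]; ring
  rw [key, key]
  rcases hw with ⟨h1, h2⟩ | ⟨h1, h2⟩
  · have := integral_G_mul_cauchyTransform hγ hγ0 hC hD hγC hγD hI hT (S := S) g isOpen_univ
      (subset_univ _) (subset_univ _) (φ := fun _ => 1) (differentiableOn_const _) {w}
      (by simpa using h1) (by simpa using h2)
    simp only [← Multiset.cons_zero, rootProd_cons, rootProd_zero, mul_one, one_div] at this
    rw [this]; ring
  · have := integral_G_mul_cauchyTransform hγ hγ0 hC hD hγC hγD hI hT (S := S) g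
      (isOpen_compl_singleton (x := w)) (by simpa using h1) (by simpa using h2)
      (φ := fun z => (z - w)⁻¹) (differentiableOn_inv_sub (by simp)) 0 (by simp) (by simp)
    simp only [rootProd_zero, div_one] at this
    rw [this]; ring

lemma double_contract (hγ : EnclosesPoles b N γ) (hγ0 : 0 ≤ γ.radius)
    (hC : EnclosesZeros a M C) (hD : EnclosesZeros a M D) (hγC : γ.disc ⊆ C.inside)
    (hγD : Disjoint γ.disc D.disc) {S I T : Finset ℕ} (hI : I ⊆ seg N) (hT : T ⊆ seg M) (g : ℤ) :
    (C.integral fun z => G a b z S T g * cauchyTransform γ (fun ζ => (G a b ζ I T g)⁻¹) z)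
      = double a b γ D S I T g + γ.integral fun ζ => nodes b S ζ / nodes b I ζ := by
  have := integral_G_mul_cauchyTransform hγ hγ0 hC hD hγC hγD hI hT (S := S) g isOpen_univ
      (subset_univ _) (subset_univ _) (φ := fun _ => 1) (differentiableOn_const _) 0
      (by simp) (by simp)
  simpa [← double_eq hγ hγ0 hD hγD hI hT] using this

lemma double_deform (hC : EnclosesZeros a M C) (hD : EnclosesZeros a M D) (hγ0 : 0 ≤ γ.radius)
    (hγC : Disjoint γ.disc C.disc) (hγD : Disjoint γ.disc D.disc) {S I T : Finset ℕ}
    (hT : T ⊆ seg M) (g : ℤ) : double a b γ C S I T g = double a b γ D S I T g := by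
  refine Contour.integral_congr hγ0 fun ζ hζ => ?_
  have hζ' := γ.bd_subset_disc hζ
  have := hC.integral_G_deform hD hT (b := b) S g (isOpen_compl_singleton (x := ζ))
    (by simpa using disjoint_left.mp hγC hζ') (by simpa using disjoint_left.mp hγD hζ')
    (φ := fun z => (G a b ζ I T g)⁻¹ * (z - ζ)⁻¹) (DifferentiableOn.const_mul
      (differentiableOn_inv_sub (by simp)) _)
  simpa only [div_eq_mul_inv, mul_inv] using this

end

set_option maxHeartbeats 800000 in
/-- The double integral over two large circles expressed through `F₁Set`. -/
theorem pairing_eq_F₁Set {γ Γ Γout Γin C D : Contour} (hγ : EnclosesPoles b N γ)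
    (hγ0 : 0 ≤ γ.radius) (hΓ : EnclosesZeros a M Γ) (hout : EnclosesZeros a M Γout)
    (hin : EnclosesZeros a M Γin) (hnest : Γin.disc ⊆ Γout.inside)
    (hdisj : Disjoint γ.disc Γ.disc) (hdisj' : Disjoint γ.disc Γout.disc)
    (hγD : γ.disc ⊆ D.inside) (houtD : Γout.disc ⊆ D.inside) (hDC : D.disc ⊆ C.inside)
    {I J S T : Finset ℕ} (hI : I ⊆ seg N) (hS : S ⊆ seg N) (hT : T ⊆ seg M)
    (hIS : I ⊆ S ∨ S ⊂ I) (hJS : S ⊆ J ∨ J ⊂ S) (g H : ℤ) :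
    pairing C D (fun z => G a b z S T g * cauchyTransform γ (fun ζ => (G a b ζ I T g)⁻¹) z)
      (fun w => G a b w (seg N \ S) (seg M \ T) (H - 1 - g)
        * cauchyTransform γ (fun ω => (G a b ω (seg N \ J) (seg M \ T) (H - 1 - g))⁻¹) w)
      = (if J ⊂ S then γ.integral fun ζ => nodes b J ζ / nodes b I ζ else 0)
        + F₁Set a b N M H γ Γ Γout Γin I J S T g := by
  set f : ℂ → ℂ := fun z => G a b z S T g * cauchyTransform γ (fun ζ => (G a b ζ I T g)⁻¹) z
    with hf
  set T' := seg M \ T with hT'def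
  set g' := H - 1 - g with hg'
  set k : ℂ → ℂ := fun w => G a b w (seg N \ S) T' g'
    * cauchyTransform γ (fun ω => (G a b ω (seg N \ J) T' g')⁻¹) w with hk
  have hT' : T' ⊆ seg M := Finset.sdiff_subset
  have hinout : Γin.disc ⊆ Γout.disc := hnest.trans Γout.inside_subset_disc
  have hdisjin : Disjoint γ.disc Γin.disc := hdisj'.mono_right hinout
  have hout_inside : ∀ z ∈ Γout.inside, z ∈ D.inside := fun z hz =>
    houtD (Γout.inside_subset_disc hz)
  have hD : EnclosesZeros a M D := ⟨hout_inside _ hout.1, fun k hk => hout_inside _ (hout.2 k hk)⟩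
  have hDinC : ∀ z ∈ D.inside, z ∈ C.inside := fun z hz => hDC (D.inside_subset_disc hz)
  have hC : EnclosesZeros a M C := ⟨hDinC _ hD.1, fun k hk => hDinC _ (hD.2 k hk)⟩
  have hγC : γ.disc ⊆ C.inside := fun z hz => hDinC z (hγD hz)
  have hγin : ∀ {z}, z ∈ Γin.bd → z ∉ γ.disc := fun {z} hz h =>
    disjoint_left.mp hdisjin h (Γin.bd_subset_disc hz)
  have hCnotD : ∀ {z}, z ∈ C.bd → z ∉ D.disc := fun {z} hz h =>
    disjoint_left.mp C.disjoint_bd_inside hz (hDC h)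
  have hCnotγ : ∀ {z}, z ∈ C.bd → z ∉ γ.disc := fun {z} hz h =>
    disjoint_left.mp C.disjoint_bd_inside hz (hγC h)
  have hp : ∀ I ⊆ seg N, ∀ T ⊆ seg M, ∀ g, ContinuousOn (fun ζ => (G a b ζ I T g)⁻¹) γ.bd :=
    fun I hI T hT g => hin.continuousOn_G_inv hγ hT hI g
      (hdisjin.mono γ.bd_subset_disc Γin.inside_subset_disc) γ.disjoint_bd_inside
  have hcont : ∀ K : Contour, EnclosesZeros a M K → Disjoint K.bd γ.bd →
      ContinuousOn f K.bd ∧ ContinuousOn k K.bd := fun K hK hKγ =>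
    ⟨(hK.continuousOn_G hT S g K.disjoint_bd_inside).mul
      (continuousOn_cauchyTransform hγ0 (hp I hI T hT g) hKγ),
     (hK.continuousOn_G hT' _ g' K.disjoint_bd_inside).mul
      (continuousOn_cauchyTransform hγ0 (hp _ Finset.sdiff_subset T' hT' g') hKγ)⟩
  have hCγ : Disjoint C.bd γ.bd :=
    C.disjoint_bd_inside.mono_right (γ.bd_subset_disc.trans hγC)
  have hinγ : Disjoint Γin.bd γ.bd :=
    (hdisjin.mono γ.bd_subset_disc Γin.bd_subset_disc).symm
  have houtγ : Disjoint Γout.bd γ.bd :=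
    (hdisj'.mono γ.bd_subset_disc Γout.bd_subset_disc).symm
  have hCin : Disjoint C.bd Γin.bd := C.disjoint_bd_inside.mono_right
    (Γin.bd_subset_disc.trans (hinout.trans (houtD.trans fun z hz => hDinC z hz)))
  have houtin : Disjoint Γout.bd Γin.bd := Γout.disjoint_bd_inside.mono_right
    (Γin.bd_subset_disc.trans hnest)
  -- the two corrections
  set ψ : ℂ → ℂ := fun z => γ.integral fun ω =>
    nodes b (seg N \ S) ω / nodes b (seg N \ J) ω * (ω - z)⁻¹ with hψ
  set φ : ℂ → ℂ := fun w => γ.integral fun ζ =>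
    nodes b S ζ / nodes b I ζ * (ζ - w)⁻¹ with hφ
  have hcorr : ∀ S I : Finset ℕ, I ⊆ seg N → ∀ s : Set ℂ, Disjoint s γ.bd →
      ContinuousOn (fun z => γ.integral fun ω => nodes b S ω / nodes b I ω * (ω - z)⁻¹) s := by
    intro S I hI s hs
    refine Contour.continuousOn_integral hγ0 (ContinuousOn.mul (ContinuousOn.div
      ((differentiable_nodes b S).continuous.comp continuous_snd).continuousOn
      ((differentiable_nodes b I).continuous.comp continuous_snd).continuousOn
      fun p hp => hγ.nodes_ne_zero_of_bd hI hp.2) (ContinuousOn.inv₀ (by fun_prop) fun p hp =>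
        sub_ne_zero.mpr (hs.ne_of_mem hp.1 hp.2).symm))
  -- The `w` contour is contracted from `D` to `Γin`. The pole `w = z` is outside both, as `z` is on
  -- the larger `C`; the poles `w = ω` contribute `ψ`.
  have h1 : pairing C D f k = pairing C Γin f k - C.integral fun z => f z * ψ z := by
    rw [pairing_eq, pairing_eq, ← Contour.integral_sub hC.radius_pos.le]
    · refine Contour.integral_congr hC.radius_pos.le fun z hz => ?_
      rw [hk, cauchyTransform_G_contract hγ hγ0 hD hin hγD hdisjin Finset.sdiff_subset hT' g'
        (Or.inr ⟨hCnotD hz, fun h => hCnotD hz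
          (D.inside_subset_disc (houtD (hinout h)))⟩)]
      ring
    · exact (hcont C hC hCγ).1.mul (continuousOn_cauchyTransform hin.radius_pos.le
        (hcont Γin hin hinγ).2 hCin)
    · exact (hcont C hC hCγ).1.mul (hcorr _ _ Finset.sdiff_subset _ hCγ)
  -- Now the `z` contour goes from `C` to `Γout`. The pole `z = w` stays inside, as `w` is on `Γin`;
  -- the poles `z = ζ` contribute `φ`.
  have h2 : pairing C Γin f k = pairing Γout Γin f k + Γin.integral fun w => k w * φ w := by
    rw [pairing_swap hC.radius_pos.le hin.radius_pos.le (hcont C hC hCγ).1 (hcont Γin hin hinγ).2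
      hCin, pairing_swap hout.radius_pos.le hin.radius_pos.le (hcont Γout hout houtγ).1
      (hcont Γin hin hinγ).2 houtin, pairing_eq, pairing_eq, neg_add_eq_sub, ← neg_sub,
      ← Contour.integral_sub hin.radius_pos.le]
    · congr 1
      refine Contour.integral_congr hin.radius_pos.le fun w hw => ?_
      have hw' := hnest (Γin.bd_subset_disc hw)
      rw [hf, cauchyTransform_G_contract hγ hγ0 hC hout hγC hdisj' hI hT g
        (Or.inl ⟨hDinC _ (hout_inside _ hw'), hw'⟩)]
      ring
    · exact (hcont Γin hin hinγ).2.mul (continuousOn_cauchyTransform hout.radius_pos.le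
        (hcont Γout hout houtγ).1 houtin.symm)
    · exact (hcont Γin hin hinγ).2.mul (hcorr _ _ hI _ hinγ)
  have h3 : pairing Γout Γin f k = quadruple a b γ Γout Γin S I T g (seg N \ S) (seg N \ J) T' g' :=
    (quadruple_eq hγ hγ0 hout hin hdisj' hdisjin houtin hI Finset.sdiff_subset hT hT' g g').symm
  -- If `I ⊆ S` the integrand of `φ` has no poles in `γ`. Otherwise `φ = -1 / nodes (I \ S)`, which
  -- turns the node set `[N] \ S` of `G` into `[N] \ I` and gives the term of type `J₂`.
  have h4 : (Γin.integral fun w => k w * φ w) =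
      -(if S.card < I.card then double a b γ Γ (seg N \ I) (seg N \ J) T' g' else 0) := by
    rcases hIS with h | h
    · rw [if_neg (by simpa using Finset.card_le_card h)]
      rw [Contour.integral_congr hin.radius_pos.le (g := fun _ => 0), Contour.integral_zero,
        neg_zero]
      intro w hw
      simp only [hφ]
      rw [hγ.integral_nodes_div_of_subset hγ0 h hI
        (differentiableOn_inv_sub (hγin hw)), mul_zero]
    · rw [if_pos (Finset.card_lt_card h), double_deform hΓ hin hγ0 hdisj hdisjin hT',
        double_eq hγ hγ0 hin hdisjin Finset.sdiff_subset hT', ← Contour.integral_neg]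
      refine Contour.integral_congr hin.radius_pos.le fun w hw => ?_
      simp only [hφ, hk]
      rw [hγ.integral_nodes_div_sub_of_ssubset hγ0 h hI (hγin hw),
        ← G_div_nodes hγ (S := seg N \ I) (I := seg N \ S) g'
          (Finset.sdiff_subset_sdiff le_rfl h.1) Finset.sdiff_subset
          (fun hh => hγin hw (γ.inside_subset_disc hh))]
      have : (seg N \ S) \ (seg N \ I) = I \ S := by
        ext x; have := @hI x; simp only [Finset.mem_sdiff]; tauto
      rw [this]; simp only [div_eq_mul_inv]; ring
  -- The same dichotomy for `ψ` gives the term of type `J₁`. Here `z` is still on the large contour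
  -- `C`, and its contraction to `Γ` leaves one more residue, the integral of `nodes J / nodes I`
  -- that becomes the identity part.
  have h5 : (C.integral fun z => f z * ψ z) =
      -((if J ⊂ S then γ.integral fun ζ => nodes b J ζ / nodes b I ζ else 0)
        + if J.card + 1 ≤ S.card then double a b γ Γ J I T g else 0) := by
    rcases hJS with h | h
    · rw [if_neg fun hh => hh.2 h, if_neg (by have := Finset.card_le_card h; omega)]
      rw [Contour.integral_congr hC.radius_pos.le (g := fun _ => 0), Contour.integral_zero]
      · simp
      intro z hz
      simp only [hψ]
      rw [hγ.integral_nodes_div_of_subset hγ0 (Finset.sdiff_subset_sdiff le_rfl h)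
        Finset.sdiff_subset (differentiableOn_inv_sub (hCnotγ hz)), mul_zero]
    · rw [if_pos (Nat.succ_le_of_lt (Finset.card_lt_card h)), if_pos h, add_comm,
        ← double_contract hγ hγ0 hC hΓ hγC hdisj hI hT, ← Contour.integral_neg]
      refine Contour.integral_congr hC.radius_pos.le fun z hz => ?_
      simp only [hψ, hf]
      have hss : seg N \ S ⊂ seg N \ J := by
        refine ⟨Finset.sdiff_subset_sdiff le_rfl h.1, fun hh => h.2 fun x hx => ?_⟩
        by_contra hxJ
        exact (Finset.mem_sdiff.mp (hh (Finset.mem_sdiff.mpr ⟨hS hx, hxJ⟩))).2 hx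
      rw [hγ.integral_nodes_div_sub_of_ssubset hγ0 hss Finset.sdiff_subset (hCnotγ hz),
        ← G_div_nodes hγ (S := J) (I := S) g h.1 hS
          (fun hh => hCnotγ hz (γ.inside_subset_disc hh))]
      have : (seg N \ J) \ (seg N \ S) = S \ J := by
        ext x; have := @hS x; simp only [Finset.mem_sdiff]; tauto
      rw [this]; simp only [div_eq_mul_inv]; ring
  rw [h1, h2, h3, h4, h5]
  unfold F₁Set
  ring

end TwoTime

namespace TwoTime

open Metric Set

/-! ### Concentric circles -/

lemma mem_bd_centered {R : ℝ} {z : ℂ} : z ∈ (Contour.centered R).bd ↔ ‖z‖ = R := by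
  simp [Contour.bd, Contour.centered]

lemma mem_inside_centered {R : ℝ} {z : ℂ} : z ∈ (Contour.centered R).inside ↔ ‖z‖ < R := by
  simp [Contour.inside, Contour.centered]

lemma mem_disc_centered {R : ℝ} {z : ℂ} : z ∈ (Contour.centered R).disc ↔ ‖z‖ ≤ R := by
  simp [Contour.disc, Contour.centered]

lemma disjoint_bd_centered {R R' : ℝ} (h : R ≠ R') :
    Disjoint (Contour.centered R).bd (Contour.centered R').bd :=
  disjoint_left.mpr fun _ h1 h2 => h ((mem_bd_centered.mp h1).symm.trans (mem_bd_centered.mp h2))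

lemma integral_centered_eq {r R : ℝ} (h0 : 0 < r) (hle : r ≤ R) {f : ℂ → ℂ}
    (hf : ∀ z, r ≤ ‖z‖ → ‖z‖ ≤ R → DifferentiableAt ℂ f z) :
    (Contour.centered R).integral f = (Contour.centered r).integral f := by
  unfold Contour.integral Contour.centered
  congr 1
  refine Complex.circleIntegral_eq_of_differentiable_on_annulus_off_countable h0 hle
    Set.countable_empty (fun z hz => ?_) fun z hz => ?_
  · simp only [mem_sdiff, mem_closedBall, dist_zero_right, mem_ball, not_lt] at hz
    exact (hf z hz.2 hz.1).continuousAt.continuousWithinAt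
  · simp only [sdiff_empty, mem_sdiff, mem_closedBall, dist_zero_right, mem_ball, not_le] at hz
    exact hf z hz.2.le hz.1.le

section

variable {r : ℝ} {f k : ℂ → ℂ}

lemma continuousOn_bd_centered (hf : ∀ z, r ≤ ‖z‖ → DifferentiableAt ℂ f z) {R : ℝ}
    (hR : r ≤ R) : ContinuousOn f (Contour.centered R).bd := fun z hz =>
  (hf z (hR.trans (mem_bd_centered.mp hz).ge)).continuousAt.continuousWithinAt

lemma pairing_eq_of_inner (hr : 0 < r) (hk : ∀ z, r ≤ ‖z‖ → DifferentiableAt ℂ k z)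
    {R₁ R₂ R₂' : ℝ} (h2 : r ≤ R₂) (h2' : R₂ ≤ R₂') (h1 : R₂' < R₁) :
    pairing (Contour.centered R₁) (Contour.centered R₂') f k
      = pairing (Contour.centered R₁) (Contour.centered R₂) f k := by
  refine Contour.integral_congr (by simp only [Contour.centered]; linarith) fun z hz => ?_
  refine integral_centered_eq (hr.trans_le h2) h2' fun w hw hw' => ?_
  have hne : z - w ≠ 0 := by
    refine sub_ne_zero.mpr fun h => ?_
    rw [mem_bd_centered] at hz
    rw [← h] at hw'; linarith
  exact ((differentiableAt_const _).mul (hk w (h2.trans hw))).div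
    ((differentiableAt_const _).sub differentiableAt_id) hne

lemma pairing_eq_of_outer (hr : 0 < r) (hf : ∀ z, r ≤ ‖z‖ → DifferentiableAt ℂ f z)
    (hk : ∀ z, r ≤ ‖z‖ → DifferentiableAt ℂ k z)
    {R₁ R₁' R₂ : ℝ} (h2 : r ≤ R₂) (h1 : R₂ < R₁) (h1' : R₁ ≤ R₁') :
    pairing (Contour.centered R₁') (Contour.centered R₂) f k
      = pairing (Contour.centered R₁) (Contour.centered R₂) f k := by
  have hc : ∀ R, R₂ < R → pairing (Contour.centered R) (Contour.centered R₂) f k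
      = -pairing (Contour.centered R₂) (Contour.centered R) k f := fun R hR =>
    pairing_swap (by simp only [Contour.centered]; linarith)
      (by simp only [Contour.centered]; linarith)
      (continuousOn_bd_centered hf (by linarith)) (continuousOn_bd_centered hk h2)
      (disjoint_bd_centered hR.ne')
  rw [hc _ h1, hc _ (by linarith)]
  congr 1
  refine Contour.integral_congr (by simp only [Contour.centered]; linarith) fun w hw => ?_
  refine integral_centered_eq (by linarith) h1' fun z hz hz' => ?_
  have hne : w - z ≠ 0 := by
    refine sub_ne_zero.mpr fun h => ?_
    rw [mem_bd_centered] at hw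
    rw [← h] at hz; linarith
  exact ((differentiableAt_const _).mul (hf z (by linarith))).div
    ((differentiableAt_const _).sub differentiableAt_id) hne

/-- Only the order of the two radii matters: the inner circle can shrink to `r` and the outer one
can grow without either crossing `z = w` or a singularity of `f` or `k`. Both sides are compared at
a common pair of radii. -/
lemma pairing_centered_eq (hr : 0 < r) (hf : ∀ z, r ≤ ‖z‖ → DifferentiableAt ℂ f z)
    (hk : ∀ z, r ≤ ‖z‖ → DifferentiableAt ℂ k z) {R₁ R₂ R₁' R₂' : ℝ} (h2 : r ≤ R₂) (h1 : R₂ < R₁)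
    (h2' : r ≤ R₂') (h1' : R₂' < R₁') :
    pairing (Contour.centered R₁) (Contour.centered R₂) f k
      = pairing (Contour.centered R₁') (Contour.centered R₂') f k := by
  have h : ∀ R₁ R₂, r ≤ R₂ → R₂ < R₁ → ∀ R, R₁ ≤ R →
      pairing (Contour.centered R₁) (Contour.centered R₂) f k
        = pairing (Contour.centered R) (Contour.centered r) f k := fun R₁ R₂ h2 h1 R hR => by
    rw [← pairing_eq_of_outer hr hf hk h2 h1 hR,
      pairing_eq_of_inner hr hk le_rfl h2 (h1.trans_le hR)]
  rw [h _ _ h2 h1 (max R₁ R₁') (le_max_left _ _), h _ _ h2' h1' (max R₁ R₁') (le_max_right _ _)]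

lemma pairing_centered_eq' (hr : 0 < r) (hf : ∀ z, r ≤ ‖z‖ → DifferentiableAt ℂ f z)
    (hk : ∀ z, r ≤ ‖z‖ → DifferentiableAt ℂ k z) {R₁ R₂ R₁' R₂' : ℝ} (h2 : r ≤ R₂) (h1 : R₂ < R₁)
    (h2' : r ≤ R₂') (h1' : R₂' < R₁') :
    pairing (Contour.centered R₂) (Contour.centered R₁) f k
      = pairing (Contour.centered R₂') (Contour.centered R₁') f k := by
  have hc : ∀ R₁ R₂, r ≤ R₂ → R₂ < R₁ → pairing (Contour.centered R₂) (Contour.centered R₁) f k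
      = -pairing (Contour.centered R₁) (Contour.centered R₂) k f := fun R₁ R₂ h2 h1 =>
    pairing_swap (by simp only [Contour.centered]; linarith)
      (by simp only [Contour.centered]; linarith)
      (continuousOn_bd_centered hf h2) (continuousOn_bd_centered hk (by linarith))
      (disjoint_bd_centered h1.ne)
  rw [hc _ _ h2 h1, hc _ _ h2' h1', pairing_centered_eq hr hk hf h2 h1 h2' h1']

/-- In contrast to `Contour.integral_contract`, nothing is known about `k` inside radius `r`.
Subtracting the pole through `dslope` leaves a function analytic on the annulus. -/
lemma integral_centered_contract (hr : 0 < r) (hk : ∀ z, r ≤ ‖z‖ → DifferentiableAt ℂ k z) {R : ℝ}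
    {z : ℂ} (hz : r < ‖z‖) (hzR : ‖z‖ < R) :
    (Contour.centered R).integral (fun w => k w / (w - z))
      = (Contour.centered r).integral (fun w => k w / (w - z)) + k z := by
  have hd : ∀ w, r ≤ ‖w‖ → ‖w‖ ≤ R → DifferentiableAt ℂ (dslope k z) w := by
    intro w hw _
    rcases eq_or_ne w z with rfl | hne
    · have hU : {y : ℂ | r < ‖y‖} ∈ nhds w :=
        (isOpen_lt continuous_const continuous_norm).mem_nhds hz
      have : DifferentiableOn ℂ (dslope k w) {y : ℂ | r < ‖y‖} :=
        (Complex.differentiableOn_dslope hU).mpr fun y hy =>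
          (hk y (le_of_lt hy)).differentiableWithinAt
      exact this.differentiableAt hU
    · exact (differentiableAt_dslope_of_ne hne).mpr (hk w hw)
  have key : ∀ K : ℝ, r ≤ K → K ≤ R → K ≠ ‖z‖ →
      (Contour.centered K).integral (fun w => k w / (w - z))
        = (Contour.centered K).integral (dslope k z)
          + k z * (Contour.centered K).integral fun w => (w - z)⁻¹ := by
    intro K hK hKR hne
    have hne' : ∀ w ∈ (Contour.centered K).bd, w - z ≠ 0 := fun w hw =>
      sub_ne_zero.mpr fun h => hne (by rw [← h, mem_bd_centered.mp hw])
    have hK0 : 0 ≤ (Contour.centered K).radius := by simp only [Contour.centered]; linarith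
    rw [← Contour.integral_const_mul, ← Contour.integral_add hK0]
    · refine Contour.integral_congr hK0 fun w hw => ?_
      have h2 := sub_smul_dslope k z w
      have h3 := hne' w hw
      simp only [smul_eq_mul] at h2 ⊢
      field_simp
      linear_combination -h2
    · intro w hw
      have := mem_bd_centered.mp hw
      exact (hd w (by linarith) (by linarith)).continuousAt.continuousWithinAt
    · exact continuousOn_const.mul (ContinuousOn.inv₀ (by fun_prop) hne')
  rw [key R (by linarith) le_rfl hzR.ne', key r le_rfl (by linarith) hz.ne,
    integral_centered_eq hr (by linarith) hd,
    Contour.integral_inv_sub (mem_inside_centered.mpr hzR),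
    Contour.integral_eq_zero (C := Contour.centered r) hr.le (f := fun w => (w - z)⁻¹)]
  · ring
  · exact differentiableOn_inv_sub (by rw [mem_disc_centered]; exact not_le.mpr hz)

/-- Interchanging the radii of the two circles costs the residue at `z = w`. -/
lemma pairing_centered_sub (hr : 0 < r) (hf : ∀ z, r ≤ ‖z‖ → DifferentiableAt ℂ f z)
    (hk : ∀ z, r ≤ ‖z‖ → DifferentiableAt ℂ k z) {R₁ R₂ : ℝ} (h2 : r ≤ R₂) (h1 : R₂ < R₁) :
    pairing (Contour.centered R₁) (Contour.centered R₂) f k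
      - pairing (Contour.centered R₂) (Contour.centered R₁) f k
      = (Contour.centered r).integral fun z => f z * k z := by
  -- With `z` fixed at radius `r + 1`, the `w` circle shrinks from `r + 2` to `r` and crosses only
  -- `w = z`. The other radii reduce to these by the preceding lemmas.
  have e : pairing (Contour.centered (r + 1)) (Contour.centered (r + 2)) f k
      = pairing (Contour.centered (r + 1)) (Contour.centered r) f k
        - (Contour.centered (r + 1)).integral fun z => f z * k z := by
    have h0 : 0 ≤ (Contour.centered (r + 1)).radius := by simp only [Contour.centered]; linarith
    rw [pairing_eq, pairing_eq, ← Contour.integral_sub h0]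
    · refine Contour.integral_congr h0 fun z hz => ?_
      have hz' := mem_bd_centered.mp hz
      have h := integral_centered_contract hr hk (R := r + 2) (z := z) (by linarith) (by linarith)
      have hcT : ∀ K, cauchyTransform K k z = -K.integral fun w => k w / (w - z) := fun K => by
        rw [← Contour.integral_neg, cauchyTransform]
        congr 1; ext w; rw [← neg_sub w z, div_neg]
      simp only [hcT, h]; ring
    · exact (continuousOn_bd_centered hf (by linarith)).mul (continuousOn_cauchyTransform hr.le
        (continuousOn_bd_centered hk le_rfl) (disjoint_bd_centered (by linarith)))
    · exact (continuousOn_bd_centered hf (by linarith)).mul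
        (continuousOn_bd_centered hk (by linarith))
  rw [pairing_centered_eq hr hf hk h2 h1 le_rfl (lt_add_one r),
    pairing_centered_eq' hr hf hk h2 h1 (by linarith : r ≤ r + 1) (by linarith : r + 1 < r + 2),
    e, sub_sub_cancel]
  exact integral_centered_eq hr (by linarith) fun z hz _ => (hf z hz).mul (hk z hz)

end

/-! ### The orthogonalization -/

variable {a b : ℕ → ℝ} {N M : ℕ}

/-- The factor of the integrand of `L` which depends on `z`. -/
def rowFun (a b : ℕ → ℝ) (n : ℕ) (T : Finset ℕ) (e : ℤ) (i : ℕ) (z : ℂ) : ℂ :=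
  ((b i : ℂ) * z) ^ e * (nodes b (seg n) z / nodes b (seg i) z)
    * ∏ k ∈ T, (1 - (a k : ℂ) * b i) / (1 - (a k : ℂ) / z)

/-- The factor of the integrand of `L` which depends on `w`. -/
def colFun (a b : ℕ → ℝ) (n : ℕ) (T : Finset ℕ) (e : ℤ) (j : ℕ) (w : ℂ) : ℂ :=
  ((b j : ℂ) * w) ^ e * (nodes b (seg (j - 1)) w / nodes b (seg n) w)
    * ∏ k ∈ T, (1 - (a k : ℂ) * b j) / (1 - (a k : ℂ) / w)

lemma L_eq_pairing (n m M : ℕ) (h H : ℤ) (Rz Rw : ℝ) (i j : ℕ) :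
    L a b n m M h H Rz Rw i j = pairing (Contour.centered Rz) (Contour.centered Rw)
      (rowFun a b n (seg m) (h - 1) i) (colFun a b n (seg M \ seg m) (H - h) j) := by
  unfold L pairing rowFun colFun nodes
  congr 1; ext z; congr 1; ext w
  ring

/-- The parameters satisfy `b_k ≠ 0` and `a_l b_k ≠ 1`. -/
def Generic (a b : ℕ → ℝ) (N M : ℕ) : Prop :=
  (∀ k ∈ seg N, (b k : ℂ) ≠ 0) ∧ ∀ l ∈ seg M, ∀ k ∈ seg N, (1 - (a l : ℂ) * b k) ≠ 0

lemma mem_seg {k n : ℕ} : k ∈ seg n ↔ 1 ≤ k ∧ k ≤ n := Finset.mem_Icc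

lemma seg_mono {m n : ℕ} (h : m ≤ n) : seg m ⊆ seg n := fun _ hk =>
  mem_seg.mpr ⟨(mem_seg.mp hk).1, (mem_seg.mp hk).2.trans h⟩

lemma nodes_seg_succ (k : ℕ) (z : ℂ) :
    nodes b (seg (k + 1)) z = nodes b (seg k) z * (z - 1 / (b (k + 1) : ℂ)) :=
  Finset.prod_Icc_succ_top (by omega) _

/-- Newton's interpolation formula for `1 / (z - ζ)`. -/
lemma sum_nodes_div_nodes (N : ℕ) {z ζ : ℂ} (hz : ∀ k ∈ seg N, z ≠ 1 / (b k : ℂ)) (h : z ≠ ζ) :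
    (∑ k : Fin N, nodes b (seg k) ζ / nodes b (seg (k + 1)) z)
      = (1 - nodes b (seg N) ζ / nodes b (seg N) z) / (z - ζ) := by
  have h0 := sub_ne_zero.mpr h
  induction N with
  | zero => simp [nodes, seg]
  | succ N ih =>
    have hz' : ∀ k ∈ seg N, z ≠ 1 / (b k : ℂ) := fun k hk => hz k (seg_mono (Nat.le_succ N) hk)
    have h1 := nodes_ne_zero hz'
    have h2 := sub_ne_zero.mpr (hz (N + 1) (mem_seg.mpr ⟨by omega, le_rfl⟩))
    rw [Fin.sum_univ_castSucc]
    simp only [Fin.val_castSucc, Fin.val_last]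
    rw [ih hz', nodes_seg_succ, nodes_seg_succ]
    generalize 1 / (b (N + 1) : ℂ) = β at *
    field_simp
    ring

lemma G_inv (z : ℂ) (S T : Finset ℕ) (e : ℤ) :
    (G a b z S T e)⁻¹ = z ^ (-e) * (∏ k ∈ T, (1 - (a k : ℂ) / z)) * (nodes b S z)⁻¹ := by
  rw [G_eq, mul_inv, mul_inv, ← Finset.prod_inv_distrib, zpow_neg]
  simp only [inv_inv]; ring

lemma differentiableOn_zpow_mul_prod (T : Finset ℕ) (e : ℤ) {s : Set ℂ} (hs : (0 : ℂ) ∉ s) :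
    DifferentiableOn ℂ (fun z => z ^ (-e) * ∏ k ∈ T, (1 - (a k : ℂ) / z)) s := by
  intro z hz
  have hz0 : z ≠ 0 := fun h => hs (h ▸ hz)
  refine DifferentiableAt.differentiableWithinAt (DifferentiableAt.mul
    (differentiableAt_id.zpow (Or.inl hz0)) (DifferentiableAt.fun_finsetProd fun k hk => ?_))
  exact (differentiableAt_const _).sub ((differentiableAt_const _).div differentiableAt_id hz0)

lemma continuousOn_orthogonalizing {γ : Contour} (hγ : EnclosesPoles b N γ)
    (h0 : (0 : ℂ) ∉ γ.disc) {I J T : Finset ℕ} (hI : I ⊆ seg N) (e : ℤ) {c : ℂ} (d : ℕ → ℂ)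
    (hc : c ≠ 0) :
    ContinuousOn (fun ζ => nodes b J ζ / nodes b I ζ * (c * ζ) ^ e
      * ∏ k ∈ T, (1 - (a k : ℂ) / ζ) / d k) γ.bd := by
  have hz0 : ∀ z ∈ γ.bd, z ≠ 0 := fun z hz h => h0 (h ▸ γ.bd_subset_disc hz)
  refine ContinuousOn.mul (ContinuousOn.mul ((differentiable_nodes _ _).continuous.continuousOn.div
    (differentiable_nodes _ _).continuous.continuousOn fun z hz => hγ.nodes_ne_zero_of_bd hI hz)
    ((continuousOn_const.mul continuousOn_id).zpow₀ _ fun z hz =>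
      Or.inl (mul_ne_zero hc (hz0 z hz)))) (continuousOn_finsetProd _ fun k hk => ?_)
  exact (continuousOn_const.sub (continuousOn_const.div continuousOn_id hz0)).div_const _

/-- For `i < j` the denominator divides the numerator and the integrand is analytic. For `i = j`
there is one simple pole at `1 / b_j`, where the remaining factors are normalized to equal `1`. -/
lemma integral_orthogonalizing {γ : Contour} (hγ : EnclosesPoles b N γ) (hγ0 : 0 ≤ γ.radius)
    (h0 : (0 : ℂ) ∉ γ.disc) {i j : ℕ} (hj : 1 ≤ j) (hij : i ≤ j) (hjN : j ≤ N) (T : Finset ℕ)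
    (e : ℤ) (hc : (b j : ℂ) ≠ 0) (hT : ∀ k ∈ T, (1 - (a k : ℂ) * b j) ≠ 0) :
    (γ.integral fun ζ => nodes b (seg (j - 1)) ζ / nodes b (seg i) ζ * ((b j : ℂ) * ζ) ^ e
      * ∏ k ∈ T, (1 - (a k : ℂ) / ζ) / (1 - (a k : ℂ) * b j)) = if i = j then 1 else 0 := by
  have hφ : DifferentiableOn ℂ (fun ζ => ((b j : ℂ) * ζ) ^ e
      * ∏ k ∈ T, (1 - (a k : ℂ) / ζ) / (1 - (a k : ℂ) * b j)) γ.disc := by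
    intro z hz
    have hz0 : z ≠ 0 := fun h => h0 (h ▸ hz)
    refine DifferentiableAt.differentiableWithinAt (DifferentiableAt.mul
      (((differentiableAt_const _).mul differentiableAt_id).zpow (Or.inl (mul_ne_zero hc hz0)))
      (DifferentiableAt.fun_finsetProd fun k hk => DifferentiableAt.div_const ?_ _))
    exact (differentiableAt_const _).sub ((differentiableAt_const _).div differentiableAt_id hz0)
  simp only [mul_assoc]
  split_ifs with h
  · subst h
    obtain ⟨i, rfl⟩ : ∃ l, i = l + 1 := ⟨i - 1, by omega⟩
    have hin := hγ (i + 1) (mem_seg.mpr ⟨hj, hjN⟩)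
    rw [Contour.integral_congr hγ0 (g := fun ζ => (((b (i + 1) : ℂ) * ζ) ^ e
      * ∏ k ∈ T, (1 - (a k : ℂ) / ζ) / (1 - (a k : ℂ) * b (i + 1))) / (ζ - 1 / (b (i + 1) : ℂ)))]
    · rw [Contour.integral_div_sub hφ hin, mul_one_div_cancel hc, one_zpow, one_mul]
      refine Finset.prod_eq_one fun k hk => ?_
      rw [div_div_eq_mul_div, div_one, div_self (hT k hk)]
    · intro ζ hζ
      have h1 := hγ.nodes_ne_zero_of_bd (seg_mono hjN) hζ
      simp only [Nat.add_sub_cancel]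
      rw [nodes_seg_succ] at h1 ⊢
      have h2 := left_ne_zero_of_mul h1
      have h3 := right_ne_zero_of_mul h1
      generalize 1 / (b (i + 1) : ℂ) = β at *
      field_simp
  · exact hγ.integral_nodes_div_of_subset hγ0 (seg_mono (by omega)) (seg_mono (by omega)) hφ

section

variable {γ : Contour} (hab : Generic a b N M) (hγ : EnclosesPoles b N γ) (hγ0 : 0 ≤ γ.radius)
  (h0 : (0 : ℂ) ∉ γ.disc)
include hab hγ hγ0 h0

/-- The powers of `b_k` and the factors `1 - a_l b_k` of `A` and of the row cancel, and the sum over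
`k` is Newton's formula for `1 / (z - ζ)`. Its main term is the Cauchy transform. The remainder
contains `nodes (seg N) ζ / nodes (seg i) ζ`, is analytic in `ζ` inside `γ`, and integrates to zero.
-/
lemma sum_A_mul_rowFun {n m : ℕ} (hm : m ≤ M) (h : ℤ) {i : ℕ} (hi : i ≤ N) {z : ℂ}
    (hz : z ∉ γ.disc) :
    (∑ k : Fin N, A a b m h γ i (k + 1) * rowFun a b n (seg m) (h - 1) (k + 1) z)
      = G a b z (seg n) (seg m) (h - 1)
        * cauchyTransform γ (fun ζ => (G a b ζ (seg i) (seg m) (h - 1))⁻¹) z := by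
  have hzne : ∀ k ∈ seg N, z ≠ 1 / (b k : ℂ) := fun k hk e =>
    hz (e ▸ γ.inside_subset_disc (hγ k hk))
  have hk1 : ∀ k : Fin N, (k : ℕ) + 1 ∈ seg N := fun k => mem_seg.mpr ⟨by omega, by omega⟩
  unfold A
  simp_rw [← Contour.integral_mul_const]
  rw [← Contour.integral_sum hγ0]
  swap
  · intro k _
    exact (continuousOn_orthogonalizing hγ h0 (seg_mono hi) _ _
      (hab.1 _ (hk1 k))).mul continuousOn_const
  set τ : ℂ → ℂ := fun ζ => ζ ^ (-(h - 1)) * ∏ k ∈ seg m, (1 - (a k : ℂ) / ζ) with hτ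
  set Gz := G a b z (seg n) (seg m) (h - 1) with hGz
  have hτd : DifferentiableOn ℂ τ γ.disc := differentiableOn_zpow_mul_prod _ _ h0
  have hpt : EqOn (fun ζ => ∑ k : Fin N, (∏ l ∈ seg ((k : ℕ) + 1 - 1), (ζ - 1 / (b l : ℂ)))
        / (∏ l ∈ seg i, (ζ - 1 / (b l : ℂ))) * ((b ((k : ℕ) + 1) : ℂ) * ζ) ^ (1 - h)
        * (∏ l ∈ seg m, (1 - (a l : ℂ) / ζ) / (1 - (a l : ℂ) * b ((k : ℕ) + 1)))
        * rowFun a b n (seg m) (h - 1) (k + 1) z)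
      (fun ζ => Gz * ((G a b ζ (seg i) (seg m) (h - 1))⁻¹ / (z - ζ))
        - Gz / nodes b (seg N) z * (nodes b (seg N) ζ / nodes b (seg i) ζ * (τ ζ / (z - ζ))))
      γ.bd := by
    intro ζ hζ
    have hne : z ≠ ζ := fun e => hz (e ▸ γ.bd_subset_disc hζ)
    have hζ0 : ζ ≠ 0 := fun e => h0 (e ▸ γ.bd_subset_disc hζ)
    have hterm : ∀ k : Fin N, (∏ l ∈ seg ((k : ℕ) + 1 - 1), (ζ - 1 / (b l : ℂ)))
        / (∏ l ∈ seg i, (ζ - 1 / (b l : ℂ))) * ((b ((k : ℕ) + 1) : ℂ) * ζ) ^ (1 - h)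
        * (∏ l ∈ seg m, (1 - (a l : ℂ) / ζ) / (1 - (a l : ℂ) * b ((k : ℕ) + 1)))
        * rowFun a b n (seg m) (h - 1) (k + 1) z
        = Gz * (τ ζ / nodes b (seg i) ζ)
          * (nodes b (seg k) ζ / nodes b (seg (k + 1)) z) := by
      intro k
      have hb := hab.1 _ (hk1 k)
      have hp : ∏ l ∈ seg m, (1 - (a l : ℂ) * b ((k : ℕ) + 1)) ≠ 0 :=
        Finset.prod_ne_zero_iff.mpr fun l hl => hab.2 l (seg_mono hm hl) _ (hk1 k)
      have hp1 : (b ((k : ℕ) + 1) : ℂ) ^ (1 - h) * (b ((k : ℕ) + 1) : ℂ) ^ (h - 1) = 1 := by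
        rw [← zpow_add₀ hb]; simp
      rw [hGz, G_eq]
      simp only [rowFun, hτ, Finset.prod_div_distrib, mul_zpow, Nat.add_sub_cancel, neg_sub,
        Finset.prod_inv_distrib]
      change nodes b (seg k) ζ / nodes b (seg i) ζ * _ * _ * _ = _
      simp only [div_eq_mul_inv]
      linear_combination (nodes b (seg k) ζ * (nodes b (seg i) ζ)⁻¹ * ζ ^ (1 - h)
        * (∏ l ∈ seg m, (1 - (a l : ℂ) * ζ⁻¹)) * z ^ (h - 1) * nodes b (seg n) z
        * (nodes b (seg (k + 1)) z)⁻¹ * (∏ l ∈ seg m, (1 - (a l : ℂ) * z⁻¹))⁻¹) *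
        (hp1 + (b ((k : ℕ) + 1) : ℂ) ^ (1 - h) * (b ((k : ℕ) + 1) : ℂ) ^ (h - 1)
          * (inv_mul_cancel₀ hp) )
    simp only [hterm]
    rw [← Finset.mul_sum, sum_nodes_div_nodes N hzne hne, G_inv]
    simp only [hτ, div_eq_mul_inv]; ring
  have hφ : DifferentiableOn ℂ (fun ζ => τ ζ / (z - ζ)) γ.disc :=
    hτd.div ((differentiableOn_const _).sub differentiableOn_id)
      fun ζ hζ => sub_ne_zero.mpr fun e => hz (e ▸ hζ)
  have hp : ContinuousOn (fun ζ => (G a b ζ (seg i) (seg m) (h - 1))⁻¹ / (z - ζ)) γ.bd := by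
    refine ContinuousOn.div ?_ (by fun_prop) fun ζ hζ =>
      sub_ne_zero.mpr fun e => hz (e ▸ γ.bd_subset_disc hζ)
    simp only [G_inv]
    exact (hτd.continuousOn.mono γ.bd_subset_disc).mul
      ((differentiable_nodes _ _).continuous.continuousOn.inv₀
        fun ζ hζ => hγ.nodes_ne_zero_of_bd (seg_mono hi) hζ)
  rw [Contour.integral_congr hγ0 hpt]
  refine (Contour.integral_sub hγ0
    (f := fun ζ => Gz * ((G a b ζ (seg i) (seg m) (h - 1))⁻¹ / (z - ζ)))
    (continuousOn_const.mul hp) ?_).trans ?_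
  rotate_left
  · rw [Contour.integral_const_mul, Contour.integral_const_mul,
      hγ.integral_nodes_div_of_subset hγ0 (seg_mono hi) (seg_mono hi) hφ, mul_zero, sub_zero]
    rfl
  · exact continuousOn_const.mul (((differentiable_nodes _ _).continuous.continuousOn.div
      (differentiable_nodes _ _).continuous.continuousOn
      fun ζ hζ => hγ.nodes_ne_zero_of_bd (seg_mono hi) hζ).mul
      (hφ.continuousOn.mono γ.bd_subset_disc))

/-- Newton's formula again, with the roles of its terms exchanged: the nodes are now in the variable
`ω` of `γ`, so the remainder `nodes (seg N) w / nodes (seg N) ω` yields the Cauchy transform and the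
main term is analytic in `ω`. The denominator `nodes b ∅ = 1` only fits this term to
`integral_nodes_div_of_subset`. -/
lemma sum_colFun_mul_B {n m : ℕ} (hn : n ≤ N) (h H : ℤ) {j : ℕ} (hj : j ≤ N)
    {w : ℂ} (hw : w ∉ γ.disc) :
    (∑ k : Fin N, colFun a b n (seg M \ seg m) (H - h) (k + 1) w * B a b m M h H γ (k + 1) j)
      = G a b w (seg N \ seg n) (seg M \ seg m) (H - h)
        * cauchyTransform γ (fun ω => (G a b ω (seg N \ seg (j - 1)) (seg M \ seg m) (H - h))⁻¹) w
    := by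
  set U := seg M \ seg m with hU
  have hwne : ∀ k ∈ seg N, w ≠ 1 / (b k : ℂ) := fun k hk e =>
    hw (e ▸ γ.inside_subset_disc (hγ k hk))
  have hk1 : ∀ k : Fin N, (k : ℕ) + 1 ∈ seg N := fun k => mem_seg.mpr ⟨by omega, by omega⟩
  have hj1 : seg (j - 1) ⊆ seg N := seg_mono (by omega)
  unfold B
  simp_rw [← Contour.integral_const_mul]
  rw [← Contour.integral_sum hγ0]
  swap
  · intro k _
    exact continuousOn_const.mul (continuousOn_orthogonalizing hγ h0
      (seg_mono (mem_seg.mp (hk1 k)).2) _ _ (hab.1 _ (hk1 k)))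
  set τ : ℂ → ℂ := fun ζ => ζ ^ (-(H - h)) * ∏ k ∈ U, (1 - (a k : ℂ) / ζ) with hτ
  set Gw := G a b w (seg N \ seg n) U (H - h) with hGw
  have hτd : DifferentiableOn ℂ τ γ.disc := differentiableOn_zpow_mul_prod _ _ h0
  have hpt : EqOn (fun ω => ∑ k : Fin N, colFun a b n U (H - h) (k + 1) w
        * ((∏ l ∈ seg (j - 1), (ω - 1 / (b l : ℂ)))
        / (∏ l ∈ seg ((k : ℕ) + 1), (ω - 1 / (b l : ℂ))) * ((b ((k : ℕ) + 1) : ℂ) * ω) ^ (h - H)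
        * (∏ l ∈ U, (1 - (a l : ℂ) / ω) / (1 - (a l : ℂ) * b ((k : ℕ) + 1)))))
      (fun ω => Gw * ((G a b ω (seg N \ seg (j - 1)) U (H - h))⁻¹ / (w - ω))
        - Gw / nodes b (seg N) w
          * (nodes b (seg (j - 1)) ω / nodes b ∅ ω * (τ ω / (w - ω))))
      γ.bd := by
    intro ω hω
    have hne : w ≠ ω := fun e => hw (e ▸ γ.bd_subset_disc hω)
    have hω0 : ω ≠ 0 := fun e => h0 (e ▸ γ.bd_subset_disc hω)
    have hωne : ∀ k ∈ seg N, ω ≠ 1 / (b k : ℂ) := fun k hk e =>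
      Contour.ne_of_bd_inside hω (hγ k hk) e
    have hterm : ∀ k : Fin N, colFun a b n U (H - h) (k + 1) w
        * ((∏ l ∈ seg (j - 1), (ω - 1 / (b l : ℂ)))
        / (∏ l ∈ seg ((k : ℕ) + 1), (ω - 1 / (b l : ℂ))) * ((b ((k : ℕ) + 1) : ℂ) * ω) ^ (h - H)
        * (∏ l ∈ U, (1 - (a l : ℂ) / ω) / (1 - (a l : ℂ) * b ((k : ℕ) + 1))))
        = w ^ (H - h) * (∏ l ∈ U, (1 - (a l : ℂ) / w)⁻¹) * (nodes b (seg n) w)⁻¹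
          * (τ ω * nodes b (seg (j - 1)) ω)
          * (nodes b (seg k) w / nodes b (seg (k + 1)) ω) := by
      intro k
      have hb := hab.1 _ (hk1 k)
      have hp : ∏ l ∈ U, (1 - (a l : ℂ) * b ((k : ℕ) + 1)) ≠ 0 :=
        Finset.prod_ne_zero_iff.mpr fun l hl => hab.2 l (Finset.sdiff_subset hl) _ (hk1 k)
      have hp1 : (b ((k : ℕ) + 1) : ℂ) ^ (h - H) * (b ((k : ℕ) + 1) : ℂ) ^ (H - h) = 1 := by
        rw [← zpow_add₀ hb]; simp
      simp only [colFun, hτ, Finset.prod_div_distrib, mul_zpow, Nat.add_sub_cancel, neg_sub,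
        Finset.prod_inv_distrib]
      change _ * (nodes b (seg (j - 1)) ω / nodes b (seg (k + 1)) ω * _ * _) = _
      simp only [div_eq_mul_inv]
      linear_combination (nodes b (seg (j - 1)) ω * (nodes b (seg (k + 1)) ω)⁻¹ * ω ^ (h - H)
        * (∏ l ∈ U, (1 - (a l : ℂ) * ω⁻¹)) * w ^ (H - h) * nodes b (seg k) w
        * (nodes b (seg n) w)⁻¹ * (∏ l ∈ U, (1 - (a l : ℂ) * w⁻¹))⁻¹) *
        (hp1 + (b ((k : ℕ) + 1) : ℂ) ^ (h - H) * (b ((k : ℕ) + 1) : ℂ) ^ (H - h)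
          * (inv_mul_cancel₀ hp) )
    simp only [hterm]
    rw [← Finset.mul_sum, sum_nodes_div_nodes N hωne hne.symm, G_inv, hGw, G_eq,
      ← nodes_div_eq (seg_mono hn) (nodes_ne_zero fun k hk => hwne k (seg_mono hn hk)),
      ← nodes_div_eq hj1 (nodes_ne_zero fun k hk => hωne k (hj1 hk)), ← neg_sub w ω]
    have e1 := nodes_ne_zero hωne
    have e2 := nodes_ne_zero hwne
    have e3 : nodes b (seg (j - 1)) ω ≠ 0 := nodes_ne_zero fun k hk => hωne k (hj1 hk)
    have e4 := sub_ne_zero.mpr hne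
    have e5 : nodes b ∅ ω = 1 := by simp [nodes]
    rw [e5]
    simp only [hτ, div_eq_mul_inv, mul_inv, inv_inv, inv_neg, inv_one]
    field_simp
    ring
  have hφ : DifferentiableOn ℂ (fun ζ => τ ζ / (w - ζ)) γ.disc :=
    hτd.div ((differentiableOn_const _).sub differentiableOn_id)
      fun ζ hζ => sub_ne_zero.mpr fun e => hw (e ▸ hζ)
  have hp : ContinuousOn (fun ω => (G a b ω (seg N \ seg (j - 1)) U (H - h))⁻¹ / (w - ω)) γ.bd := by
    refine ContinuousOn.div ?_ (by fun_prop) fun ζ hζ =>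
      sub_ne_zero.mpr fun e => hw (e ▸ γ.bd_subset_disc hζ)
    simp only [G_inv]
    exact (hτd.continuousOn.mono γ.bd_subset_disc).mul
      ((differentiable_nodes _ _).continuous.continuousOn.inv₀
        fun ζ hζ => hγ.nodes_ne_zero_of_bd Finset.sdiff_subset hζ)
  rw [Contour.integral_congr hγ0 hpt]
  refine (Contour.integral_sub hγ0
    (f := fun ω => Gw * ((G a b ω (seg N \ seg (j - 1)) U (H - h))⁻¹ / (w - ω)))
    (continuousOn_const.mul hp) ?_).trans ?_
  rotate_left
  · rw [Contour.integral_const_mul, Contour.integral_const_mul,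
      hγ.integral_nodes_div_of_subset hγ0 (Finset.empty_subset _) (Finset.empty_subset _) hφ,
      mul_zero, sub_zero]
    rfl
  · exact continuousOn_const.mul (((differentiable_nodes _ _).continuous.continuousOn.div
      (differentiable_nodes _ _).continuous.continuousOn
      fun ζ hζ => hγ.nodes_ne_zero_of_bd (Finset.empty_subset _) hζ).mul
      (hφ.continuousOn.mono γ.bd_subset_disc))

lemma isLowerUnitriangular_A {m : ℕ} (hm : m ≤ M) (h : ℤ) :
    IsLowerUnitriangular (toMatrix N (A a b m h γ)) := by
  have key : ∀ i j : Fin N, i ≤ j → toMatrix N (A a b m h γ) i j = if (i : ℕ) = j then 1 else 0 := by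
    intro i j hij
    have hj : (j : ℕ) + 1 ∈ seg N := mem_seg.mpr ⟨by omega, by omega⟩
    have := integral_orthogonalizing (a := a) hγ hγ0 h0 (i := i + 1) (j := j + 1) (by omega)
      (by have := Fin.le_def.mp hij; omega) (by omega) (seg m) (1 - h) (hab.1 _ hj)
      fun k hk => hab.2 k (seg_mono hm hk) _ hj
    simp only [Nat.add_right_cancel_iff] at this
    exact this
  exact ⟨fun i j hij => by rw [key i j hij.le, if_neg (Fin.lt_def.mp hij).ne],
    fun i => by rw [key i i le_rfl, if_pos rfl]⟩

lemma isLowerUnitriangular_B {m : ℕ} (h H : ℤ) :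
    IsLowerUnitriangular (toMatrix N (B a b m M h H γ)) := by
  have key : ∀ i j : Fin N, i ≤ j →
      toMatrix N (B a b m M h H γ) i j = if (i : ℕ) = j then 1 else 0 := by
    intro i j hij
    have hj : (j : ℕ) + 1 ∈ seg N := mem_seg.mpr ⟨by omega, by omega⟩
    -- The normalization in `B` uses `b_i`, not `b_j`, so `integral_orthogonalizing` covers only the
    -- diagonal. Above it the integrand is analytic for the same reason.
    rcases hij.lt_or_eq with hlt | rfl
    · have hlt' := Fin.lt_def.mp hlt
      rw [if_neg hlt'.ne]
      have hi : (i : ℕ) + 1 ∈ seg N := mem_seg.mpr ⟨by omega, by omega⟩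
      have hφ : DifferentiableOn ℂ (fun ζ => ((b (i + 1) : ℂ) * ζ) ^ (h - H)
          * ∏ k ∈ seg M \ seg m, (1 - (a k : ℂ) / ζ) / (1 - (a k : ℂ) * b (i + 1))) γ.disc := by
        intro z hz
        have hz0 : z ≠ 0 := fun h => h0 (h ▸ hz)
        refine DifferentiableAt.differentiableWithinAt (DifferentiableAt.mul
          (((differentiableAt_const _).mul differentiableAt_id).zpow
            (Or.inl (mul_ne_zero (hab.1 _ hi) hz0)))
          (DifferentiableAt.fun_finsetProd fun k hk => DifferentiableAt.div_const ?_ _))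
        exact (differentiableAt_const _).sub
          ((differentiableAt_const _).div differentiableAt_id hz0)
      have := hγ.integral_nodes_div_of_subset hγ0 (S := seg (j + 1 - 1)) (I := seg (i + 1))
        (seg_mono (by omega)) (seg_mono (by omega)) hφ
      simp only [← mul_assoc] at this
      exact this
    · have := integral_orthogonalizing (a := a) hγ hγ0 h0 (i := i + 1) (j := i + 1) (by omega)
        le_rfl (by omega) (seg M \ seg m) (h - H) (hab.1 _ hj)
        fun k hk => hab.2 k (Finset.sdiff_subset hk) _ hj
      rw [if_pos rfl] at this ⊢
      exact this
  exact ⟨fun i j hij => by rw [key i j hij.le, if_neg (Fin.lt_def.mp hij).ne],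
    fun i => by rw [key i i le_rfl, if_pos rfl]⟩

/-- Conjugating `L` by the orthogonalizing matrices, for circles which enclose `γ`. -/
lemma A_mul_L_mul_B {n m : ℕ} (hn : n ≤ N) (hm : m ≤ M) (h H : ℤ) {Rz Rw : ℝ} (hne : Rz ≠ Rw)
    (hz : γ.disc ⊆ (Contour.centered Rz).inside) (hw : γ.disc ⊆ (Contour.centered Rw).inside)
    (hRz : 0 < Rz) (hRw : 0 < Rw)
    (hf : ∀ i ∈ seg N, ContinuousOn (rowFun a b n (seg m) (h - 1) i) (Contour.centered Rz).bd)
    (hk : ∀ j ∈ seg N,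
      ContinuousOn (colFun a b n (seg M \ seg m) (H - h) j) (Contour.centered Rw).bd)
    (i j : Fin N) :
    (toMatrix N (A a b m h γ) * toMatrix N (L a b n m M h H Rz Rw)
        * toMatrix N (B a b m M h H γ)) i j
      = pairing (Contour.centered Rz) (Contour.centered Rw)
        (fun z => G a b z (seg n) (seg m) (h - 1)
          * cauchyTransform γ (fun ζ => (G a b ζ (seg (i + 1)) (seg m) (h - 1))⁻¹) z)
        (fun w => G a b w (seg N \ seg n) (seg M \ seg m) (H - h)
          * cauchyTransform γ
            (fun ω => (G a b ω (seg N \ seg (j + 1 - 1)) (seg M \ seg m) (H - h))⁻¹) w) := by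
  have hmem : ∀ k : Fin N, (k : ℕ) + 1 ∈ seg N := fun k => mem_seg.mpr ⟨by omega, by omega⟩
  have h1 : (toMatrix N (A a b m h γ) * toMatrix N (L a b n m M h H Rz Rw)
        * toMatrix N (B a b m M h H γ)) i j
      = ∑ k : Fin N, ∑ l : Fin N, A a b m h γ (i + 1) (k + 1)
        * pairing (Contour.centered Rz) (Contour.centered Rw)
          (rowFun a b n (seg m) (h - 1) (k + 1))
          (colFun a b n (seg M \ seg m) (H - h) (l + 1)) * B a b m M h H γ (l + 1) (j + 1) := by
    simp only [Matrix.mul_apply, toMatrix, Matrix.of_apply, Finset.sum_mul, L_eq_pairing]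
    exact Finset.sum_comm
  rw [h1, pairing_sum hRz.le hRw.le (disjoint_bd_centered hne) Finset.univ Finset.univ
    (fun k : Fin N => rowFun a b n (seg m) (h - 1) (k + 1))
    (fun l : Fin N => colFun a b n (seg M \ seg m) (H - h) (l + 1))
    (fun k : Fin N => A a b m h γ (i + 1) (k + 1))
    (fun l : Fin N => B a b m M h H γ (l + 1) (j + 1))
    (fun k _ => hf _ (hmem k)) (fun l _ => hk _ (hmem l))]
  refine pairing_congr hRz.le hRw.le (fun z hz' => ?_) fun w hw' => ?_
  · exact sum_A_mul_rowFun hab hγ hγ0 h0 hm h (by omega)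
      (fun hh => Contour.ne_of_bd_inside hz' (hz hh) rfl)
  · exact sum_colFun_mul_B hab hγ hγ0 h0 hn h H (by omega)
      (fun hh => Contour.ne_of_bd_inside hw' (hw hh) rfl)

end
end TwoTime

/-! ### Complementation, and the orthogonalization of `L₁` and `L₂` -/

namespace TwoTime

open Metric Set

variable {a b : ℕ → ℝ} {N M : ℕ}

@[simp] lemma card_seg (k : ℕ) : (seg k).card = k := by simp [seg]

lemma card_seg_sdiff {k l : ℕ} (h : k ≤ l) : (seg l \ seg k).card = l - k := by
  rw [Finset.card_sdiff_of_subset (seg_mono h), card_seg, card_seg]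

lemma seg_ssubset {k l : ℕ} : seg k ⊂ seg l ↔ k < l := by
  refine ⟨fun h => ?_, fun h => ⟨seg_mono h.le, fun h' => ?_⟩⟩
  · simpa using Finset.card_lt_card h
  · have := Finset.card_le_card h'
    simp only [card_seg] at this; omega

lemma sdiff_seg_ssubset {k l : ℕ} (hl : l ≤ N) : seg N \ seg l ⊂ seg N \ seg k ↔ k < l := by
  constructor
  · intro h
    by_contra hkl
    exact h.2 (Finset.sdiff_subset_sdiff le_rfl (seg_mono (not_lt.mp hkl)))
  · refine fun h => ⟨Finset.sdiff_subset_sdiff le_rfl (seg_mono h.le), fun h' => ?_⟩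
    have := Finset.card_le_card h'
    rw [card_seg_sdiff hl, card_seg_sdiff (by omega)] at this; omega

lemma sdiff_sdiff_seg {k : ℕ} (h : k ≤ N) : seg N \ (seg N \ seg k) = seg k :=
  Finset.sdiff_sdiff_eq_self (seg_mono h)

lemma F₁_eq_F₁Set {n m : ℕ} (h H : ℤ) (γ Γ Γout Γin : Contour) (i : ℕ) {j : ℕ} (hj : 1 ≤ j) :
    F₁ a b n N m M h H γ Γ Γout Γin i j
      = F₁Set a b N M H γ Γ Γout Γin (seg i) (seg (j - 1)) (seg n) (seg m) (h - 1) := by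
  have h1 : (seg (j - 1)).card + 1 ≤ (seg n).card ↔ j ≤ n := by simp only [card_seg]; omega
  have h2 : (seg n).card < (seg i).card ↔ n < i := by simp only [card_seg]
  have h3 : H - 1 - (h - 1) = H - h := by ring
  simp only [F₁, J₁, J₂, J₃₄, F₁Set, h1, h2, h3]

/-- Complementation exchanges `J₁` and `J₂`. In the quadruple integral it exchanges the roles of `z`
and `w`, hence also the nesting of their contours, and `1 / (z - w)` changes sign; so `J₃` becomes
`-J₄`. -/
lemma F₂_eq_F₁Set {γ Γ Γout Γin : Contour} (hγ : EnclosesPoles b N γ) (hγ0 : 0 ≤ γ.radius)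
    (hout : EnclosesZeros a M Γout) (hin : EnclosesZeros a M Γin)
    (hnest : Γin.disc ⊆ Γout.inside) (hdisj' : Disjoint γ.disc Γout.disc)
    {n m : ℕ} (hn : n ≤ N) (hm : m ≤ M) (h H : ℤ) {i j : ℕ} (hi : i ≤ N) (hj : 1 ≤ j)
    (hjN : j ≤ N) :
    F₂ a b n N m M h H γ Γ Γout Γin i j
      = F₁Set a b N M H γ Γ Γout Γin (seg N \ seg (j - 1)) (seg N \ seg i) (seg N \ seg n)
          (seg M \ seg m) (H - h) := by
  have h1 : (seg N \ seg i).card + 1 ≤ (seg N \ seg n).card ↔ n < i := by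
    rw [card_seg_sdiff hi, card_seg_sdiff hn]; omega
  have h2 : (seg N \ seg n).card < (seg N \ seg (j - 1)).card ↔ j ≤ n := by
    rw [card_seg_sdiff hn, card_seg_sdiff (by omega)]; omega
  have h3 : H - 1 - (H - h) = h - 1 := by ring
  have hdisjin : Disjoint γ.disc Γin.disc :=
    hdisj'.mono_right (hnest.trans Γout.inside_subset_disc)
  have houtin : Disjoint Γout.bd Γin.bd := Γout.disjoint_bd_inside.mono_right
    (Γin.bd_subset_disc.trans hnest)
  have hp : ∀ I ⊆ seg N, ∀ T ⊆ seg M, ∀ g, ContinuousOn (fun ζ => (G a b ζ I T g)⁻¹) γ.bd :=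
    fun I hI T hT g => hin.continuousOn_G_inv hγ hT hI g
      (hdisjin.mono γ.bd_subset_disc Γin.inside_subset_disc) γ.disjoint_bd_inside
  have h4 : quadruple a b γ Γout Γin (seg N \ seg n) (seg N \ seg (j - 1)) (seg M \ seg m) (H - h)
        (seg n) (seg i) (seg m) (h - 1)
      = -quadruple a b γ Γin Γout (seg n) (seg i) (seg m) (h - 1)
        (seg N \ seg n) (seg N \ seg (j - 1)) (seg M \ seg m) (H - h) := by
    rw [quadruple_eq hγ hγ0 hout hin hdisj' hdisjin houtin Finset.sdiff_subset (seg_mono hi)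
        Finset.sdiff_subset (seg_mono hm),
      quadruple_eq hγ hγ0 hin hout hdisjin hdisj' houtin.symm (seg_mono hi) Finset.sdiff_subset
        (seg_mono hm) Finset.sdiff_subset]
    refine pairing_swap hout.radius_pos.le hin.radius_pos.le ?_ ?_ houtin
    · exact (hout.continuousOn_G Finset.sdiff_subset _ _ Γout.disjoint_bd_inside).mul
        (continuousOn_cauchyTransform hγ0 (hp _ Finset.sdiff_subset _ Finset.sdiff_subset _)
          (hdisj'.mono γ.bd_subset_disc Γout.bd_subset_disc).symm)
    · exact (hin.continuousOn_G (seg_mono hm) _ _ Γin.disjoint_bd_inside).mul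
        (continuousOn_cauchyTransform hγ0 (hp _ (seg_mono hi) _ (seg_mono hm) _)
          (hdisjin.mono γ.bd_subset_disc Γin.bd_subset_disc).symm)
  simp only [F₂, J₁, J₂, J₃₄, F₁Set, h1, h2, h3, sdiff_sdiff_seg hi, sdiff_sdiff_seg hn,
    sdiff_sdiff_seg hm, sdiff_sdiff_seg (show j - 1 ≤ N by omega), h4]
  ring

/-- The source of the identity part. The integrand is a polynomial for `i < j`, has one simple pole
for `i = j`, and has at least two poles and no numerator for `i > j`. -/
lemma integral_nodes_seg_div {γ : Contour} (hγ : EnclosesPoles b N γ) (hγ0 : 0 ≤ γ.radius)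
    {i j : ℕ} (hi : i < N) (hj : j < N) :
    (γ.integral fun ζ => nodes b (seg j) ζ / nodes b (seg (i + 1)) ζ) = if i = j then 1 else 0 := by
  have hiN : seg (i + 1) ⊆ seg N := seg_mono hi
  rcases lt_trichotomy i j with h | rfl | h
  · rw [if_neg h.ne]
    have := hγ.integral_nodes_div_of_subset hγ0 (S := seg j) (seg_mono (Nat.succ_le_of_lt h)) hiN
      (φ := fun _ => 1) (differentiableOn_const _)
    simpa using this
  · rw [if_pos rfl]
    exact hγ.integral_nodes_div_of_card_eq_one hγ0 (seg_mono (Nat.le_succ i)) hiN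
      (by rw [card_seg_sdiff (by omega)]; omega)
  · rw [if_neg h.ne']
    exact hγ.integral_nodes_div_of_two_le_card hγ0 (seg_mono (by omega)) hiN
      (by rw [card_seg_sdiff (by omega)]; omega)

lemma integral_nodes_sdiff_seg_div {γ : Contour} (hγ : EnclosesPoles b N γ) (hγ0 : 0 ≤ γ.radius)
    {i j : ℕ} (hi : i < N) (hj : j < N) :
    (γ.integral fun ζ => nodes b (seg N \ seg (i + 1)) ζ / nodes b (seg N \ seg j) ζ)
      = if i = j then 1 else 0 := by
  rw [← integral_nodes_seg_div hγ hγ0 hi hj]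
  refine Contour.integral_congr hγ0 fun ζ hζ => ?_
  have h0 : ∀ S ⊆ seg N, nodes b S ζ ≠ 0 := fun S hS => hγ.nodes_ne_zero_of_bd hS hζ
  have hi' : seg (i + 1) ⊆ seg N := seg_mono hi
  have hj' : seg j ⊆ seg N := seg_mono hj.le
  rw [div_eq_div_iff (h0 _ Finset.sdiff_subset) (h0 _ hi'), nodes_sdiff_mul hi',
    mul_comm, nodes_sdiff_mul hj']

lemma differentiableAt_rowFun {n : ℕ} {T : Finset ℕ} (e : ℤ) {i : ℕ} {z : ℂ}
    (hb : (b i : ℂ) ≠ 0) (hz0 : z ≠ 0) (hz : ∀ k ∈ seg i, z ≠ 1 / (b k : ℂ))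
    (hT : ∀ k ∈ T, z ≠ a k) : DifferentiableAt ℂ (rowFun a b n T e i) z := by
  unfold rowFun
  refine DifferentiableAt.mul (DifferentiableAt.mul
    (((differentiableAt_const _).mul differentiableAt_id).zpow (Or.inl (mul_ne_zero hb hz0)))
    ((differentiable_nodes _ _ z).div (differentiable_nodes _ _ z) (nodes_ne_zero hz)))
    (DifferentiableAt.fun_finsetProd fun k hk => ?_)
  refine (differentiableAt_const _).div
    ((differentiableAt_const _).sub ((differentiableAt_const _).div differentiableAt_id hz0)) ?_
  rw [one_sub_div hz0]; exact div_ne_zero (sub_ne_zero.mpr (hT k hk)) hz0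

lemma differentiableAt_colFun {n : ℕ} {T : Finset ℕ} (e : ℤ) {j : ℕ} {w : ℂ}
    (hb : (b j : ℂ) ≠ 0) (hw0 : w ≠ 0) (hw : ∀ k ∈ seg n, w ≠ 1 / (b k : ℂ))
    (hT : ∀ k ∈ T, w ≠ a k) : DifferentiableAt ℂ (colFun a b n T e j) w := by
  unfold colFun
  refine DifferentiableAt.mul (DifferentiableAt.mul
    (((differentiableAt_const _).mul differentiableAt_id).zpow (Or.inl (mul_ne_zero hb hw0)))
    ((differentiable_nodes _ _ w).div (differentiable_nodes _ _ w) (nodes_ne_zero hw)))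
    (DifferentiableAt.fun_finsetProd fun k hk => ?_)
  refine (differentiableAt_const _).div
    ((differentiableAt_const _).sub ((differentiableAt_const _).div differentiableAt_id hw0)) ?_
  rw [one_sub_div hw0]; exact div_ne_zero (sub_ne_zero.mpr (hT k hk)) hw0

/-- `r` exceeds all the numbers `a_k` and `1 / b_k`. -/
def Exceeds (a b : ℕ → ℝ) (N M : ℕ) (r : ℝ) : Prop :=
  0 < r ∧ (∀ k ∈ seg N, ‖(1 / (b k : ℂ))‖ < r) ∧ ∀ k ∈ seg M, ‖(a k : ℂ)‖ < r

namespace Exceeds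

variable {r : ℝ} {z : ℂ}

lemma ne_zero (hr : Exceeds a b N M r) (hz : r ≤ ‖z‖) : z ≠ 0 :=
  norm_pos_iff.mp (hr.1.trans_le hz)

lemma ne_node (hr : Exceeds a b N M r) (hz : r ≤ ‖z‖) {k : ℕ} (hk : k ∈ seg N) :
    z ≠ 1 / (b k : ℂ) := fun h => (hr.2.1 k hk).not_ge (h ▸ hz)

lemma ne_a (hr : Exceeds a b N M r) (hz : r ≤ ‖z‖) {k : ℕ} (hk : k ∈ seg M) :
    z ≠ (a k : ℂ) := fun h => (hr.2.2 k hk).not_ge (h ▸ hz)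

lemma differentiableAt_rowFun (hr : Exceeds a b N M r) (hab : Generic a b N M) {n : ℕ}
    {T : Finset ℕ} (hT : T ⊆ seg M) (e : ℤ) {i : ℕ} (hi : i ∈ seg N) (hz : r ≤ ‖z‖) :
    DifferentiableAt ℂ (rowFun a b n T e i) z :=
  TwoTime.differentiableAt_rowFun e (hab.1 i hi) (hr.ne_zero hz)
    (fun _ hk => hr.ne_node hz (seg_mono (mem_seg.mp hi).2 hk)) fun _ hk => hr.ne_a hz (hT hk)

lemma differentiableAt_colFun (hr : Exceeds a b N M r) (hab : Generic a b N M) {n : ℕ}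
    (hn : n ≤ N) {T : Finset ℕ} (hT : T ⊆ seg M) (e : ℤ) {j : ℕ} (hj : j ∈ seg N)
    (hz : r ≤ ‖z‖) : DifferentiableAt ℂ (colFun a b n T e j) z :=
  TwoTime.differentiableAt_colFun e (hab.1 j hj) (hr.ne_zero hz)
    (fun _ hk => hr.ne_node hz (seg_mono hn hk)) fun _ hk => hr.ne_a hz (hT hk)

end Exceeds

section

variable {γ Γ Γout Γin : Contour} (hab : Generic a b N M) (hγ : EnclosesPoles b N γ)
  (hγ0 : 0 ≤ γ.radius) (hΓ : EnclosesZeros a M Γ) (hout : EnclosesZeros a M Γout)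
  (hin : EnclosesZeros a M Γin) (hnest : Γin.disc ⊆ Γout.inside)
  (hdisj : Disjoint γ.disc Γ.disc) (hdisj' : Disjoint γ.disc Γout.disc)
include hab hγ hγ0 hΓ hout hin hnest hdisj hdisj'

/-- The orthogonalization of `L₁` and `L₂`. -/
theorem A_mul_L_mul_B_eq {n m : ℕ} (hn : n ≤ N) (hm : m ≤ M) (h H : ℤ) {Rin Rout : ℝ}
    (hr : Exceeds a b N M Rin) (hR : Rin < Rout) :
    toMatrix N (A a b m h γ) * toMatrix N (L a b n m M h H Rout Rin)
        * toMatrix N (B a b m M h H γ)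
      = toMatrix N (fun i j => (if i = j ∧ i ≤ n then 1 else 0)
        + F₁ a b n N m M h H γ Γ Γout Γin i j) ∧
    -(toMatrix N (A a b m h γ) * toMatrix N (L a b n m M h H Rin Rout)
        * toMatrix N (B a b m M h H γ))
      = toMatrix N (fun i j => (if i = j ∧ n < i then 1 else 0)
        + F₂ a b n N m M h H γ Γ Γout Γin i j) := by
  have h0 : (0 : ℂ) ∉ γ.disc := fun hh =>
    disjoint_left.mp hdisj hh (Γ.inside_subset_disc hΓ.1)
  obtain ⟨R, hRR, hsub⟩ := exists_centered_inside (γ.disc ∪ Γout.disc)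
    (isBounded_closedBall.union isBounded_closedBall) Rin
  have hγR : γ.disc ⊆ (Contour.centered R).inside := subset_union_left.trans hsub
  have houtR : Γout.disc ⊆ (Contour.centered R).inside := subset_union_right.trans hsub
  have hRR1 : (Contour.centered R).disc ⊆ (Contour.centered (R + 1)).inside := fun z hz =>
    mem_inside_centered.mpr ((mem_disc_centered.mp hz).trans_lt (lt_add_one R))
  have hγR1 : γ.disc ⊆ (Contour.centered (R + 1)).inside :=
    hγR.trans ((Contour.inside_subset_disc _).trans hRR1)
  have hR0 := hr.1
  have hf : ∀ i ∈ seg N, ∀ z, Rin ≤ ‖z‖ →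
      DifferentiableAt ℂ (rowFun a b n (seg m) (h - 1) i) z := fun i hi z hz =>
    hr.differentiableAt_rowFun hab (seg_mono hm) _ hi hz
  have hk : ∀ j ∈ seg N, ∀ z, Rin ≤ ‖z‖ →
      DifferentiableAt ℂ (colFun a b n (seg M \ seg m) (H - h) j) z := fun j hj z hz =>
    hr.differentiableAt_colFun hab hn Finset.sdiff_subset _ hj hz
  have hmem : ∀ k : Fin N, (k : ℕ) + 1 ∈ seg N := fun k => mem_seg.mpr ⟨by omega, by omega⟩
  -- The given circles need not contain `γ` or `Γout`. They are moved out to the radii `R` and `R +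
  -- 1`, in the same order.
  have hL1 : toMatrix N (L a b n m M h H Rout Rin) = toMatrix N (L a b n m M h H (R + 1) R) := by
    ext i j
    simp only [toMatrix, Matrix.of_apply, L_eq_pairing]
    exact pairing_centered_eq hR0 (hf _ (hmem i)) (hk _ (hmem j)) le_rfl hR hRR.le (lt_add_one R)
  have hL2 : toMatrix N (L a b n m M h H Rin Rout) = toMatrix N (L a b n m M h H R (R + 1)) := by
    ext i j
    simp only [toMatrix, Matrix.of_apply, L_eq_pairing]
    exact pairing_centered_eq' hR0 (hf _ (hmem i)) (hk _ (hmem j)) le_rfl hR hRR.le (lt_add_one R)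
  have hfc : ∀ K, Rin ≤ K → ∀ i ∈ seg N,
      ContinuousOn (rowFun a b n (seg m) (h - 1) i) (Contour.centered K).bd := fun K hK i hi =>
    continuousOn_bd_centered (hf i hi) hK
  have hkc : ∀ K, Rin ≤ K → ∀ j ∈ seg N,
      ContinuousOn (colFun a b n (seg M \ seg m) (H - h) j) (Contour.centered K).bd :=
    fun K hK j hj => continuousOn_bd_centered (hk j hj) hK
  rw [hL1, hL2]
  constructor
  · ext i j
    rw [A_mul_L_mul_B hab hγ hγ0 h0 hn hm h H (by linarith) hγR1 hγR (by linarith) (by linarith)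
      (hfc _ (by linarith)) (hkc _ hRR.le)]
    have key := pairing_eq_F₁Set hγ hγ0 hΓ hout hin hnest hdisj hdisj' hγR houtR hRR1
      (I := seg (i + 1)) (J := seg (j + 1 - 1)) (S := seg n) (T := seg m)
      (seg_mono (by omega)) (seg_mono hn) (seg_mono hm)
      ((le_or_gt ((i : ℕ) + 1) n).imp seg_mono seg_ssubset.mpr)
      ((le_or_gt n ((j : ℕ) + 1 - 1)).imp seg_mono seg_ssubset.mpr) (h - 1) H
    rw [show H - 1 - (h - 1) = H - h by ring, ← F₁_eq_F₁Set h H γ Γ Γout Γin _ (by omega)] at key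
    rw [key]
    simp only [toMatrix, Matrix.of_apply, Nat.add_sub_cancel, seg_ssubset,
      integral_nodes_seg_div hγ hγ0 i.2 j.2]
    congr 1
    rw [← ite_and]
    refine if_congr ?_ rfl rfl
    omega
  · ext i j
    rw [Matrix.neg_apply, A_mul_L_mul_B hab hγ hγ0 h0 hn hm h H (by linarith) hγR hγR1
      (by linarith) (by linarith) (hfc _ hRR.le) (hkc _ (by linarith))]
    -- For `L₂` the `w` circle is the outer one, so `w` plays the part of `z`: the theorem is
    -- applied to the complementary sets, with row and column sets exchanged. The minus sign in
    -- front of the product is the one in `pairing_swap`.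
    have key := pairing_eq_F₁Set hγ hγ0 hΓ hout hin hnest hdisj hdisj' hγR houtR hRR1
      (I := seg N \ seg (j + 1 - 1)) (J := seg N \ seg (i + 1)) (S := seg N \ seg n)
      (T := seg M \ seg m) Finset.sdiff_subset Finset.sdiff_subset Finset.sdiff_subset
      ((le_or_gt n ((j : ℕ) + 1 - 1)).imp (fun hh => Finset.sdiff_subset_sdiff le_rfl (seg_mono hh))
        (sdiff_seg_ssubset hn).mpr)
      ((le_or_gt ((i : ℕ) + 1) n).imp (fun hh => Finset.sdiff_subset_sdiff le_rfl (seg_mono hh))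
        (sdiff_seg_ssubset (by omega)).mpr) (H - h) H
    rw [← F₂_eq_F₁Set hγ hγ0 hout hin hnest hdisj' hn hm h H (by omega) (by omega) (by omega),
      show H - 1 - (H - h) = h - 1 by ring, sdiff_sdiff_seg hn, sdiff_sdiff_seg hm,
      sdiff_sdiff_seg (show (i : ℕ) + 1 ≤ N by omega)] at key
    have hp : ∀ I ⊆ seg N, ∀ T ⊆ seg M, ∀ g, ContinuousOn (fun ζ => (G a b ζ I T g)⁻¹) γ.bd :=
      fun I hI T hT g => hΓ.continuousOn_G_inv hγ hT hI g
        (hdisj.mono γ.bd_subset_disc Γ.inside_subset_disc) γ.disjoint_bd_inside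
    have hZ : ∀ K, R ≤ K → EnclosesZeros a M (Contour.centered K) ∧
        Disjoint (Contour.centered K).bd γ.bd := fun K hK => by
      refine ⟨⟨mem_inside_centered.mpr (by simp; linarith), fun k hk =>
        mem_inside_centered.mpr ((hr.2.2 k hk).trans_le (by linarith))⟩, ?_⟩
      refine disjoint_left.mpr fun z hz hz' => ?_
      have h1 := mem_inside_centered.mp (hγR (γ.bd_subset_disc hz'))
      have h2 := mem_bd_centered.mp hz
      linarith
    rw [← pairing_swap, key]
    · simp only [toMatrix, Matrix.of_apply, Nat.add_sub_cancel,
        integral_nodes_sdiff_seg_div hγ hγ0 i.2 j.2]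
      congr 1
      rw [← ite_and]
      refine if_congr ?_ rfl rfl
      rw [sdiff_seg_ssubset (by omega)]
      omega
    · simp only [Contour.centered]; linarith
    · simp only [Contour.centered]; linarith
    · obtain ⟨hZ1, hZ2⟩ := hZ (R + 1) (by linarith)
      exact (hZ1.continuousOn_G Finset.sdiff_subset _ _ (Contour.disjoint_bd_inside _)).mul
        (continuousOn_cauchyTransform hγ0 (hp _ Finset.sdiff_subset _ Finset.sdiff_subset _) hZ2)
    · obtain ⟨hZ1, hZ2⟩ := hZ R le_rfl
      exact (hZ1.continuousOn_G (seg_mono hm) _ _ (Contour.disjoint_bd_inside _)).mul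
        (continuousOn_cauchyTransform hγ0 (hp _ (seg_mono (by omega)) _ (seg_mono hm) _) hZ2)
    · exact disjoint_bd_centered (by linarith)

end
end TwoTime

namespace TwoTime

open MeasureTheory ProbabilityTheory

/-! ### The growth function column by column -/

/-- Adding weight `l` at height `k` to the column `z`, and pushing up what is above. -/
def push (k l : ℕ) (z : ℕ → ℤ) (i : ℕ) : ℤ :=
  if i < k then z i else max (z i) (z k + l)

/-- Functions `U k` of a column which are compatible with the weights of a column being added one
by one at the heights `k, k + 1, …, N - 1`, with parameters `q k, …, q (N - 1)`. -/
structure StepFamily (N : ℕ) (q : ℕ → ℝ) (C : ℝ) (U : ℕ → (ℕ → ℤ) → ℂ) : Prop where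
  step : ∀ k < N, ∀ x, U k x - q k * U k (Function.update x k (x k + 1)) = (1 - q k) * U (k + 1) x
  reflect : ∀ k i, k ≤ i → i + 1 < N → ∀ x, x (i + 1) + 1 = x i →
    U k x = U k (Function.update x (i + 1) (x i))
  bound : ∀ k x, (∀ i < N, 0 ≤ x i) → ‖U k x‖ ≤ C
  congr : ∀ k x y, (∀ i < N, x i = y i) → U k x = U k y

namespace StepFamily

variable {N : ℕ} {q : ℕ → ℝ} {C : ℝ} {U : ℕ → (ℕ → ℤ) → ℂ}

/-- Raising entry `k` alone may lift it one above the next entry. Each use of `reflect` then raises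
the next entry as well, and the raise travels upwards until the column is the pushed one. -/
lemma push_succ (hU : StepFamily N q C U) {k : ℕ} (hk : k < N) (l : ℕ) {z : ℕ → ℤ}
    (hz : ∀ i j, k ≤ i → i ≤ j → z i ≤ z j) :
    U k (Function.update (push k l z) k (push k l z k + 1)) = U k (push k (l + 1) z) := by
  set y := z k + l with hy
  -- Interpolates between the two columns: from height `k` through `r` the new level `y + 1` is in
  -- force, above `r` still the old level `y`.
  let hyb : ℕ → ℕ → ℤ := fun r i =>
    if i < k then z i else if i ≤ r then max (z i) (y + 1) else max (z i) y
  have hpk : push k l z k = y := by simp [push, hy]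
  have h0 : Function.update (push k l z) k (push k l z k + 1) = hyb k := by
    funext i
    rcases lt_trichotomy i k with h | rfl | h
    · rw [Function.update_of_ne h.ne]; simp [push, hyb, h]
    · rw [Function.update_self, hpk]
      simp only [hyb, lt_irrefl, if_false, le_refl, if_true]
      omega
    · rw [Function.update_of_ne h.ne']
      simp only [push, hyb, if_neg h.not_gt, if_neg h.not_ge, hy]
  have hind : ∀ d, k + d < N → U k (hyb k) = U k (hyb (k + d)) := by
    intro d
    induction d with
    | zero => simp
    | succ d ih =>
      intro hd
      rw [ih (by omega)]
      rcases lt_or_ge y (z (k + d + 1)) with h | h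
      · congr 1
        funext i
        simp only [hyb]
        rcases eq_or_ne i (k + d + 1) with rfl | hi
        · rw [if_neg (by omega), if_neg (by omega), if_neg (by omega), if_pos (by omega)]; omega
        · by_cases h1 : i < k
          · simp [h1]
          · have : i ≤ k + d ↔ i ≤ k + (d + 1) := by omega
            simp only [this]
      · have h1 : hyb (k + d) (k + d) = y + 1 := by
          have := hz (k + d) (k + d + 1) (by omega) (by omega)
          simp only [hyb]
          rw [if_neg (by omega), if_pos le_rfl]; omega
        have h2 : hyb (k + d) (k + d + 1) = y := by
          simp only [hyb]
          rw [if_neg (by omega), if_neg (by omega)]; omega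
        rw [hU.reflect k (k + d) (by omega) (by omega) _ (by rw [h1, h2])]
        congr 1
        funext i
        rcases eq_or_ne i (k + d + 1) with rfl | hi
        · rw [Function.update_self, h1]
          simp only [hyb]
          rw [if_neg (by omega), if_pos (by omega)]; omega
        · rw [Function.update_of_ne hi]
          simp only [hyb]
          by_cases h1 : i < k
          · simp [h1]
          · have : i ≤ k + d ↔ i ≤ k + (d + 1) := by omega
            simp only [this]
  rw [h0, hind (N - 1 - k) (by omega)]
  refine hU.congr _ _ _ fun i hi => ?_
  simp only [hyb, push, Nat.cast_add, Nat.cast_one]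
  rw [if_pos (by omega : i ≤ k + (N - 1 - k)), hy, add_assoc]

/-- The expectation over one geometric weight. -/
lemma hasSum_push (hU : StepFamily N q C U) {k : ℕ} (hk : k < N) (hq0 : 0 ≤ q k) (hq1 : q k < 1)
    {z : ℕ → ℤ} (hz0 : ∀ i, 0 ≤ z i) (hz : ∀ i j, k ≤ i → i ≤ j → z i ≤ z j) :
    HasSum (fun l : ℕ => (((1 - q k) * q k ^ l : ℝ) : ℂ) * U (k + 1) (push k l z)) (U k z) := by
  set c : ℕ → ℂ := fun l => U k (push k l z) with hc
  have hpos : ∀ l i, 0 ≤ push k l z i := fun l i => by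
    unfold push; split_ifs
    exacts [hz0 i, (hz0 i).trans (le_max_left _ _)]
  have hsum : Summable fun l => (q k : ℂ) ^ l * c l := by
    refine Summable.of_norm_bounded ((summable_geometric_of_lt_one hq0 hq1).mul_right C) fun l => ?_
    rw [norm_mul, norm_pow, Complex.norm_real, Real.norm_of_nonneg hq0]
    exact mul_le_mul_of_nonneg_left (hU.bound _ _ fun i _ => hpos l i) (pow_nonneg hq0 _)
  have h0 : c 0 = U k z := by
    refine hU.congr _ _ _ fun i _ => ?_
    unfold push
    split_ifs with h
    · rfl
    · simpa using hz k i le_rfl (not_lt.mp h)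
  -- By `step` and `push_succ` the terms are `q ^ l * c l - q ^ (l + 1) * c (l + 1)`, so the series
  -- telescopes to `c 0`. The bound on `U` makes the parts summable.
  have h1 := (hasSum_nat_add_iff' 1).mpr hsum.hasSum
  have h2 := hsum.hasSum.sub h1
  simp only [Finset.range_one, Finset.sum_singleton, pow_zero, one_mul, sub_sub_cancel, h0] at h2
  refine h2.congr_fun fun l => ?_
  have h3 := hU.step k hk (push k l z)
  rw [hU.push_succ hk l hz] at h3
  push_cast
  simp only [hc]
  linear_combination -(q k : ℂ) ^ l * h3

end StepFamily

section growth

variable {w w' : ℕ → ℕ → ℕ}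

@[simp] lemma growth_zero_right (t : ℕ) : growth 0 w t 0 = 0 := by
  simp [growth]

@[simp] lemma growth_zero_left (n : ℕ) : growth 0 w 0 n = 0 := by
  cases n <;> simp [growth]

lemma growth_succ (m n : ℕ) : growth 0 w (m + 1) (n + 1)
    = max (growth 0 w m (n + 1)) (growth 0 w (m + 1) n) + (w (m + 1) (n + 1) : ℤ) := by
  rw [growth]

lemma growth_congr {m n : ℕ} (h : ∀ i j, 1 ≤ i → i ≤ m → 1 ≤ j → j ≤ n → w i j = w' i j) :
    growth 0 w m n = growth 0 w' m n := by
  induction m generalizing n with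
  | zero => simp
  | succ m ihm =>
    induction n with
    | zero => simp
    | succ n ihn =>
      rw [growth_succ, growth_succ, ihm fun i j h1 h2 h3 h4 => h i j h1 (by omega) h3 h4,
        ihn fun i j h1 h2 h3 h4 => h i j h1 h2 h3 (by omega),
        h (m + 1) (n + 1) (by omega) le_rfl (by omega) le_rfl]

lemma growth_le_succ (m n : ℕ) : growth 0 w m n ≤ growth 0 w m (n + 1) := by
  cases m with
  | zero => simp
  | succ m =>
    rw [growth_succ]
    have := le_max_right (growth 0 w m (n + 1)) (growth 0 w (m + 1) n)
    omega

lemma growth_mono (m : ℕ) : Monotone (growth 0 w m) := monotone_nat_of_le_succ (growth_le_succ m)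

lemma growth_nonneg (m n : ℕ) : 0 ≤ growth 0 w m n := by
  simpa using growth_mono (w := w) m (Nat.zero_le n)

/-- The column `t + 1` after the weights at heights less than `k` have been added to column `t`. -/
def partialColumn (w : ℕ → ℕ → ℕ) (t k i : ℕ) : ℤ :=
  if i < k then growth 0 w (t + 1) (i + 1) else max (growth 0 w t (i + 1)) (growth 0 w (t + 1) k)

lemma partialColumn_zero (t : ℕ) : partialColumn w t 0 = fun i => growth 0 w t (i + 1) := by
  funext i
  simp [partialColumn, growth_nonneg]

/-- From height `k` on, a partial column carries the maximum with the last finished value `growth (t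
+ 1) k`. Its entry at index `k` is therefore the maximum in the recursion, and adding the weight is
a push. Index `i` stands for height `i + 1`. -/
lemma partialColumn_succ (t k : ℕ) :
    partialColumn w t (k + 1) = push k (w (t + 1) (k + 1)) (partialColumn w t k) := by
  funext i
  have h1 := growth_succ (w := w) t k
  have h2 := growth_le_succ (w := w) (t + 1) k
  have h3 : partialColumn w t k k = max (growth 0 w t (k + 1)) (growth 0 w (t + 1) k) := by
    simp [partialColumn]
  unfold push
  rw [h3, ← h1]
  rcases lt_trichotomy i k with h | rfl | h
  · simp [partialColumn, h, h.trans (Nat.lt_succ_self k)]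
  · simp only [partialColumn, Nat.lt_succ_self, if_true, lt_irrefl, if_false]
    omega
  · simp only [partialColumn, if_neg h.not_gt, if_neg (not_lt.mpr (Nat.succ_le_of_lt h))]
    omega

lemma partialColumn_nonneg (t k i : ℕ) : 0 ≤ partialColumn w t k i := by
  unfold partialColumn
  split_ifs
  exacts [growth_nonneg _ _, (growth_nonneg _ _).trans (le_max_left _ _)]

lemma partialColumn_mono {t k i j : ℕ} (hi : k ≤ i) (hij : i ≤ j) :
    partialColumn w t k i ≤ partialColumn w t k j := by
  simp only [partialColumn, if_neg hi.not_gt, if_neg (hi.trans hij).not_gt]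
  exact max_le_max_right _ (growth_mono t (by omega))

/-- Only weights of earlier columns and the first `k` weights of the current one enter. This makes
the partial column independent of the weight that is added next. -/
lemma partialColumn_congr {N t k i : ℕ} (hi : i < N) (hkN : k < N)
    (h : ∀ p : ℕ × ℕ, (p.1 < t ∧ p.2 < N) ∨ (p.1 = t ∧ p.2 < k) →
      w (p.1 + 1) (p.2 + 1) = w' (p.1 + 1) (p.2 + 1)) :
    partialColumn w t k i = partialColumn w' t k i := by
  have h' : ∀ i j, 1 ≤ i → 1 ≤ j → (i ≤ t ∧ j ≤ N) ∨ (i = t + 1 ∧ j ≤ k) → w i j = w' i j := by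
    intro i j hi hj hij
    have := h (i - 1, j - 1) (by simp only; omega)
    simpa only [Nat.sub_add_cancel hi, Nat.sub_add_cancel hj] using this
  have h1 : growth 0 w t (i + 1) = growth 0 w' t (i + 1) :=
    growth_congr fun i j h1 h2 h3 h4 => h' i j h1 h3 (by omega)
  have h2 : ∀ r ≤ k, growth 0 w (t + 1) r = growth 0 w' (t + 1) r := fun r hr =>
    growth_congr fun i j h1 h2 h3 h4 => h' i j h1 h3 (by omega)
  unfold partialColumn
  split_ifs with hik
  · exact h2 _ hik
  · rw [h1, h2 k le_rfl]

end growth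

/-! ### Expectations -/

variable {Ω : Type*} [MeasurableSpace Ω] {μ : Measure Ω} [IsProbabilityMeasure μ]

/-- Integrating out one variable of an independent family. -/
lemma integral_eq_of_hasSum {ι : Type*} {X : ι → Ω → ℕ} (hX : iIndepFun X μ)
    (hm : ∀ i, Measurable (X i)) {S : Finset ι} {p : ι} (hp : p ∉ S) {g : ℕ → ℝ}
    (hg : ∀ l, μ.real {x | X p x = l} = g l) {Φ : (S → ℕ) → ℕ → ℂ} {C : ℝ}
    (hΦ : ∀ τ l, ‖Φ τ l‖ ≤ C) {Ψ : (S → ℕ) → ℂ}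
    (hs : ∀ τ, HasSum (fun l => (g l : ℂ) * Φ τ l) (Ψ τ)) :
    ∫ x, Φ (fun i => X i x) (X p x) ∂μ = ∫ x, Ψ (fun i => X i x) ∂μ := by
  classical
  set P : Ω → (S → ℕ) := fun x i => X i x with hP
  have hPm : Measurable P := measurable_pi_lambda _ fun i => hm i
  have hind : IndepFun P (X p) μ := by
    have h := hX.indepFun_finset S {p} (Finset.disjoint_singleton_right.mpr hp) hm
    exact h.comp (φ := id) (ψ := fun τ : ({p} : Finset ι) → ℕ => τ ⟨p, Finset.mem_singleton_self p⟩)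
      measurable_id (measurable_pi_apply _)
  have hmap := (indepFun_iff_map_prod_eq_prod_map_map hPm.aemeasurable (hm p).aemeasurable).mp hind
  have : IsProbabilityMeasure (μ.map P) := Measure.isProbabilityMeasure_map hPm.aemeasurable
  have : IsProbabilityMeasure (μ.map (X p)) :=
    Measure.isProbabilityMeasure_map (hm p).aemeasurable
  have hΦm : Measurable (Function.uncurry Φ) := Measurable.of_discrete
  have e1 : ∫ x, Φ (P x) (X p x) ∂μ = ∫ y, Function.uncurry Φ y ∂(μ.map fun x => (P x, X p x)) := by
    rw [integral_map (hPm.prodMk (hm p)).aemeasurable hΦm.aestronglyMeasurable]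
    rfl
  have hint : Integrable (Function.uncurry Φ) ((μ.map P).prod (μ.map (X p))) :=
    Integrable.of_bound hΦm.aestronglyMeasurable C (Filter.Eventually.of_forall fun y => hΦ y.1 y.2)
  have e2 : ∀ τ, ∫ l, Φ τ l ∂(μ.map (X p)) = Ψ τ := by
    intro τ
    have hi : Integrable (Φ τ) (μ.map (X p)) :=
      Integrable.of_bound Measurable.of_discrete.aestronglyMeasurable C
        (Filter.Eventually.of_forall fun l => hΦ τ l)
    rw [integral_countable hi, ← (hs τ).tsum_eq]
    refine tsum_congr fun l => ?_
    rw [map_measureReal_apply (hm p) (measurableSet_singleton l)]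
    have : X p ⁻¹' {l} = {x | X p x = l} := rfl
    rw [this, hg l]
    simp
  rw [e1, hmap, integral_prod _ hint]
  simp only [Function.uncurry_apply_pair, e2]
  rw [integral_map hPm.aemeasurable Measurable.of_discrete.aestronglyMeasurable]

section

variable {W : ℕ → ℕ → Ω → ℕ} {a b : ℕ → ℝ}

/-- Adding a whole column of weights. -/
lemma StepFamily.integral_column {N : ℕ} {C : ℝ} {U : ℕ → (ℕ → ℤ) → ℂ} {t : ℕ}
    (hU : StepFamily N (fun k => a (t + 1) * b (k + 1)) C U)
    (hab : ∀ i j, 1 ≤ i → 1 ≤ j → 0 < a i * b j ∧ a i * b j < 1)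
    (hWmeas : ∀ i j, 1 ≤ i → 1 ≤ j → Measurable (W i j))
    (hWindep : iIndepFun (fun p : ℕ × ℕ => W (p.1 + 1) (p.2 + 1)) μ)
    (hWlaw : ∀ i j, 1 ≤ i → 1 ≤ j → ∀ k : ℕ,
      μ.real {x | W i j x = k} = (1 - a i * b j) * (a i * b j) ^ k)
    {f : (ℕ → ℕ → ℕ) → ℂ} (hf1 : ∀ w, ‖f w‖ ≤ 1)
    (hf : ∀ w w' : ℕ → ℕ → ℕ, (∀ i j, i < t → j < N → w (i + 1) (j + 1) = w' (i + 1) (j + 1)) →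
      f w = f w') :
    ∫ x, f (fun i j => W i j x) * U N (fun i => growth 0 (fun i j => W i j x) (t + 1) (i + 1)) ∂μ
      = ∫ x, f (fun i j => W i j x) * U 0 (fun i => growth 0 (fun i j => W i j x) t (i + 1)) ∂μ := by
  have key : ∀ k ≤ N, ∫ x, f (fun i j => W i j x) * U k (partialColumn (fun i j => W i j x) t k) ∂μ
      = ∫ x, f (fun i j => W i j x) * U 0 (partialColumn (fun i j => W i j x) t 0) ∂μ := by
    intro k
    induction k with
    | zero => simp
    | succ k ih =>
      intro hk
      rw [← ih (by omega)]
      have hC : 0 ≤ C := (norm_nonneg _).trans (hU.bound 0 (fun _ => 0) fun _ _ => le_rfl)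
      -- The weights used so far, in indices shifted to start at `0`. The next weight `(t, k)` is
      -- not among them.
      let S : Finset (ℕ × ℕ) := (Finset.range (t + 1) ×ˢ Finset.range N).filter
        fun p => p.1 < t ∨ p.2 < k
      have hS : ∀ p : ℕ × ℕ, p ∈ S ↔ (p.1 < t ∧ p.2 < N) ∨ (p.1 = t ∧ p.2 < k) := by
        intro p
        simp only [S, Finset.mem_filter, Finset.mem_product, Finset.mem_range]; omega
      -- Extends a configuration on `S` to a full array. The value `0` elsewhere is immaterial,
      -- since `f` and the partial column read only `S`.
      let ext : (S → ℕ) → ℕ → ℕ → ℕ := fun τ i j =>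
        if h : (i - 1, j - 1) ∈ S then τ ⟨_, h⟩ else 0
      have hext : ∀ (x : Ω) (p : ℕ × ℕ), p ∈ S →
          W (p.1 + 1) (p.2 + 1) x = ext (fun p => W (p.1.1 + 1) (p.1.2 + 1) x) (p.1 + 1) (p.2 + 1) :=
        fun x p hp => by simp only [ext, Nat.add_sub_cancel, dif_pos hp]
      have hfe : ∀ x, f (fun i j => W i j x)
          = f (ext fun p => W (p.1.1 + 1) (p.1.2 + 1) x) := fun x =>
        hf _ _ fun i j hi hj => hext x (i, j) ((hS _).mpr (Or.inl ⟨hi, hj⟩))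
      have hce : ∀ x, ∀ i < N, partialColumn (fun i j => W i j x) t k i
          = partialColumn (ext fun p => W (p.1.1 + 1) (p.1.2 + 1) x) t k i := fun x i hi =>
        partialColumn_congr hi hk fun p hp => hext x p ((hS p).mpr hp)
      have h := integral_eq_of_hasSum hWindep (fun p => hWmeas _ _ (by omega) (by omega)) (S := S)
        (p := (t, k)) (by rw [hS]; simp) (fun l => hWlaw (t + 1) (k + 1) (by omega) (by omega) l)
        (Φ := fun τ l => f (ext τ) * U (k + 1) (push k l (partialColumn (ext τ) t k))) (C := C)
        (fun τ l => by
          rw [norm_mul, ← one_mul C]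
          refine mul_le_mul (hf1 _) (hU.bound _ _ fun i _ => ?_) (norm_nonneg _) zero_le_one
          unfold push; split_ifs
          exacts [partialColumn_nonneg _ _ _, (partialColumn_nonneg _ _ _).trans (le_max_left _ _)])
        (Ψ := fun τ => f (ext τ) * U k (partialColumn (ext τ) t k))
        (fun τ => by
          have := (hU.hasSum_push hk (hab (t + 1) (k + 1) (by omega) (by omega)).1.le
            (hab (t + 1) (k + 1) (by omega) (by omega)).2
            (partialColumn_nonneg (w := ext τ) t k)
            fun i j hi hij => partialColumn_mono hi hij).mul_left (f (ext τ))
          refine this.congr_fun fun l => ?_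
          ring)
      refine Eq.trans (integral_congr_ae (Filter.Eventually.of_forall fun x => ?_))
        (h.trans (integral_congr_ae (Filter.Eventually.of_forall fun x => ?_)))
      · simp only
        rw [hfe x, partialColumn_succ]
        congr 1
        refine hU.congr _ _ _ fun i hi => ?_
        unfold push
        rw [hce x i hi, hce x k hk]
      · simp only
        rw [hfe x]
        congr 1
        exact hU.congr _ _ _ fun i hi => (hce x i hi).symm
  have h1 := key N le_rfl
  simp only [partialColumn_zero] at h1
  rw [← h1]
  refine integral_congr_ae (Filter.Eventually.of_forall fun x => ?_)
  simp only
  congr 1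
  exact hU.congr _ _ _ fun i hi => by simp [partialColumn, hi]

end
end TwoTime

namespace TwoTime

open Metric Set

/-! ### Determinantal step families -/

lemma Contour.integral_linear {C : Contour} (hC : 0 ≤ C.radius) {f g : ℂ → ℂ}
    (hf : ContinuousOn f C.bd) (hg : ContinuousOn g C.bd) (c d : ℂ) :
    (C.integral fun z => c * f z + d * g z) = c * C.integral f + d * C.integral g := by
  rw [Contour.integral_add hC (f := fun z => c * f z) (g := fun z => d * g z)
    (continuousOn_const.mul hf) (continuousOn_const.mul hg), Contour.integral_const_mul,
    Contour.integral_const_mul]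

/-- Rows of a matrix which depend on a coordinate of the column, before (`ρ₀`) and after (`ρ₁`)
a weight has been integrated out. -/
structure RowFamily (N : ℕ) (q : ℕ → ℝ) (c : ℕ → ℤ → ℂ) (C : ℝ) (ρ₀ ρ₁ : ℕ → ℤ → Fin N → ℂ) :
    Prop where
  step : ∀ i < N, ∀ x, ρ₁ i x = (1 - q i : ℂ) • ρ₀ i x + (q i : ℂ) • ρ₁ i (x + 1)
  reflect : ∀ i, i + 1 < N → ∀ x, ρ₁ (i + 1) (x - 1) = ρ₁ (i + 1) x + c i x • ρ₁ i x
  bound₀ : ∀ i < N, ∀ x, 0 ≤ x → ∀ j, ‖ρ₀ i x j‖ ≤ C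
  bound₁ : ∀ i < N, ∀ x, 0 ≤ x → ∀ j, ‖ρ₁ i x j‖ ≤ C

lemma norm_det_le {N : ℕ} {A : Matrix (Fin N) (Fin N) ℂ} {C : ℝ} (h : ∀ i j, ‖A i j‖ ≤ C) :
    ‖A.det‖ ≤ N.factorial • C ^ N := by
  have := Matrix.det_le (abv := NormedField.toAbsoluteValue ℂ) (A := A) (x := C) h
  rw [Fintype.card_fin] at this
  exact this

namespace RowFamily

variable {N : ℕ} {q : ℕ → ℝ} {c : ℕ → ℤ → ℂ} {C D : ℝ} {ρ₀ ρ₁ σ₀ σ₁ : ℕ → ℤ → Fin N → ℂ}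

/-- The relations are linear in the rows, and both families have the same `q` and `c`. It is applied
to the rows of `θ X - Y`. -/
lemma smul_sub (hρ : RowFamily N q c C ρ₀ ρ₁) (hσ : RowFamily N q c D σ₀ σ₁) (θ : ℂ) :
    RowFamily N q c (‖θ‖ * C + D) (fun i x => θ • ρ₀ i x - σ₀ i x)
      (fun i x => θ • ρ₁ i x - σ₁ i x) where
  step i hi x := by
    nth_rw 1 [hρ.step i hi x, hσ.step i hi x]
    module
  reflect i hi x := by
    rw [hρ.reflect i hi x, hσ.reflect i hi x]
    module
  bound₀ i hi x hx j := by
    refine (norm_sub_le _ _).trans (add_le_add ?_ (hσ.bound₀ i hi x hx j))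
    rw [Pi.smul_apply, norm_smul]
    exact mul_le_mul_of_nonneg_left (hρ.bound₀ i hi x hx j) (norm_nonneg _)
  bound₁ i hi x hx j := by
    refine (norm_sub_le _ _).trans (add_le_add ?_ (hσ.bound₁ i hi x hx j))
    rw [Pi.smul_apply, norm_smul]
    exact mul_le_mul_of_nonneg_left (hρ.bound₁ i hi x hx j) (norm_nonneg _)

/-- `step` is the linearity of the determinant in row `k`. For `reflect`, the lowered row `i + 1` is
the raised one plus a multiple of row `i`; both rows are of type `ρ₁` because `k ≤ i`. -/
lemma stepFamily (hρ : RowFamily N q c C ρ₀ ρ₁) :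
    StepFamily N q (N.factorial • C ^ N) fun k x =>
      (Matrix.of fun i : Fin N => if (i : ℕ) < k then ρ₀ i (x i) else ρ₁ i (x i)).det where
  step k hk x := by
    set A : Matrix (Fin N) (Fin N) ℂ :=
      Matrix.of fun i : Fin N => if (i : ℕ) < k then ρ₀ i (x i) else ρ₁ i (x i) with hA
    have h1 : (Matrix.of fun i : Fin N => if (i : ℕ) < k
        then ρ₀ i (Function.update x k (x k + 1) i) else ρ₁ i (Function.update x k (x k + 1) i))
        = A.updateRow ⟨k, hk⟩ (ρ₁ k (x k + 1)) := by
      ext i j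
      rcases eq_or_ne i ⟨k, hk⟩ with rfl | hi
      · simp
      · have : (i : ℕ) ≠ k := fun h => hi (Fin.ext h)
        simp [hA, Matrix.updateRow_ne hi, Function.update_of_ne this]
    have h2 : (Matrix.of fun i : Fin N => if (i : ℕ) < k + 1 then ρ₀ i (x i) else ρ₁ i (x i))
        = A.updateRow ⟨k, hk⟩ (ρ₀ k (x k)) := by
      ext i j
      rcases eq_or_ne i ⟨k, hk⟩ with rfl | hi
      · simp
      · have : (i : ℕ) ≠ k := fun h => hi (Fin.ext h)
        have : (i : ℕ) < k + 1 ↔ (i : ℕ) < k := by omega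
        simp only [hA, Matrix.updateRow_ne hi, Matrix.of_apply, this]
    have h3 : A = A.updateRow ⟨k, hk⟩
        ((1 - q k : ℂ) • ρ₀ k (x k) + (q k : ℂ) • ρ₁ k (x k + 1)) := by
      rw [← hρ.step k hk (x k)]
      ext i j
      rcases eq_or_ne i ⟨k, hk⟩ with rfl | hi
      · simp [hA]
      · rw [Matrix.updateRow_ne hi]
    rw [h1, h2]
    nth_rw 1 [h3]
    rw [Matrix.det_updateRow_add, Matrix.det_updateRow_smul, Matrix.det_updateRow_smul]
    ring
  reflect k i hki hi x hx := by
    set A : Matrix (Fin N) (Fin N) ℂ := Matrix.of fun j : Fin N => if (j : ℕ) < k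
      then ρ₀ j (Function.update x (i + 1) (x i) j)
      else ρ₁ j (Function.update x (i + 1) (x i) j) with hA
    have hne : (⟨i + 1, hi⟩ : Fin N) ≠ ⟨i, by omega⟩ := by simp
    have hAi : A ⟨i, by omega⟩ = ρ₁ i (x i) := by
      ext j; simp [hA, hki.not_gt]
    have hAi1 : A ⟨i + 1, hi⟩ = ρ₁ (i + 1) (x i) := by
      ext j; simp [hA, show ¬ (i + 1 < k) by omega]
    rw [← Matrix.det_updateRow_add_smul_self A hne (c i (x i)), hAi, hAi1,
      ← hρ.reflect i hi (x i)]
    congr 1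
    ext l j
    rcases eq_or_ne l ⟨i + 1, hi⟩ with rfl | hl
    · simp [show ¬ (i + 1 < k) by omega, ← hx]
    · have : (l : ℕ) ≠ i + 1 := fun h => hl (Fin.ext h)
      simp [hA, Matrix.updateRow_ne hl, Function.update_of_ne this]
  bound k x hx := by
    refine norm_det_le fun i j => ?_
    simp only [Matrix.of_apply]
    split_ifs
    · exact hρ.bound₀ i i.2 _ (hx i i.2) j
    · exact hρ.bound₁ i i.2 _ (hx i i.2) j
  congr k x y hxy := by
    congr 1
    ext i j
    simp only [Matrix.of_apply, hxy i i.2]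

end RowFamily

/-- Step families may be integrated over a parameter. -/
lemma StepFamily.integral {N : ℕ} {q : ℕ → ℝ} {B K : ℝ} {U : ℂ → ℕ → (ℕ → ℤ) → ℂ} {Γ : Contour}
    (hΓ : 0 ≤ Γ.radius) {κ : ℂ → ℂ} (hκ : ContinuousOn κ Γ.bd) (hK : ∀ θ ∈ Γ.bd, ‖κ θ‖ ≤ K)
    (hU : ∀ θ ∈ Γ.bd, StepFamily N q B (U θ))
    (hc : ∀ k x, ContinuousOn (fun θ => U θ k x) Γ.bd) :
    StepFamily N q (Γ.radius * (K * B)) fun k x => Γ.integral fun θ => κ θ * U θ k x where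
  step k hk x := by
    have hfc : ∀ k x, ContinuousOn (fun θ => κ θ * U θ k x) Γ.bd := fun k x => hκ.mul (hc k x)
    have := Contour.integral_linear hΓ (hfc k x) (hfc k (Function.update x k (x k + 1))) 1 (-q k)
    refine Eq.trans ?_ (this.symm.trans ((Contour.integral_congr hΓ fun θ hθ => ?_).trans
      (Contour.integral_const_mul _ _ _)))
    · ring
    · linear_combination κ θ * (hU θ hθ).step k hk x
  reflect k i hki hi x hx := Contour.integral_congr hΓ fun θ hθ => by
    simp only [(hU θ hθ).reflect k i hki hi x hx]
  bound k x hx := Contour.norm_integral_le hΓ fun θ hθ => by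
    rw [norm_mul]
    exact mul_le_mul (hK θ hθ) ((hU θ hθ).bound k x hx) (norm_nonneg _)
      ((norm_nonneg _).trans (hK θ hθ))
  congr k x y hxy := Contour.integral_congr hΓ fun θ hθ => by
    simp only [(hU θ hθ).congr k x y hxy]

/-! ### Rows given by contour integrals -/

variable {a b : ℕ → ℝ} {N M : ℕ}

/-- The contour integral of `(b z) ^ (e - x) ∏_{k ∈ [i + 1]} (z - 1 / b_k)⁻¹
∏_{k ∈ T} (1 - a_k b) / (1 - a_k / z) K(z)` with `b = b_{i + 1}`. -/
def rowInt (a b : ℕ → ℝ) (R : ℝ) (e : ℤ) (T : Finset ℕ) (K : ℂ → ℂ) (i : ℕ) (x : ℤ) : ℂ :=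
  (Contour.centered R).integral fun z => ((b (i + 1) : ℂ) * z) ^ (e - x) / nodes b (seg (i + 1)) z
    * (∏ k ∈ T, (1 - (a k : ℂ) * b (i + 1)) / (1 - (a k : ℂ) / z)) * K z

/-- The coefficient in the reflection relation between two rows. -/
def reflectCoeff (a b : ℕ → ℝ) (e : ℤ) (T : Finset ℕ) (i : ℕ) (x : ℤ) : ℂ :=
  b (i + 2) * ((b (i + 2) : ℂ) / b (i + 1)) ^ (e - x)
    * ∏ k ∈ T, (1 - (a k : ℂ) * b (i + 2)) / (1 - (a k : ℂ) * b (i + 1))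

section

variable {R : ℝ} (hR : Exceeds a b N M R) (hab : Generic a b N M) {K : ℂ → ℂ}
  (hK : ContinuousOn K (Contour.centered R).bd)
include hR

lemma one_sub_div_ne_zero_of_bd {z : ℂ} (hz : z ∈ (Contour.centered R).bd) {k : ℕ}
    (hk : k ∈ seg M) : 1 - (a k : ℂ) / z ≠ 0 := by
  have hz' := mem_bd_centered.mp hz
  rw [one_sub_div (hR.ne_zero hz'.ge)]
  exact div_ne_zero (sub_ne_zero.mpr (hR.ne_a hz'.ge hk)) (hR.ne_zero hz'.ge)

include hab hK

lemma continuousOn_rowInt {T : Finset ℕ} (hT : T ⊆ seg M) (e : ℤ) {i : ℕ} (hi : i < N) :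
    ContinuousOn (fun z => ((b (i + 1) : ℂ) * z) ^ e / nodes b (seg (i + 1)) z
      * (∏ k ∈ T, (1 - (a k : ℂ) * b (i + 1)) / (1 - (a k : ℂ) / z)) * K z)
      (Contour.centered R).bd := by
  have hz0 : ∀ z ∈ (Contour.centered R).bd, z ≠ 0 := fun z hz =>
    hR.ne_zero (mem_bd_centered.mp hz).ge
  have hb := hab.1 (i + 1) (mem_seg.mpr ⟨by omega, hi⟩)
  refine ContinuousOn.mul (ContinuousOn.mul (ContinuousOn.div
    ((continuousOn_const.mul continuousOn_id).zpow₀ _ fun z hz => Or.inl (mul_ne_zero hb (hz0 z hz)))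
    (differentiable_nodes _ _).continuous.continuousOn fun z hz => ?_)
    (continuousOn_finsetProd _ fun k hk => ContinuousOn.div continuousOn_const
      (continuousOn_const.sub (continuousOn_const.div continuousOn_id hz0))
      fun z hz => one_sub_div_ne_zero_of_bd hR hz (hT hk))) hK
  exact nodes_ne_zero fun k hk => hR.ne_node (mem_bd_centered.mp hz).ge
    (seg_mono (Nat.succ_le_of_lt hi) hk)

/-- Under the integral sign this is `(b z - a b) / (1 - a / z) = b z`. -/
lemma rowInt_step {T : Finset ℕ} {t : ℕ} (ht : t ∉ T) (hT : insert t T ⊆ seg M) (e : ℤ) {i : ℕ}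
    (hi : i < N) (x : ℤ) :
    rowInt a b R e (insert t T) K i x = (1 - (a t * b (i + 1) : ℝ) : ℂ) * rowInt a b R e T K i x
      + ((a t * b (i + 1) : ℝ) : ℂ) * rowInt a b R e (insert t T) K i (x + 1) := by
  have hR0 : 0 ≤ (Contour.centered R).radius := hR.1.le
  have hTM : T ⊆ seg M := (Finset.subset_insert t T).trans hT
  have hb := hab.1 (i + 1) (mem_seg.mpr ⟨by omega, hi⟩)
  unfold rowInt
  rw [← Contour.integral_linear hR0 (continuousOn_rowInt hR hab hK hTM _ hi)
    (continuousOn_rowInt hR hab hK hT _ hi)]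
  refine Contour.integral_congr hR0 fun z hz => ?_
  have hz0 := hR.ne_zero (mem_bd_centered.mp hz).ge
  have h1 := one_sub_div_ne_zero_of_bd hR hz (hT (Finset.mem_insert_self t T))
  have h3 : ((b (i + 1) : ℂ) * z) ^ (e - x)
      = ((b (i + 1) : ℂ) * z) ^ (e - (x + 1)) * ((b (i + 1) : ℂ) * z) := by
    rw [← zpow_add_one₀ (mul_ne_zero hb hz0)]; congr 1; ring
  simp only [Finset.prod_insert ht, h3]
  generalize ((b (i + 1) : ℂ) * z) ^ (e - (x + 1)) = Z
  generalize (nodes b (seg (i + 1)) z) = Y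
  generalize (∏ k ∈ T, (1 - (a k : ℂ) * b (i + 1)) / (1 - (a k : ℂ) / z)) = X
  have h4 : z - a t ≠ 0 := by
    rw [one_sub_div hz0] at h1; exact (div_ne_zero_iff.mp h1).1
  push_cast
  rw [one_sub_div hz0]
  field_simp
  ring

/-- The difference of consecutive powers of `b z` produces `b z - 1 = b (z - 1 / b)`, with `b =
b_{i+2}`. This cancels the last node, and row `i` remains up to a constant. -/
lemma rowInt_reflect {T : Finset ℕ} (hT : T ⊆ seg M) (e : ℤ) {i : ℕ} (hi : i + 1 < N) (x : ℤ) :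
    rowInt a b R e T K (i + 1) (x - 1) = rowInt a b R e T K (i + 1) x
      + reflectCoeff a b e T i x * rowInt a b R e T K i x := by
  have hR0 : 0 ≤ (Contour.centered R).radius := hR.1.le
  have hb := hab.1 (i + 1) (mem_seg.mpr ⟨by omega, by omega⟩)
  have hb' := hab.1 (i + 2) (mem_seg.mpr ⟨by omega, by omega⟩)
  unfold rowInt
  rw [← one_mul (Contour.integral _ fun z => ((b (i + 1 + 1) : ℂ) * z) ^ (e - x) / _ * _ * _),
    ← Contour.integral_linear hR0 (continuousOn_rowInt hR hab hK hT _ hi)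
    (continuousOn_rowInt hR hab hK hT _ (by omega))]
  refine Contour.integral_congr hR0 fun z hz => ?_
  have hz' := (mem_bd_centered.mp hz).ge
  have hz0 := hR.ne_zero hz'
  have h1 : nodes b (seg (i + 1)) z ≠ 0 := nodes_ne_zero fun k hk =>
    hR.ne_node hz' (seg_mono (by omega) hk)
  have h2 := sub_ne_zero.mpr (hR.ne_node hz' (k := i + 2) (mem_seg.mpr ⟨by omega, by omega⟩))
  have h3 : ((b (i + 2) : ℂ) * z) ^ (e - (x - 1))
      = ((b (i + 2) : ℂ) * z) ^ (e - x) * ((b (i + 2) : ℂ) * z) := by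
    rw [← zpow_add_one₀ (mul_ne_zero hb' hz0)]; congr 1; ring
  have h4 : ((b (i + 2) : ℂ) / b (i + 1)) ^ (e - x) * ((b (i + 1) : ℂ) * z) ^ (e - x)
      = ((b (i + 2) : ℂ) * z) ^ (e - x) := by
    rw [← mul_zpow]; congr 1; field_simp
  have h5 : (∏ k ∈ T, (1 - (a k : ℂ) * b (i + 2)) / (1 - (a k : ℂ) * b (i + 1)))
      * (∏ k ∈ T, (1 - (a k : ℂ) * b (i + 1)) / (1 - (a k : ℂ) / z))
      = ∏ k ∈ T, (1 - (a k : ℂ) * b (i + 2)) / (1 - (a k : ℂ) / z) := by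
    rw [← Finset.prod_mul_distrib]
    refine Finset.prod_congr rfl fun k hk => ?_
    have := hab.2 k (hT hk) (i + 1) (mem_seg.mpr ⟨by omega, by omega⟩)
    rw [div_mul_div_cancel₀ this]
  have h6 : (b (i + 2) : ℂ) * z - 1 = b (i + 2) * (z - 1 / (b (i + 2) : ℂ)) := by
    field_simp
  have h7 : b (i + 2) * ((b (i + 2) : ℂ) * z) ^ (e - x) / nodes b (seg (i + 1)) z
      = ((b (i + 2) : ℂ) * z) ^ (e - x) * ((b (i + 2) : ℂ) * z - 1) / nodes b (seg (i + 2)) z := by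
    rw [show nodes b (seg (i + 2)) z = _ from nodes_seg_succ (i + 1) z, h6]
    generalize 1 / (b (i + 1 + 1) : ℂ) = β at *
    field_simp
  simp only [reflectCoeff, h3]
  rw [show i + 1 + 1 = i + 2 from rfl]
  calc _ = ((b (i + 2) : ℂ) * z) ^ (e - x) / nodes b (seg (i + 2)) z
        * (∏ k ∈ T, (1 - (a k : ℂ) * b (i + 2)) / (1 - (a k : ℂ) / z)) * K z
        + ((b (i + 2) : ℂ) * z) ^ (e - x) * ((b (i + 2) : ℂ) * z - 1) / nodes b (seg (i + 2)) z
        * (∏ k ∈ T, (1 - (a k : ℂ) * b (i + 2)) / (1 - (a k : ℂ) / z)) * K z := by ring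
    _ = _ := by rw [← h7, ← h5, ← h4]; ring

/-- `|b z| ≥ 1` on the circle since `R > 1 / b`, so the factor `(b z) ^ (-x)` is at most `1` in
modulus for `x ≥ 0`. -/
lemma exists_rowInt_bound {T : Finset ℕ} (hT : T ⊆ seg M) (e : ℤ) {i : ℕ} (hi : i < N) :
    ∃ C, 0 ≤ C ∧ ∀ x, 0 ≤ x → ‖rowInt a b R e T K i x‖ ≤ C := by
  have hR0 : 0 ≤ (Contour.centered R).radius := hR.1.le
  have hb := hab.1 (i + 1) (mem_seg.mpr ⟨by omega, hi⟩)
  obtain ⟨C, hC⟩ := (Contour.centered R).isCompact_bd.exists_bound_of_continuousOn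
    (continuousOn_rowInt hR hab hK hT e hi)
  refine ⟨R * max C 0, mul_nonneg hR.1.le (le_max_right _ _), fun x hx => ?_⟩
  refine Contour.norm_integral_le hR0 fun z hz => ?_
  have hz' := (mem_bd_centered.mp hz)
  have hbz : 1 ≤ ‖(b (i + 1) : ℂ) * z‖ := by
    have h1 := hR.2.1 (i + 1) (mem_seg.mpr ⟨by omega, hi⟩)
    rw [norm_div, norm_one, div_lt_iff₀ (norm_pos_iff.mpr hb)] at h1
    rw [norm_mul, hz', mul_comm]; exact h1.le
  have hne : (b (i + 1) : ℂ) * z ≠ 0 := norm_pos_iff.mp (zero_lt_one.trans_le hbz)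
  have h2 := (hC z hz).trans (le_max_left C 0)
  have h3 : ((b (i + 1) : ℂ) * z) ^ (e - x)
      = ((b (i + 1) : ℂ) * z) ^ e * ((b (i + 1) : ℂ) * z) ^ (-x) := by
    rw [← zpow_add₀ hne]; rfl
  rw [h3]
  calc _ = ‖((b (i + 1) : ℂ) * z) ^ (-x)‖ * ‖((b (i + 1) : ℂ) * z) ^ e / nodes b (seg (i + 1)) z
      * (∏ k ∈ T, (1 - (a k : ℂ) * b (i + 1)) / (1 - (a k : ℂ) / z)) * K z‖ := by
        rw [← norm_mul]; congr 1; ring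
    _ ≤ 1 * max C 0 := by
        refine mul_le_mul ?_ h2 (norm_nonneg _) zero_le_one
        rw [norm_zpow]
        exact zpow_le_one_of_nonpos₀ hbz (by omega)
    _ = max C 0 := one_mul _

end

lemma exists_rowFamily (hab : Generic a b N M) {R : ℝ} (hR : Exceeds a b N M R)
    {K : Fin N → ℂ → ℂ} (hK : ∀ j, ContinuousOn (K j) (Contour.centered R).bd)
    {T : Finset ℕ} {t : ℕ} (ht : t ∉ T) (hT : insert t T ⊆ seg M) (e : ℤ) :
    ∃ C, RowFamily N (fun i => a t * b (i + 1)) (reflectCoeff a b e (insert t T)) C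
      (fun i x j => rowInt a b R e T (K j) i x)
      (fun i x j => rowInt a b R e (insert t T) (K j) i x) := by
  have hTM : T ⊆ seg M := (Finset.subset_insert t T).trans hT
  have key : ∀ T ⊆ seg M, ∃ C : ℝ, ∀ i < N, ∀ x, 0 ≤ x → ∀ j,
      ‖rowInt a b R e T (K j) i x‖ ≤ C := by
    intro T hT
    choose C hC0 hC using fun p : Fin N × Fin N =>
      exists_rowInt_bound hR hab (hK p.2) hT e p.1.2
    refine ⟨∑ p, C p, fun i hi x hx j => (hC (⟨i, hi⟩, j) x hx).trans ?_⟩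
    exact Finset.single_le_sum (fun p _ => hC0 p) (Finset.mem_univ _)
  obtain ⟨C₀, hC₀⟩ := key T hTM
  obtain ⟨C₁, hC₁⟩ := key _ hT
  refine ⟨max C₀ C₁, ⟨fun i hi x => ?_, fun i hi x => ?_, fun i hi x hx j => ?_,
    fun i hi x hx j => ?_⟩⟩
  · ext j
    simpa using rowInt_step hR hab (hK j) ht hT e hi x
  · ext j
    simpa using rowInt_reflect hR hab (hK j) hT e hi x
  · exact (hC₀ i hi x hx j).trans (le_max_left _ _)
  · exact (hC₁ i hi x hx j).trans (le_max_right _ _)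

end TwoTime

namespace TwoTime

open Metric Set

/-! ### Determinants depending on a parameter -/

lemma prod_ite_lt {N n : ℕ} (hn : n ≤ N) (θ : ℂ) :
    (∏ i : Fin N, if (i : ℕ) < n then θ else 1) = θ ^ n := by
  rw [Fin.prod_univ_eq_prod_range (fun i => if i < n then θ else 1), Finset.prod_ite,
    Finset.prod_const_one, mul_one, Finset.prod_const]
  congr 1
  rw [show (Finset.range N).filter (· < n) = Finset.range n by
    ext i; simp only [Finset.mem_filter, Finset.mem_range]; omega, Finset.card_range]

lemma differentiable_det {N : ℕ} {X : ℂ → Matrix (Fin N) (Fin N) ℂ}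
    (hX : ∀ i j, Differentiable ℂ fun θ => X θ i j) : Differentiable ℂ fun θ => (X θ).det := by
  simp only [Matrix.det_apply]
  exact Differentiable.fun_sum fun σ _ => (Differentiable.fun_finsetProd fun i _ => hX _ _).const_smul _

section

variable {N n : ℕ} {X Y Z : Matrix (Fin N) (Fin N) ℂ} {s : ℝ}

/-- The first `n` rows of `θ X - Y` are `θ` times those of `Z`, which cancels `θ ^ (-n)`. The other
rows are `Z + (θ - 1) X`, so the pole at `θ = 1` gives `det Z`. -/
lemma integral_det_of_rows_eq_zero (hn : n ≤ N) (hs : 1 < s) (hZ : X - Y = Z)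
    (hY : ∀ i : Fin N, (i : ℕ) < n → ∀ j, Y i j = 0) :
    ((Contour.centered s).integral fun θ => (θ ^ n)⁻¹ / (θ - 1) * (θ • X - Y).det) = Z.det := by
  let P : ℂ → Matrix (Fin N) (Fin N) ℂ := fun θ => Matrix.of fun i j =>
    if (i : ℕ) < n then Z i j else Z i j + (θ - 1) * X i j
  have hP : Differentiable ℂ fun θ => (P θ).det := differentiable_det fun i j => by
    simp only [P, Matrix.of_apply]
    split_ifs <;> fun_prop
  have hP1 : P 1 = Z := by ext i j; simp [P]
  have hf : ∀ θ : ℂ, (θ • X - Y).det = θ ^ n * (P θ).det := fun θ => by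
    rw [← prod_ite_lt hn, ← Matrix.det_mul_column]
    congr 1
    ext i j
    simp only [P, Matrix.of_apply, Matrix.sub_apply, Matrix.smul_apply, smul_eq_mul, ← hZ]
    split_ifs with h
    · rw [hY i h]; ring
    · ring
  rw [← hP1, ← Contour.integral_div_sub (C := Contour.centered s) hP.differentiableOn
    (w := 1) (mem_inside_centered.mpr (by simpa using hs))]
  refine Contour.integral_congr (zero_le_one.trans hs.le) fun θ hθ => ?_
  have h0 : θ ≠ 0 := norm_pos_iff.mp (by rw [mem_bd_centered.mp hθ]; linarith)
  simp only [hf]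
  field_simp

lemma integral_inv_pow_div (hs : 1 < s) (k : ℕ) :
    ((Contour.centered s).integral fun θ => (θ ^ (k + 1))⁻¹ / (θ - 1)) = 0 := by
  have hs0 : 0 ≤ (Contour.centered s).radius := zero_le_one.trans hs.le
  rw [← Contour.integral_inv_rootProd (C := Contour.centered s)
    (1 ::ₘ Multiset.replicate (k + 1) 0) (fun e he => ?_) (by simp)]
  · refine Contour.integral_congr hs0 fun θ _ => ?_
    simp only [rootProd_cons, rootProd_replicate_zero]
    rw [mul_inv, mul_comm, div_eq_mul_inv]
  · rw [mem_inside_centered]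
    rcases Multiset.mem_cons.mp he with rfl | h
    · simpa using hs
    · rw [Multiset.eq_of_mem_replicate h, norm_zero]; linarith

/-- At most `n - 1` rows involve `θ`, so the determinant is `θ ^ (n - 1)` times a polynomial `Q` in
`1 / θ`. After division by `θ ^ n` every monomial has at least two poles inside the circle and
integrates to zero. -/
lemma integral_det_eq_zero (hn : 1 ≤ n) (hnN : n ≤ N) (hs : 1 < s)
    (hX : ∀ i : Fin N, n ≤ (i : ℕ) + 1 → ∀ j, X i j = 0) :
    ((Contour.centered s).integral fun θ => (θ ^ n)⁻¹ / (θ - 1) * (θ • X - Y).det) = 0 := by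
  have hs0 : 0 ≤ (Contour.centered s).radius := zero_le_one.trans hs.le
  let Q : Matrix (Fin N) (Fin N) (Polynomial ℂ) := Matrix.of fun i j =>
    if (i : ℕ) < n - 1 then Polynomial.C (X i j) - Polynomial.X * Polynomial.C (Y i j)
    else -Polynomial.C (Y i j)
  have h0 : ∀ θ ∈ (Contour.centered s).bd, θ ≠ 0 := fun θ hθ =>
    norm_pos_iff.mp (by rw [mem_bd_centered.mp hθ]; linarith)
  have h1 : ∀ θ ∈ (Contour.centered s).bd, θ - 1 ≠ 0 := fun θ hθ =>
    sub_ne_zero.mpr fun h => by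
      rw [h, mem_bd_centered, norm_one] at hθ; exact hs.ne hθ
  have hQ : ∀ θ : ℂ, θ ≠ 0 → (θ • X - Y).det = θ ^ (n - 1) * Q.det.eval θ⁻¹ := fun θ hθ => by
    rw [← prod_ite_lt (N := N) (by omega), ← Polynomial.coe_evalRingHom, RingHom.map_det,
      ← Matrix.det_mul_column]
    congr 1
    ext i j
    simp only [Q, Matrix.of_apply, Matrix.sub_apply, Matrix.smul_apply, smul_eq_mul,
      RingHom.mapMatrix_apply, Matrix.map_apply, Polynomial.coe_evalRingHom]
    split_ifs with h
    · simp; field_simp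
    · rw [hX i (by omega)]; simp
  have hterm : ∀ k, ContinuousOn (fun θ : ℂ => Q.det.coeff k * ((θ ^ (k + 1))⁻¹ / (θ - 1)))
      (Contour.centered s).bd := fun k => continuousOn_const.mul <|
    ((continuousOn_id.pow _).inv₀ fun θ hθ => pow_ne_zero _ (h0 θ hθ)).div
      (continuousOn_id.sub continuousOn_const) h1
  trans (Contour.centered s).integral fun θ => ∑ k ∈ Finset.range (Q.det.natDegree + 1),
    Q.det.coeff k * ((θ ^ (k + 1))⁻¹ / (θ - 1))
  · refine Contour.integral_congr hs0 fun θ hθ => ?_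
    have hθ0 := h0 θ hθ
    simp only [hQ θ hθ0, Polynomial.eval_eq_sum_range]
    rw [← mul_assoc, Finset.mul_sum]
    refine Finset.sum_congr rfl fun k _ => ?_
    obtain ⟨n, rfl⟩ := Nat.exists_eq_add_of_le' hn
    rw [Nat.add_sub_cancel, inv_pow]
    field_simp
    ring
  · rw [Contour.integral_sum hs0 _ fun k _ => hterm k]
    refine Finset.sum_eq_zero fun k _ => ?_
    rw [Contour.integral_const_mul, integral_inv_pow_div hs, mul_zero]

end

/-! ### Initial values -/

variable {a b : ℕ → ℝ} {N M : ℕ}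

lemma Exceeds.mono {R R' : ℝ} (hR : Exceeds a b N M R) (hRR : R ≤ R') : Exceeds a b N M R' :=
  ⟨hR.1.trans_le hRR, fun k hk => (hR.2.1 k hk).trans_le hRR,
    fun k hk => (hR.2.2 k hk).trans_le hRR⟩

/-- The entries for two times are row integrals with a special kernel `K`, so the relations for
`rowInt` cover them too. -/
lemma rowInt_pairing (n : ℕ) (T U : Finset ℕ) (e e' x : ℤ) (R R' : ℝ) (i j : ℕ) :
    rowInt a b R e T (fun z => nodes b (seg n) z
        * cauchyTransform (Contour.centered R') (colFun a b n U e' j) z) i x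
      = pairing (Contour.centered R) (Contour.centered R') (rowFun a b n T (e - x) (i + 1))
        (colFun a b n U e' j) := by
  rw [pairing_eq]
  unfold rowInt rowFun
  congr 1; ext z
  ring

/-- A negative power adds a root at `0` to those in `E`, so there are at least two roots in all. -/
lemma integral_zpow_div_rootProd {R : ℝ} (hR : 0 < R) {c : ℂ} {p : ℤ} (hp : p < 0) {E : Multiset ℂ}
    (hE : ∀ e ∈ E, ‖e‖ < R) (h1 : 1 ≤ E.card) :
    ((Contour.centered R).integral fun z => (c * z) ^ p / rootProd E z) = 0 := by
  obtain ⟨q, rfl⟩ : ∃ q : ℕ, p = -((q + 1 : ℕ) : ℤ) := ⟨(-p - 1).toNat, by omega⟩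
  have hR0 : 0 ≤ (Contour.centered R).radius := hR.le
  rw [← mul_zero (c ^ (-((q + 1 : ℕ) : ℤ))), ← Contour.integral_inv_rootProd
    (C := Contour.centered R) (Multiset.replicate (q + 1) 0 + E) (fun e he => ?_) ?_,
    ← Contour.integral_const_mul]
  · refine Contour.integral_congr hR0 fun z _ => ?_
    simp only [rootProd_add, rootProd_replicate_zero, zpow_neg, zpow_natCast]
    rw [mul_pow, mul_inv, mul_inv, div_eq_mul_inv, mul_assoc]
  · rw [Multiset.card_add, Multiset.card_replicate]; omega
  · rw [mem_inside_centered]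
    rcases Multiset.mem_add.mp he with h | h
    · rw [Multiset.eq_of_mem_replicate h, norm_zero]; exact hR
    · exact hE e h

section

variable {R : ℝ} (hR : Exceeds a b N M R) (hab : Generic a b N M)
include hR hab

/-- The factor in `z` is a polynomial, and `w` lies outside the `z` circle: the integral over `z`
vanishes by Cauchy's theorem. -/
lemma pairing_eq_zero_of_nonneg {n i : ℕ} (hn : n ≤ N) (hi : i ≤ n) (h1 : 1 ≤ i) {p : ℤ} (hp : 0 ≤ p)
    {R' : ℝ} (hRR : R < R') {k : ℂ → ℂ} (hk : ContinuousOn k (Contour.centered R').bd) :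
    pairing (Contour.centered R) (Contour.centered R') (rowFun a b n ∅ p i) k = 0 := by
  have hR0 : 0 ≤ (Contour.centered R).radius := hR.1.le
  have hR0' : 0 ≤ (Contour.centered R').radius := hR.1.le.trans hRR.le
  lift p to ℕ using hp
  have hin : i ∈ seg N := mem_seg.mpr ⟨h1, hi.trans hn⟩
  rw [pairing_swap hR0 hR0' (fun z hz => (hR.differentiableAt_rowFun hab (Finset.empty_subset _) _
    hin (mem_bd_centered.mp hz).ge).continuousAt.continuousWithinAt) hk
    (disjoint_bd_centered hRR.ne), pairing_eq, neg_eq_zero, ← Contour.integral_zero]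
  refine Contour.integral_congr hR0' fun w hw => ?_
  have : cauchyTransform (Contour.centered R) (rowFun a b n ∅ p i) w = 0 := by
    unfold cauchyTransform
    trans (Contour.centered R).integral fun z =>
      ((b i : ℂ) * z) ^ p * nodes b (seg n \ seg i) z / (w - z)
    · refine Contour.integral_congr hR0 fun z hz => ?_
      have h0 : nodes b (seg i) z ≠ 0 := nodes_ne_zero fun k hk =>
        hR.ne_node (mem_bd_centered.mp hz).ge (seg_mono (hi.trans hn) hk)
      simp only [rowFun, nodes_div_eq (seg_mono hi) h0, zpow_natCast, Finset.prod_empty, mul_one]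
    · refine Contour.integral_eq_zero hR0 fun z hz => DifferentiableAt.differentiableWithinAt ?_
      refine DifferentiableAt.div (DifferentiableAt.mul (by fun_prop) (differentiable_nodes _ _ z))
        (by fun_prop) (sub_ne_zero.mpr ?_)
      rintro rfl
      exact hRR.not_ge ((mem_bd_centered.mp hw).symm.le.trans (mem_disc_centered.mp hz))
  rw [this, mul_zero]

/-- Here the `z` circle encloses `w`. The integrand in `z` is a constant over a product with the
roots `0` and `w` at least, hence integrates to zero. -/
lemma pairing_eq_zero_of_neg {n i : ℕ} (hi : n ≤ i) (h1 : 1 ≤ i) (hiN : i ≤ N) {p : ℤ} (hp : p < 0)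
    {R' : ℝ} (hRR : R < R') {k : ℂ → ℂ} (hk : ContinuousOn k (Contour.centered R).bd) :
    pairing (Contour.centered R') (Contour.centered R) (rowFun a b n ∅ p i) k = 0 := by
  have hR0 : 0 ≤ (Contour.centered R).radius := hR.1.le
  have hR0' : 0 ≤ (Contour.centered R').radius := hR.1.le.trans hRR.le
  have hR' := hR.mono hRR.le
  have hin : i ∈ seg N := mem_seg.mpr ⟨h1, hiN⟩
  rw [pairing_swap hR0' hR0 (fun z hz => (hR'.differentiableAt_rowFun hab (Finset.empty_subset _) _
    hin (mem_bd_centered.mp hz).ge).continuousAt.continuousWithinAt) hk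
    (disjoint_bd_centered hRR.ne'), pairing_eq, neg_eq_zero, ← Contour.integral_zero]
  refine Contour.integral_congr hR0 fun w hw => ?_
  have : cauchyTransform (Contour.centered R') (rowFun a b n ∅ p i) w = 0 := by
    unfold cauchyTransform
    rw [← neg_zero, ← integral_zpow_div_rootProd hR'.1 (c := b i) hp
      (E := w ::ₘ (seg i \ seg n).val.map fun k => 1 / (b k : ℂ)) (fun e he => ?_) (by simp),
      ← Contour.integral_neg]
    · refine Contour.integral_congr hR0' fun z hz => ?_
      have hz' := (mem_bd_centered.mp hz).ge
      have h0 : nodes b (seg i) z ≠ 0 := nodes_ne_zero fun k hk =>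
        hR'.ne_node hz' (seg_mono hiN hk)
      simp only [rowFun, nodes_div_eq_inv (seg_mono hi) h0, Finset.prod_empty, mul_one,
        rootProd_cons, ← nodes_eq_rootProd]
      rw [← neg_sub z w, div_neg, ← div_eq_mul_inv, div_div, mul_comm (z - w)]
    · rcases Multiset.mem_cons.mp he with rfl | h
      · rw [mem_bd_centered.mp hw]; exact hRR
      · obtain ⟨k, hk, rfl⟩ := Multiset.mem_map.mp h
        exact hR'.2.1 k (seg_mono hiN (Finset.sdiff_subset (Finset.mem_val.mp hk)))
  rw [this, mul_zero]

/-- The determinant attached to one time, for the empty set of columns. -/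
lemma det_rowInt_empty {H : ℤ} {x : ℕ → ℤ} (hx : Monotone x) (hN : 1 ≤ N) :
    (Matrix.of fun i j : Fin N => rowInt a b R (H - 1) ∅ (nodes b (seg j)) i (x i)).det
      = if x (N - 1) < H then 1 else 0 := by
  have hR0 : 0 ≤ (Contour.centered R).radius := hR.1.le
  have hnode : ∀ k ≤ N, ∀ z ∈ (Contour.centered R).bd, nodes b (seg k) z ≠ 0 := fun k hk z hz =>
    nodes_ne_zero fun l hl => hR.ne_node (mem_bd_centered.mp hz).ge (seg_mono hk hl)
  split_ifs with hH
  -- By monotonicity all exponents are nonnegative. Entries above the diagonal are then integrals of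
  -- polynomials, and a diagonal entry is the residue `1` at `1 / b_{i+1}`.
  · have hp : ∀ i : Fin N, ∃ p : ℕ, H - 1 - x i = p := fun i =>
      ⟨(H - 1 - x i).toNat, by have := hx (show (i : ℕ) ≤ N - 1 by omega); omega⟩
    choose p hp using hp
    rw [Matrix.det_of_isLowerTriangular]
    · refine Finset.prod_eq_one fun i _ => ?_
      have hb := hab.1 (i + 1) (mem_seg.mpr ⟨by omega, i.2⟩)
      have hw : 1 / (b (i + 1) : ℂ) ∈ (Contour.centered R).inside :=
        mem_inside_centered.mpr (hR.2.1 _ (mem_seg.mpr ⟨by omega, i.2⟩))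
      simp only [Matrix.of_apply, rowInt, hp, zpow_natCast, Finset.prod_empty, mul_one]
      trans ((b (i + 1) : ℂ) * (1 / (b (i + 1) : ℂ))) ^ p i
      · rw [← Contour.integral_div_sub (C := Contour.centered R)
          (f := fun z => ((b (i + 1) : ℂ) * z) ^ p i)
          (Differentiable.differentiableOn (by fun_prop)) hw]
        refine Contour.integral_congr hR0 fun z hz => ?_
        have := hnode i i.2.le z hz
        simp only [nodes_seg_succ]
        rw [mul_comm (nodes b _ z), ← div_div, div_mul_cancel₀ _ this]
      · rw [mul_one_div_cancel hb, one_pow]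
    · intro i j hij
      simp only [Matrix.of_apply, rowInt, hp, zpow_natCast, Finset.prod_empty, mul_one]
      have hij' : (i : ℕ) < j := hij
      trans (Contour.centered R).integral fun z =>
        ((b (i + 1) : ℂ) * z) ^ p i * nodes b (seg j \ seg (i + 1)) z
      · refine Contour.integral_congr hR0 fun z hz => ?_
        simp only [← nodes_div_eq (seg_mono (Nat.succ_le_of_lt hij')) (hnode _ i.2 z hz)]
        ring
      · exact Contour.integral_eq_zero hR0 ((Differentiable.mul (by fun_prop)
          (differentiable_nodes _ _)).differentiableOn)
  -- The exponent in the last row is negative, and at least one node survives in each of its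
  -- denominators, so the whole row vanishes.
  · refine Matrix.det_eq_zero_of_row_eq_zero ⟨N - 1, by omega⟩ fun j => ?_
    have hj : (j : ℕ) ≤ N - 1 := by omega
    simp only [Matrix.of_apply, rowInt, Finset.prod_empty, mul_one]
    rw [← integral_zpow_div_rootProd hR.1 (c := b (N - 1 + 1))
      (p := H - 1 - x (N - 1)) (by omega)
      (E := (seg (N - 1 + 1) \ seg j).val.map fun k => 1 / (b k : ℂ)) (fun e he => ?_) ?_]
    · refine Contour.integral_congr hR0 fun z hz => ?_
      simp only [← nodes_eq_rootProd]
      rw [div_mul_eq_mul_div, mul_div_assoc,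
        nodes_div_eq_inv (seg_mono (by omega)) (hnode _ (by omega) z hz), ← div_eq_mul_inv]
    · rw [Multiset.card_map, Finset.card_val, card_seg_sdiff (by omega)]; omega
    · obtain ⟨k, hk, rfl⟩ := Multiset.mem_map.mp he
      exact hR.2.1 k (seg_mono (by omega) (Finset.sdiff_subset (Finset.mem_val.mp hk)))

/-- The integral attached to two times, for the empty set of columns up to the first time. -/
lemma integral_det_pairing_empty {n : ℕ} (hn : 1 ≤ n) (hnN : n ≤ N) {U : Finset ℕ} (hU : U ⊆ seg M)
    {h H : ℤ} {x : ℕ → ℤ} (hx : Monotone x) {R' s : ℝ} (hRR : R < R') (hs : 1 < s) :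
    ((Contour.centered s).integral fun θ => (θ ^ n)⁻¹ / (θ - 1) *
      (θ • (Matrix.of fun i j : Fin N => pairing (Contour.centered R') (Contour.centered R)
          (rowFun a b n ∅ (h - 1 - x i) (i + 1)) (colFun a b n U (H - h) (j + 1)))
        - Matrix.of fun i j : Fin N => pairing (Contour.centered R) (Contour.centered R')
          (rowFun a b n ∅ (h - 1 - x i) (i + 1)) (colFun a b n U (H - h) (j + 1))).det)
      = if x (n - 1) < h then
          (Matrix.of fun i j : Fin N => rowInt a b R (H - 1) U (nodes b (seg j)) i (x i)).det
        else 0 := by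
  have hR0 : 0 ≤ (Contour.centered R).radius := hR.1.le
  have hmem : ∀ i : Fin N, (i : ℕ) + 1 ∈ seg N := fun i => mem_seg.mpr ⟨by omega, i.2⟩
  have hf : ∀ (i : Fin N) (p : ℤ) (z : ℂ), R ≤ ‖z‖ →
      DifferentiableAt ℂ (rowFun a b n ∅ p (i + 1)) z := fun i p z hz =>
    hR.differentiableAt_rowFun hab (Finset.empty_subset _) _ (hmem i) hz
  have hk : ∀ (j : Fin N) (z : ℂ), R ≤ ‖z‖ →
      DifferentiableAt ℂ (colFun a b n U (H - h) (j + 1)) z := fun j z hz =>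
    hR.differentiableAt_colFun hab hnN hU _ (hmem j) hz
  split_ifs with hh
  -- `X - Y` is the residue at `z = w`, a single integral `g`. It carries normalizing factors from
  -- column `j` where `rowInt` has those of row `i`. The two matrices differ by conjugation with the
  -- diagonal matrix of the `c i`.
  · let c : Fin N → ℂ := fun i =>
      (b (i + 1) : ℂ) ^ (H - h) * ∏ k ∈ U, (1 - (a k : ℂ) * b (i + 1))
    have hc : ∀ i, c i ≠ 0 := fun i => mul_ne_zero (zpow_ne_zero _ (hab.1 _ (hmem i)))
      (Finset.prod_ne_zero_iff.mpr fun k hk => hab.2 k (hU hk) _ (hmem i))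
    let g : Matrix (Fin N) (Fin N) ℂ := Matrix.of fun i j => (Contour.centered R).integral fun z =>
      rowFun a b n ∅ (h - 1 - x i) (i + 1) z * colFun a b n U (H - h) (j + 1) z
    rw [integral_det_of_rows_eq_zero (Z := g) hnN hs]
    · have hcg : (∏ i, c i) * g.det = (∏ i, c i) * (Matrix.of fun i j : Fin N =>
          rowInt a b R (H - 1) U (nodes b (seg j)) i (x i)).det := by
        rw [← Matrix.det_mul_column, ← Matrix.det_mul_row]
        congr 1
        ext i j
        simp only [g, Matrix.of_apply, rowInt]
        rw [← Contour.integral_const_mul, ← Contour.integral_const_mul]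
        refine Contour.integral_congr hR0 fun z hz => ?_
        have hz' := (mem_bd_centered.mp hz).ge
        have hz0 := hR.ne_zero hz'
        have hnz : nodes b (seg n) z ≠ 0 := nodes_ne_zero fun k hk =>
          hR.ne_node hz' (seg_mono hnN hk)
        have e1 : H - 1 - x i = (h - 1 - x i) + (H - h) := by ring
        simp only [c, rowFun, colFun, e1, zpow_add₀ (mul_ne_zero (hab.1 _ (hmem i)) hz0),
          Finset.prod_empty, Nat.add_sub_cancel, Finset.prod_div_distrib, mul_zpow]
        generalize (∏ k ∈ U, (1 - (a k : ℂ) * b (i + 1))) = X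
        generalize (∏ k ∈ U, (1 - (a k : ℂ) * b (j + 1))) = Y
        generalize (∏ k ∈ U, (1 - (a k : ℂ) / z)) = Z
        field_simp
      exact mul_left_cancel₀ (Finset.prod_ne_zero_iff.mpr fun i _ => hc i) hcg
    · ext i j
      exact pairing_centered_sub hR.1 (hf i _) (hk j) le_rfl hRR
    · intro i hi j
      have := hx (show (i : ℕ) ≤ n - 1 by omega)
      exact pairing_eq_zero_of_nonneg hR hab hnN hi (by omega) (by omega) hRR
        (continuousOn_bd_centered (hk j) hRR.le)
  -- Index `n - 1` is height `n`. From there on the exponents `h - 1 - x i` are negative, and the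
  -- corresponding rows of `X` vanish.
  · refine integral_det_eq_zero hn hnN hs fun i hi j => ?_
    have := hx (show n - 1 ≤ (i : ℕ) by omega)
    exact pairing_eq_zero_of_neg hR hab hi (by omega) i.2 (by omega) hRR
      (continuousOn_bd_centered (hk j) le_rfl)

end

end TwoTime

namespace TwoTime

open MeasureTheory ProbabilityTheory

/-! ### Integrating out all the columns -/

variable {a b : ℕ → ℝ} {n N m M : ℕ}

lemma insert_seg_sdiff {t k : ℕ} (h : t < k) :
    insert (t + 1) (seg k \ seg (t + 1)) = seg k \ seg t := by
  ext l
  simp only [Finset.mem_insert, Finset.mem_sdiff, mem_seg]; omega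

section

variable {Ω : Type*} [MeasurableSpace Ω] {μ : Measure Ω} [IsProbabilityMeasure μ]
  {W : ℕ → ℕ → Ω → ℕ}

lemma measurable_growth (hW : ∀ i j, 1 ≤ i → 1 ≤ j → Measurable (W i j)) (m n : ℕ) :
    Measurable fun x => growth 0 (fun i j => W i j x) m n := by
  induction m generalizing n with
  | zero => simp only [growth_zero_left]; exact measurable_const
  | succ m ih =>
    induction n with
    | zero => simp only [growth_zero_right]; exact measurable_const
    | succ n ihn =>
      simp only [growth_succ]
      exact ((ih (n + 1)).max ihn).add
        ((measurable_from_top (f := fun k : ℕ => (k : ℤ))).comp (hW _ _ (by omega) (by omega)))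

/-- Column by column from `l` down to `k`. The factor `f` depends only on the first `k` columns and
is carried along unchanged. -/
lemma integral_columns (hab : ∀ i j, 1 ≤ i → 1 ≤ j → 0 < a i * b j ∧ a i * b j < 1)
    (hWmeas : ∀ i j, 1 ≤ i → 1 ≤ j → Measurable (W i j))
    (hWindep : iIndepFun (fun p : ℕ × ℕ => W (p.1 + 1) (p.2 + 1)) μ)
    (hWlaw : ∀ i j, 1 ≤ i → 1 ≤ j → ∀ k : ℕ,
      μ.real {x | W i j x = k} = (1 - a i * b j) * (a i * b j) ^ k)
    {k l : ℕ} (hkl : k ≤ l) {F : ℕ → (ℕ → ℤ) → ℂ}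
    (hF : ∀ t, k ≤ t → t < l → ∃ C U, StepFamily N (fun i => a (t + 1) * b (i + 1)) C U ∧
      U N = F (t + 1) ∧ U 0 = F t)
    {f : (ℕ → ℕ → ℕ) → ℂ} (hf1 : ∀ w, ‖f w‖ ≤ 1)
    (hf : ∀ w w' : ℕ → ℕ → ℕ, (∀ i j, i < k → j < N → w (i + 1) (j + 1) = w' (i + 1) (j + 1)) →
      f w = f w') :
    ∫ x, f (fun i j => W i j x) * F l (fun i => growth 0 (fun i j => W i j x) l (i + 1)) ∂μ
      = ∫ x, f (fun i j => W i j x) * F k (fun i => growth 0 (fun i j => W i j x) k (i + 1)) ∂μ := by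
  induction l, hkl using Nat.le_induction with
  | base => rfl
  | succ l hkl ih =>
    rw [← ih fun t h1 h2 => hF t h1 (by omega)]
    obtain ⟨C, U, hU, hN, h0⟩ := hF l hkl (Nat.lt_succ_self l)
    rw [← hN, ← h0]
    exact hU.integral_column hab hWmeas hWindep hWlaw hf1
      fun w w' h => hf w w' fun i j hi hj => h i j (by omega) hj

end

section

variable {R : ℝ} (hR : Exceeds a b N M R) (hab : Generic a b N M)
include hR hab

/-- The determinant attached to one time, for the set `T` of columns. -/
def oneTimeDet (a b : ℕ → ℝ) (N : ℕ) (R : ℝ) (e : ℤ) (T : Finset ℕ) (x : ℕ → ℤ) : ℂ :=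
  (Matrix.of fun i j : Fin N => rowInt a b R e T (nodes b (seg j)) i (x i)).det

/-- The set of columns holds those already integrated out. Integrating out column `t + 1` adds it to
the set. -/
lemma exists_stepFamily_oneTimeDet {e : ℤ} {k t : ℕ} (hk : k ≤ M) (ht : t < k) :
    ∃ C U, StepFamily N (fun i => a (t + 1) * b (i + 1)) C U ∧
      U N = oneTimeDet a b N R e (seg k \ seg (t + 1)) ∧
      U 0 = oneTimeDet a b N R e (seg k \ seg t) := by
  obtain ⟨C, hC⟩ := exists_rowFamily hab hR (K := fun j => nodes b (seg j))
    (fun j => (differentiable_nodes _ _).continuous.continuousOn)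
    (T := seg k \ seg (t + 1)) (t := t + 1) (by simp [mem_seg])
    (by rw [insert_seg_sdiff ht]; exact Finset.sdiff_subset.trans (seg_mono hk)) e
  rw [insert_seg_sdiff ht] at hC
  refine ⟨_, _, hC.stepFamily, ?_, ?_⟩
  · funext x
    unfold oneTimeDet
    congr 1; ext i j; simp
  · funext x
    unfold oneTimeDet
    congr 1

/-- A row of the matrix attached to two times. -/
def twoTimeRow (a b : ℕ → ℝ) (n N : ℕ) (R R' : ℝ) (T U : Finset ℕ) (e e' : ℤ) (i : ℕ) (x : ℤ)
    (j : Fin N) : ℂ :=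
  pairing (Contour.centered R) (Contour.centered R')
    (rowFun a b n T (e - x) (i + 1)) (colFun a b n U e' (j + 1))

/-- The matrix attached to two times, for the set `T` of columns up to the first time and the
set `U` of columns between the two times. -/
def twoTimeMatrix (a b : ℕ → ℝ) (n N : ℕ) (R R' : ℝ) (T U : Finset ℕ) (e e' : ℤ) (x : ℕ → ℤ) :
    Matrix (Fin N) (Fin N) ℂ :=
  Matrix.of fun i => twoTimeRow a b n N R R' T U e e' i (x i)

/-- The integral attached to two times, for the set `T` of columns up to the first time and the
set `U` of columns between the two times. -/
def twoTimeInt (a b : ℕ → ℝ) (n N : ℕ) (R R' s : ℝ) (T U : Finset ℕ) (e e' : ℤ) (x : ℕ → ℤ) : ℂ :=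
  (Contour.centered s).integral fun θ => (θ ^ n)⁻¹ / (θ - 1) *
    (θ • twoTimeMatrix a b n N R' R T U e e' x - twoTimeMatrix a b n N R R' T U e e' x).det

/-- For each `θ` the rows of `θ X - Y` form a row family, and step families survive integration
against the kernel in `θ`. -/
lemma exists_stepFamily_twoTimeInt (hn : n ≤ N) {R' s : ℝ} (hRR : R < R') (hs : 1 < s) {U : Finset ℕ}
    (hU : U ⊆ seg M) {e e' : ℤ} {k t : ℕ} (hk : k ≤ M) (ht : t < k) :
    ∃ C V, StepFamily N (fun i => a (t + 1) * b (i + 1)) C V ∧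
      V N = twoTimeInt a b n N R R' s (seg k \ seg (t + 1)) U e e' ∧
      V 0 = twoTimeInt a b n N R R' s (seg k \ seg t) U e e' := by
  have hR' := hR.mono hRR.le
  have hs0 : 0 ≤ (Contour.centered s).radius := zero_le_one.trans hs.le
  have hfam : ∀ r r' : ℝ, R ≤ r → R ≤ r' → r ≠ r' →
      ∃ C, RowFamily N (fun i => a (t + 1) * b (i + 1)) (reflectCoeff a b e (seg k \ seg t)) C
        (twoTimeRow a b n N r r' (seg k \ seg (t + 1)) U e e')
        (twoTimeRow a b n N r r' (seg k \ seg t) U e e') := by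
    intro r r' hr hr' hne
    obtain ⟨C, hC⟩ := exists_rowFamily hab (hR.mono hr) (K := fun (j : Fin N) z =>
      nodes b (seg n) z * cauchyTransform (Contour.centered r') (colFun a b n U e' (j + 1)) z)
      (fun j => (differentiable_nodes _ _).continuous.continuousOn.mul
        (continuousOn_cauchyTransform (hR.1.le.trans hr') (continuousOn_bd_centered (fun z hz =>
          hR.differentiableAt_colFun hab hn hU _ (mem_seg.mpr ⟨by omega, j.2⟩) hz) hr')
        (disjoint_bd_centered hne)))
      (T := seg k \ seg (t + 1)) (t := t + 1) (by simp [mem_seg])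
      (by rw [insert_seg_sdiff ht]; exact Finset.sdiff_subset.trans (seg_mono hk)) e
    rw [insert_seg_sdiff ht] at hC
    simp only [rowInt_pairing] at hC
    exact ⟨C, hC⟩
  obtain ⟨C, hC⟩ := hfam R' R hRR.le le_rfl hRR.ne'
  obtain ⟨D, hD⟩ := hfam R R' le_rfl hRR.le hRR.ne
  have h0 : ∀ θ ∈ (Contour.centered s).bd, θ ≠ 0 := fun θ hθ =>
    norm_pos_iff.mp (by rw [mem_bd_centered.mp hθ]; linarith)
  have h1 : ∀ θ ∈ (Contour.centered s).bd, θ - 1 ≠ 0 := fun θ hθ => sub_ne_zero.mpr fun h => by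
    rw [h, mem_bd_centered, norm_one] at hθ; exact hs.ne hθ
  have hκ : ContinuousOn (fun θ : ℂ => (θ ^ n)⁻¹ / (θ - 1)) (Contour.centered s).bd :=
    ((continuousOn_id.pow _).inv₀ fun θ hθ => pow_ne_zero _ (h0 θ hθ)).div
      (continuousOn_id.sub continuousOn_const) h1
  obtain ⟨K, hK⟩ := (Contour.centered s).isCompact_bd.exists_bound_of_continuousOn hκ
  -- `|θ| = s` on the circle, so the bound of the combined rows is uniform in `θ`.
  refine ⟨_, _, StepFamily.integral hs0 hκ hK (B := N.factorial • (s * C + D) ^ N)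
    (U := fun θ k' x => (Matrix.of fun i : Fin N => if (i : ℕ) < k'
      then θ • twoTimeRow a b n N R' R (seg k \ seg (t + 1)) U e e' i (x i)
        - twoTimeRow a b n N R R' (seg k \ seg (t + 1)) U e e' i (x i)
      else θ • twoTimeRow a b n N R' R (seg k \ seg t) U e e' i (x i)
        - twoTimeRow a b n N R R' (seg k \ seg t) U e e' i (x i)).det)
    (fun θ hθ => ?_) fun k x => ?_, ?_, ?_⟩
  · have := (hC.smul_sub hD θ).stepFamily
    rw [mem_bd_centered.mp hθ] at this
    exact this
  · refine (Continuous.matrix_det (continuous_matrix fun i j => ?_)).continuousOn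
    simp only [Matrix.of_apply]
    split_ifs <;> simp only [Pi.sub_apply, Pi.smul_apply, smul_eq_mul] <;> fun_prop
  · funext x
    unfold twoTimeInt
    congr 1; funext θ; congr 2; ext i j; simp [twoTimeMatrix]
  · funext x
    unfold twoTimeInt
    congr 1

end

section

variable {Ω : Type*} [MeasurableSpace Ω] {μ : Measure Ω} [IsProbabilityMeasure μ]
  {W : ℕ → ℕ → Ω → ℕ}

omit [IsProbabilityMeasure μ] in
lemma measureReal_eq_integral_oneTimeDet
    (hWmeas : ∀ i j, 1 ≤ i → 1 ≤ j → Measurable (W i j)) (hgen : Generic a b N M) (hN : 1 ≤ N)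
    (h H : ℤ) {R : ℝ} (hR : Exceeds a b N M R) :
    ((μ.real {x | growth 0 (fun i j => W i j x) m n < h ∧
        growth 0 (fun i j => W i j x) M N < H} : ℝ) : ℂ)
      = ∫ x, (if growth 0 (fun i j => W i j x) m n < h then 1 else 0)
        * oneTimeDet a b N R (H - 1) ∅ (fun i => growth 0 (fun i j => W i j x) M (i + 1)) ∂μ := by
  have hmeas : MeasurableSet {x | growth 0 (fun i j => W i j x) m n < h ∧
      growth 0 (fun i j => W i j x) M N < H} :=
    (measurableSet_lt (measurable_growth hWmeas m n) measurable_const).inter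
      (measurableSet_lt (measurable_growth hWmeas M N) measurable_const)
  have : ∀ x, (if growth 0 (fun i j => W i j x) m n < h then (1 : ℂ) else 0)
        * oneTimeDet a b N R (H - 1) ∅ (fun i => growth 0 (fun i j => W i j x) M (i + 1))
      = {x | growth 0 (fun i j => W i j x) m n < h ∧
        growth 0 (fun i j => W i j x) M N < H}.indicator (fun _ => (1 : ℂ)) x := by
    intro x
    rw [oneTimeDet, det_rowInt_empty hR hgen
      (fun i j hij => growth_mono M (Nat.add_le_add_right hij 1)) hN, Nat.sub_add_cancel hN,
      Set.indicator_apply]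
    change _ = if _ ∧ _ then (1 : ℂ) else 0
    rw [ite_and, ite_mul, one_mul, zero_mul]
  simp only [this]
  rw [integral_indicator_const _ hmeas, Complex.real_smul, mul_one]

lemma integral_oneTimeDet_eq (hab : ∀ i j, 1 ≤ i → 1 ≤ j → 0 < a i * b j ∧ a i * b j < 1)
    (hWmeas : ∀ i j, 1 ≤ i → 1 ≤ j → Measurable (W i j))
    (hWindep : iIndepFun (fun p : ℕ × ℕ => W (p.1 + 1) (p.2 + 1)) μ)
    (hWlaw : ∀ i j, 1 ≤ i → 1 ≤ j → ∀ k : ℕ,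
      μ.real {x | W i j x = k} = (1 - a i * b j) * (a i * b j) ^ k)
    (hgen : Generic a b N M) (hnN : n ≤ N) (hmM : m ≤ M) (h : ℤ) (e : ℤ) {R : ℝ}
    (hR : Exceeds a b N M R) :
    ∫ x, (if growth 0 (fun i j => W i j x) m n < h then 1 else 0)
        * oneTimeDet a b N R e ∅ (fun i => growth 0 (fun i j => W i j x) M (i + 1)) ∂μ
      = ∫ x, (if growth 0 (fun i j => W i j x) m n < h then 1 else 0)
        * oneTimeDet a b N R e (seg M \ seg m)
          (fun i => growth 0 (fun i j => W i j x) m (i + 1)) ∂μ := by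
  rw [← Finset.sdiff_self (seg M)]
  refine integral_columns (N := N) hab hWmeas hWindep hWlaw hmM
    (F := fun t => oneTimeDet a b N R e (seg M \ seg t))
    (fun t _ ht => exists_stepFamily_oneTimeDet hR hgen le_rfl ht)
    (f := fun w => if growth 0 w m n < h then 1 else 0)
    (fun w => by split_ifs <;> simp) fun w w' hw => ?_
  have := growth_congr (w := w) (w' := w') (m := m) (n := n) fun i j hi hi' hj hj' => by
    obtain ⟨i, rfl⟩ := Nat.exists_eq_add_of_le' hi
    obtain ⟨j, rfl⟩ := Nat.exists_eq_add_of_le' hj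
    exact hw i j (by omega) (by omega)
  simp only [this]

lemma twoTimeInt_empty (hgen : Generic a b N M) (hn : 1 ≤ n) (hnN : n ≤ N) {U : Finset ℕ}
    (hU : U ⊆ seg M) {h H : ℤ} {x : ℕ → ℤ} (hx : Monotone x) {R R' s : ℝ}
    (hR : Exceeds a b N M R) (hRR : R < R') (hs : 1 < s) :
    twoTimeInt a b n N R R' s ∅ U (h - 1) (H - h) x
      = (if x (n - 1) < h then 1 else 0) * oneTimeDet a b N R (H - 1) U x := by
  rw [ite_mul, one_mul, zero_mul]
  exact integral_det_pairing_empty hR hgen hn hnN hU hx hRR hs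

lemma twoTimeMatrix_zero (h H : ℤ) (R R' : ℝ) :
    twoTimeMatrix a b n N R R' (seg m) (seg M \ seg m) (h - 1) (H - h) (fun _ => 0)
      = toMatrix N (L a b n m M h H R R') := by
  ext i j
  simp only [twoTimeMatrix, twoTimeRow, toMatrix, Matrix.of_apply, sub_zero, L_eq_pairing]

/-- The distribution function in terms of a single determinant. -/
lemma measureReal_growth (hab : ∀ i j, 1 ≤ i → 1 ≤ j → 0 < a i * b j ∧ a i * b j < 1)
    (hWmeas : ∀ i j, 1 ≤ i → 1 ≤ j → Measurable (W i j))
    (hWindep : iIndepFun (fun p : ℕ × ℕ => W (p.1 + 1) (p.2 + 1)) μ)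
    (hWlaw : ∀ i j, 1 ≤ i → 1 ≤ j → ∀ k : ℕ,
      μ.real {x | W i j x = k} = (1 - a i * b j) * (a i * b j) ^ k)
    (hgen : Generic a b N M) (hn : 1 ≤ n) (hnN : n ≤ N) (hmM : m ≤ M) (h H : ℤ) {R R' s : ℝ}
    (hR : Exceeds a b N M R) (hRR : R < R') (hs : 1 < s) :
    ((μ.real {x | growth 0 (fun i j => W i j x) m n < h ∧
        growth 0 (fun i j => W i j x) M N < H} : ℝ) : ℂ)
      = (Contour.centered s).integral fun θ => (θ ^ n)⁻¹ / (θ - 1) *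
        (θ • toMatrix N (L a b n m M h H R' R) - toMatrix N (L a b n m M h H R R')).det := by
  -- The second stage: from column `m` down to column `0`, which is identically zero, so that the
  -- integrand is deterministic. The indicator is now part of the `θ` integral and `f` is constant.
  have e3 := integral_columns (μ := μ) (N := N) hab hWmeas hWindep hWlaw (Nat.zero_le m)
    (F := fun t => twoTimeInt a b n N R R' s (seg m \ seg t) (seg M \ seg m) (h - 1) (H - h))
    (fun t _ ht => exists_stepFamily_twoTimeInt hR hgen hnN hRR hs Finset.sdiff_subset hmM ht)
    (f := fun _ => 1) (fun w => by simp) (fun _ _ _ => rfl)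
  have e4 : ∀ x, (if growth 0 (fun i j => W i j x) m n < h then 1 else 0)
        * oneTimeDet a b N R (H - 1) (seg M \ seg m)
          (fun i => growth 0 (fun i j => W i j x) m (i + 1))
      = twoTimeInt a b n N R R' s ∅ (seg M \ seg m) (h - 1) (H - h)
        (fun i => growth 0 (fun i j => W i j x) m (i + 1)) := by
    intro x
    rw [twoTimeInt_empty hgen hn hnN Finset.sdiff_subset
      (fun i j hij => growth_mono m (Nat.add_le_add_right hij 1)) hR hRR hs, Nat.sub_add_cancel hn]
  rw [measureReal_eq_integral_oneTimeDet hWmeas hgen (hn.trans hnN) h H hR,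
    integral_oneTimeDet_eq hab hWmeas hWindep hWlaw hgen hnN hmM h (H - 1) hR]
  simp only [e4]
  simp only [one_mul, Finset.sdiff_self] at e3
  rw [e3]
  have hseg : seg m \ seg 0 = seg m := by simp [seg]
  simp only [growth_zero_left, integral_const, probReal_univ, one_smul, hseg]
  unfold twoTimeInt
  simp only [twoTimeMatrix_zero]

end

end TwoTime

namespace TwoTime

/-! ### The distribution function in terms of the orthogonalized matrices -/

lemma IsLowerUnitriangular.det_eq_one {N : ℕ} {X : Matrix (Fin N) (Fin N) ℂ}
    (hX : IsLowerUnitriangular X) : X.det = 1 := by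
  rw [Matrix.det_of_isLowerTriangular X fun i j hij => hX.1 i j hij]
  exact Finset.prod_eq_one fun i _ => hX.2 i

/-- Changing the powers of `θ` by a diagonal factor. -/
lemma det_one_add_eq {n N : ℕ} (hn : n ≤ N) {θ : ℂ} (hθ : θ ≠ 0) {A B X Y : Matrix (Fin N) (Fin N) ℂ}
    {F F' : ℕ → ℕ → ℂ} (hA : IsLowerUnitriangular A) (hB : IsLowerUnitriangular B)
    (hX : A * X * B = toMatrix N fun i j => (if i = j ∧ i ≤ n then 1 else 0) + F i j)
    (hY : -(A * Y * B) = toMatrix N fun i j => (if i = j ∧ n < i then 1 else 0) + F' i j) :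
    (1 + toMatrix N fun i j =>
        (if n < i then θ else 1) * F i j + (if i ≤ n then θ⁻¹ else 1) * F' i j).det
      = (θ ^ n)⁻¹ * (θ • X - Y).det := by
  have h1 : (A * (θ • X - Y) * B) = θ • (A * X * B) + -(A * Y * B) := by
    rw [Matrix.mul_sub, Matrix.sub_mul, Matrix.mul_smul, Matrix.smul_mul, sub_eq_add_neg]
  have h2 : (θ • X - Y).det = (A * (θ • X - Y) * B).det := by
    rw [Matrix.det_mul, Matrix.det_mul, hA.det_eq_one, hB.det_eq_one, one_mul, mul_one]
  -- The prefactor `θ ^ (-n)` is spread as one `θ⁻¹` over each of the first `n` rows. There it turns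
  -- `θ (1 + F)` into `1 + F`; in the other rows the ones come from `F'`, free of `θ`.
  rw [h2, h1, hX, hY, ← inv_pow, ← prod_ite_lt hn, ← Matrix.det_mul_column]
  congr 1
  ext i j
  have hij : (i : ℕ) + 1 = j + 1 ↔ i = j := by rw [Nat.add_right_cancel_iff, Fin.ext_iff]
  simp only [toMatrix, Matrix.add_apply, Matrix.of_apply, Matrix.smul_apply, smul_eq_mul,
    Matrix.one_apply, hij]
  rcases Nat.lt_or_ge (i : ℕ) n with h | h
  · simp only [if_pos h, Nat.succ_le_of_lt h,
      not_lt.mpr (Nat.succ_le_of_lt h), and_true, and_false, if_false]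
    rw [mul_add, inv_mul_cancel_left₀ hθ]
    split_ifs <;> ring
  · simp only [if_neg (not_lt.mpr h), not_le.mpr (Nat.lt_succ_of_le h), Nat.lt_succ_of_le h,
      and_true, and_false, if_false, if_true]
    split_ifs <;> ring

end TwoTime

end

/-! ### The two-time formula -/

theorem theorem4
    {Ω : Type*} [MeasurableSpace Ω] (μ : MeasureTheory.Measure Ω)
    [MeasureTheory.IsProbabilityMeasure μ]
    (a b : ℕ → ℝ)
    (ha : ∀ i, 1 ≤ i → a i ∈ Set.Icc (0 : ℝ) 1)
    (hb : ∀ j, 1 ≤ j → b j ∈ Set.Icc (0 : ℝ) 1)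
    (hab : ∀ i j, 1 ≤ i → 1 ≤ j → 0 < a i * b j ∧ a i * b j < 1)
    -- the independent geometric weights
    (W : ℕ → ℕ → Ω → ℕ)
    (hWmeas : ∀ i j, 1 ≤ i → 1 ≤ j → Measurable (W i j))
    (hWindep : ProbabilityTheory.iIndepFun
      (fun p : ℕ × ℕ => W (p.1 + 1) (p.2 + 1)) μ)
    (hWlaw : ∀ i j, 1 ≤ i → 1 ≤ j → ∀ k : ℕ,
      μ.real {x | W i j x = k} = (1 - a i * b j) * (a i * b j) ^ k)
    (n N m M : ℕ) (hn : 1 ≤ n) (hnN : n < N) (hm : 1 ≤ m) (hmM : m < M)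
    (h H : ℤ)
    -- the contours: `γ` is around the points `1 / b_k`, the others are around `0` and the `a_k`
    (γ Γ Γout Γin : TwoTime.Contour)
    (hγ : ∀ k ∈ TwoTime.seg N, 1 / (b k : ℂ) ∈ γ.inside)
    (hΓ₀ : (0 : ℂ) ∈ Γ.inside) (hΓ : ∀ k ∈ TwoTime.seg M, (a k : ℂ) ∈ Γ.inside)
    (hΓin₀ : (0 : ℂ) ∈ Γin.inside) (hΓin : ∀ k ∈ TwoTime.seg M, (a k : ℂ) ∈ Γin.inside)
    (hnest : Γin.disc ⊆ Γout.inside)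
    (hdisj : Disjoint γ.disc Γ.disc) (hdisj' : Disjoint γ.disc Γout.disc)
    (s : ℝ) (hs : 1 < s)
    (Rin Rout : ℝ) (hRin : ∀ k ∈ TwoTime.seg N, 1 / b k < Rin) (hRout : Rin < Rout) :
    -- the two-time distribution function
    ((μ.real {x | TwoTime.growth 0 (fun i j => W i j x) m n < h ∧
          TwoTime.growth 0 (fun i j => W i j x) M N < H} : ℝ) : ℂ) =
      (TwoTime.Contour.centered s).integral (fun θ =>
        (1 + TwoTime.toMatrix N (fun i j =>
          (if n < i then θ else 1) * TwoTime.F₁ a b n N m M h H γ Γ Γout Γin i j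
            + (if i ≤ n then θ⁻¹ else 1) * TwoTime.F₂ a b n N m M h H γ Γ Γout Γin i j)).det
          / (θ - 1)) ∧
    -- the symmetry relating `F₂` to `F₁`
    (∀ i ∈ TwoTime.seg N, ∀ j ∈ TwoTime.seg N,
      TwoTime.F₁ a b n N m M h H γ Γ Γout Γin i j =
        TwoTime.F₁Set a b N M H γ Γ Γout Γin (TwoTime.seg i) (TwoTime.seg (j - 1))
          (TwoTime.seg n) (TwoTime.seg m) (h - 1) ∧
      TwoTime.F₂ a b n N m M h H γ Γ Γout Γin i j =
        TwoTime.F₁Set a b N M H γ Γ Γout Γin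
          (TwoTime.seg N \ TwoTime.seg (j - 1)) (TwoTime.seg N \ TwoTime.seg i)
          (TwoTime.seg N \ TwoTime.seg n) (TwoTime.seg M \ TwoTime.seg m) (H - h)) ∧
    -- the orthogonalization
    TwoTime.IsLowerUnitriangular (TwoTime.toMatrix N (TwoTime.A a b m h γ)) ∧
    TwoTime.IsLowerUnitriangular (TwoTime.toMatrix N (TwoTime.B a b m M h H γ)) ∧
    TwoTime.toMatrix N (TwoTime.A a b m h γ)
        * TwoTime.toMatrix N (TwoTime.L a b n m M h H Rout Rin)
        * TwoTime.toMatrix N (TwoTime.B a b m M h H γ) =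
      TwoTime.toMatrix N (fun i j => (if i = j ∧ i ≤ n then 1 else 0)
        + TwoTime.F₁ a b n N m M h H γ Γ Γout Γin i j) ∧
    -(TwoTime.toMatrix N (TwoTime.A a b m h γ)
        * TwoTime.toMatrix N (TwoTime.L a b n m M h H Rin Rout)
        * TwoTime.toMatrix N (TwoTime.B a b m M h H γ)) =
      TwoTime.toMatrix N (fun i j => (if i = j ∧ n < i then 1 else 0)
        + TwoTime.F₂ a b n N m M h H γ Γ Γout Γin i j) := by

  have hseg : ∀ {k l : ℕ}, k ∈ TwoTime.seg l → 1 ≤ k := fun hk => (TwoTime.mem_seg.mp hk).1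
  have hbpos : ∀ j, 1 ≤ j → 0 < b j := fun j hj =>
    pos_of_mul_pos_right (hab 1 j le_rfl hj).1 (ha 1 le_rfl).1
  have h1N : 1 ∈ TwoTime.seg N := TwoTime.mem_seg.mpr ⟨le_rfl, by omega⟩
  have hγ0 : 0 ≤ γ.radius := (TwoTime.Contour.radius_pos (hγ 1 h1N)).le
  have hgen : TwoTime.Generic a b N M := by
    refine ⟨fun k hk => Complex.ofReal_ne_zero.mpr (hbpos k (hseg hk)).ne', fun l hl k hk => ?_⟩
    have := (hab l k (hseg hl) (hseg hk)).2
    exact_mod_cast (sub_pos.mpr this).ne'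
  have hr : TwoTime.Exceeds a b N M Rin := by
    have hpos : 0 < 1 / b 1 := one_div_pos.mpr (hbpos 1 le_rfl)
    refine ⟨hpos.trans (hRin 1 h1N), fun k hk => ?_, fun k hk => ?_⟩
    · have hk' := one_div_pos.mpr (hbpos k (hseg hk))
      rw [← Complex.ofReal_one, ← Complex.ofReal_div, Complex.norm_of_nonneg hk'.le]
      exact hRin k hk
    -- The circles enclose the `a_k` as well, because `a_k b_1 < 1` means `a_k < 1 / b_1`.
    · rw [Complex.norm_of_nonneg (ha k (hseg hk)).1]
      refine lt_trans ?_ (hRin 1 h1N)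
      rw [lt_div_iff₀ (hbpos 1 le_rfl)]
      exact (hab k 1 (hseg hk) le_rfl).2
  have h0 : (0 : ℂ) ∉ γ.disc := fun hh =>
    Set.disjoint_left.mp hdisj hh (Γ.inside_subset_disc hΓ₀)
  have hΓ' : TwoTime.EnclosesZeros a M Γ := ⟨hΓ₀, hΓ⟩
  have hin : TwoTime.EnclosesZeros a M Γin := ⟨hΓin₀, hΓin⟩
  have hsub := Γin.inside_subset_disc.trans hnest
  have hout : TwoTime.EnclosesZeros a M Γout := ⟨hsub hΓin₀, fun k hk => hsub (hΓin k hk)⟩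
  have hA := TwoTime.isLowerUnitriangular_A hgen hγ hγ0 h0 hmM.le h
  have hB := TwoTime.isLowerUnitriangular_B (m := m) hgen hγ hγ0 h0 h H
  obtain ⟨h₁, h₂⟩ := TwoTime.A_mul_L_mul_B_eq hgen hγ hγ0 hΓ' hout hin hnest hdisj hdisj'
    hnN.le hmM.le h H hr hRout
  refine ⟨?_, fun i hi j hj => ⟨TwoTime.F₁_eq_F₁Set h H γ Γ Γout Γin i (hseg hj),
    TwoTime.F₂_eq_F₁Set hγ hγ0 hout hin hnest hdisj' hnN.le hmM.le h H (TwoTime.mem_seg.mp hi).2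
      (hseg hj) (TwoTime.mem_seg.mp hj).2⟩, hA, hB, h₁, h₂⟩
  rw [TwoTime.measureReal_growth hab hWmeas hWindep hWlaw hgen hn hnN.le hmM.le h H hr hRout hs]
  refine TwoTime.Contour.integral_congr (zero_le_one.trans hs.le) fun θ hθ => ?_
  have hθ0 : θ ≠ 0 := norm_pos_iff.mp (by rw [TwoTime.mem_bd_centered.mp hθ]; linarith)
  simp only [TwoTime.det_one_add_eq hnN.le hθ0 hA hB h₁ h₂]
  rw [div_mul_eq_mul_div]
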